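/- Let $n\ge 1$, let $B_n$ be the open unit ball of $\mathbb C^n$, $\langle w,z\rangle=\sum_j w_j\overline{z_j}$, and let $\sigma$ be the normalized rotation invariant measure on $\partial B_n$. For $0<s<\infty$ let $H^s$ be the space of holomorphic $f$ on $B_n$ with $\|f\|_s=\left(\sup_{0<r<1}\int_{\partial B_n}|f(r\xi)|^s\,d\sigma(\xi)\right)^{1/s}<\infty$. Let $0<p\le q<\infty$, let $\varphi:B_n\to B_n$ be holomorphic and let $\psi\in H^q$; write $\varphi^*,\psi^*$ for the radial limit functions (which exist $\sigma$-a.e. on $\partial B_n$), and put $W_{\psi,\varphi}f=\psi\cdot(f\circ\varphi)$. Let $\mu_{\psi,\varphi,q}$ be the measure on $\overline{B}_n$ given by $$\mu_{\psi,\varphi,q}(A)=\int_{(\varphi^*)^{-1}(A)}|\psi^*|^q\,d\sigma .$$ A finite positive measure $\mu$ on $\overline{B}_n$ is called a bounded $\beta$-Carleson measure ($\beta\ge1$) if there is a constant $M<\infty$ such that $\mu(S_h(\xi))\le M h^{n\beta}$ for all $\xi\in\partial B_n$ and $0<h<2$, where $S_h(\xi)=\{z\in\overline{B}_n: |1-\langle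 z,\xi\rangle|<h\}$. Then the following are equivalent: (i) $\mu_{\psi,\varphi,q}$ is a bounded $\frac qp$-Carleson measure; (ii) $W_{\psi,\varphi}:H^p\to H^q$ is bounded, i.e. there is $C<\infty$ such that $W_{\psi,\varphi}f\in H^q$ and $\|W_{\psi,\varphi}f\|_q\le C\|f\|_p$ for all $f\in H^p$; (iii) $$\sup_{z\in B_n}\int_{\overline{B}_n}\frac{(1-|z|^2)^{nq/p}}{|1-\langle w,z\rangle|^{2nq/p}}\,d\mu_{\psi,\varphi,q}(w)<\infty .$$ -/

import Mathlib

open MeasureTheory Filter Topology Set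
open scoped ENNReal NNReal

noncomputable section

namespace BallHardy

/-- `ℂⁿ` with its Hermitian inner product and Euclidean norm. Mathlib's inner product is conjugate
linear in the first variable, so the usual `⟨w, z⟩ = ∑ wⱼ conj zⱼ` is `inner ℂ z w`. -/
abbrev Cn (n : ℕ) : Type := EuclideanSpace ℂ (Fin n)

/-- The open unit ball of `ℂⁿ`. -/
abbrev unitBall (n : ℕ) : Set (Cn n) := Metric.ball 0 1

/-- The closed unit ball of `ℂⁿ`. -/
abbrev closedUnitBall (n : ℕ) : Set (Cn n) := Metric.closedBall 0 1

/-- The unit sphere of `ℂⁿ`. -/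
abbrev unitSphere (n : ℕ) : Set (Cn n) := Metric.sphere 0 1

/-- The normalized rotation invariant measure on the unit sphere: the surface measure
(obtained from Lebesgue measure on `ℂⁿ = ℝ²ⁿ` in polar coordinates) divided by its total mass. -/
def sphereMeasure (n : ℕ) : Measure (unitSphere n) :=
  ((volume : Measure (Cn n)).toSphere univ)⁻¹ • (volume : Measure (Cn n)).toSphere

/-- The quantity `‖f‖_p = (sup_{0<r<1} ∫ |f(rξ)|^p dσ(ξ))^{1/p}`, with values in `[0, ∞]`. -/
def hardyNorm {n : ℕ} (p : ℝ) (f : Cn n → ℂ) : ℝ≥0∞ :=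
  (⨆ r ∈ Ioo (0 : ℝ) 1, ∫⁻ ξ : unitSphere n, ‖f (r • (ξ : Cn n))‖ₑ ^ p ∂(sphereMeasure n)) ^ (1 / p)

/-- `f` belongs to the Hardy space `H^p` of the unit ball: it is holomorphic in the ball and
`‖f‖_p < ∞`. Only the values of `f` in the ball matter. -/
def MemHardy {n : ℕ} (p : ℝ) (f : Cn n → ℂ) : Prop :=
  DifferentiableOn ℂ f (unitBall n) ∧ hardyNorm p f < ∞

/-- `φ` is a holomorphic self-map of the unit ball. -/
def IsHolomorphicSelfMap {n : ℕ} (φ : Cn n → Cn n) : Prop :=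
  DifferentiableOn ℂ φ (unitBall n) ∧ MapsTo φ (unitBall n) (unitBall n)

/-- The radial limit function `F*(ξ) = lim_{r → 1⁻} F(rξ)` on the sphere (an arbitrary value is
taken where the limit does not exist; for functions of class `H^p` and for holomorphic self-maps
of the ball this happens only on a set of measure zero). -/
def radialLimit {n : ℕ} {F : Type*} [TopologicalSpace F] [Nonempty F] (f : Cn n → F)
    (ξ : unitSphere n) : F :=
  limUnder (𝓝[<] (1 : ℝ)) fun r : ℝ => f (r • (ξ : Cn n))

/-- The weighted composition operator `W_{ψ,φ} f = ψ · (f ∘ φ)`. -/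
def weightedComp {n : ℕ} (ψ : Cn n → ℂ) (φ : Cn n → Cn n) (f : Cn n → ℂ) : Cn n → ℂ :=
  fun z => ψ z * f (φ z)

/-- `W_{ψ,φ}` is a bounded operator from `H^p` to `H^q`. -/
def IsBoundedWeightedComp {n : ℕ} (p q : ℝ) (ψ : Cn n → ℂ) (φ : Cn n → Cn n) : Prop :=
  ∃ C : ℝ≥0, ∀ f : Cn n → ℂ, MemHardy p f →
    MemHardy q (weightedComp ψ φ f) ∧ hardyNorm q (weightedComp ψ φ f) ≤ C * hardyNorm p f

/-- The measure `μ_{ψ,φ,q}(A) = ∫_{(φ*)⁻¹(A)} |ψ*|^q dσ`, i.e. the image under `φ*` of the measure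
`|ψ*|^q dσ`, where `ψ*`, `φ*` are the radial limit functions. It is carried by the closed ball. -/
def pullbackMeasure {n : ℕ} (ψ : Cn n → ℂ) (φ : Cn n → Cn n) (q : ℝ) : Measure (Cn n) :=
  ((sphereMeasure n).withDensity fun ξ => ‖radialLimit ψ ξ‖ₑ ^ q).map (radialLimit φ)

/-- The Carleson set `S_h(ξ) = {z : |z| ≤ 1, |1 - ⟨z, ξ⟩| < h}`. -/
def carlesonSet {n : ℕ} (ξ : Cn n) (h : ℝ) : Set (Cn n) :=
  {z | z ∈ closedUnitBall n ∧ ‖1 - inner ℂ ξ z‖ < h}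

/-- A finite measure `μ` on the closed ball is a (bounded) `β`-Carleson measure if
`μ(S_h(ξ)) ≤ M h^{nβ}` for all `|ξ| = 1` and `0 < h < 2`, with a constant `M < ∞`. -/
def IsCarlesonMeasure {n : ℕ} (β : ℝ) (μ : Measure (Cn n)) : Prop :=
  IsFiniteMeasure μ ∧ ∃ M : ℝ≥0, ∀ ξ ∈ unitSphere n, ∀ h ∈ Ioo (0 : ℝ) 2,
    μ (carlesonSet ξ h) ≤ M * ENNReal.ofReal (h ^ ((n : ℝ) * β))

end BallHardy

end

/-! The three conditions are closed into a cycle (i) ⇒ (ii) ⇒ (iii) ⇒ (i), and only the first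
implication is deep.

(i) ⇒ (ii) is a Carleson embedding. For `f` holomorphic across the sphere and any `s > 0`, `|f|^s`
is at most a constant times the Poisson–Szegő integral of its boundary values
(`exists_poisson_szego_bound`). Cutting the kernel dyadically shows that wherever `|f|^s` is large,
some nonisotropic ball above that point carries a large mean of `|f|^s`; the point then lies in a
`tentSet` (`exists_mem_tentSet`). A Vitali covering and the Carleson condition bound the measure of
tent sets by the power `q/p ≥ 1` of an `L¹` norm (`measure_tentSet_le`), and Marcinkiewicz
interpolation with the trivial `L^∞` bound turns this into an `L²` to `L^{2q/p}` estimate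
(`exists_strong_type`). Taking `s = p/2` gives `∫ |f|^q dμ ≤ C ‖f‖_p^q`. For `μ = μ_{ψ,φ,q}` the
left side is `∫ |ψ*·(f∘φ*)|^q dσ`, which dominates the means of `W_{ψ,φ} f`. A general `f` is
reached through its dilates and Fatou's lemma.

The Poisson–Szegő bound has an elementary source. In the disc `|F|^s` lies below its Poisson
integral, so its means over circles, and by slicing those over spheres, increase with the radius.
Averaging over an ellipsoid adapted to the nonisotropic geometry gives `|f(z)|^s ≤ C (1-|z|)^{-n}
‖f‖_s^s` (`exists_point_evaluation_bound`); applied to `f` times a power of the Szegő kernel, this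
becomes the Poisson–Szegő bound.

Radial limits are obtained along the way. The strong type estimate with `μ = σ` is the radial
maximal theorem. On slices an integrable maximal function makes `f` a quotient of two bounded
functions, and for bounded functions Fatou's theorem follows from a.e. differentiability of a
Lipschitz primitive.

(ii) ⇒ (iii) tests the operator on powers of the Szegő kernel, whose `H^p` norms are controlled by
the same dyadic kernel estimate. (iii) ⇒ (i) holds because on `S_h(ξ)` the kernel with pole at
`(1-h/2)ξ` is at least a constant times `h^{-nq/p}`. -/

noncomputable section

namespace BallHardy

/-! ### The unit disc: subharmonicity of `log |F|` through the maximum principle. -/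

section Disc

open Real Complex

/-- Real continuous functions on the unit circle are uniform limits of real parts of
entire functions. -/
theorem exists_entire_re_approx (u : ℂ → ℝ) (hu : ContinuousOn u (Metric.sphere 0 1))
    {ε : ℝ} (hε : 0 < ε) :
    ∃ P : ℂ → ℂ, Differentiable ℂ P ∧ ∀ z ∈ Metric.sphere (0 : ℂ) 1, |u z - (P z).re| ≤ ε := by
  have : Fact (0 < 2 * π) := ⟨by positivity⟩
  let v : C(AddCircle (2 * π), ℂ) :=
    ⟨fun x => (u (AddCircle.toCircle x) : ℂ), by
      refine Complex.continuous_ofReal.comp ?_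
      exact hu.comp_continuous (by fun_prop) (fun x => by simp [Circle.norm_coe])⟩
  have hv : v ∈ (Submodule.span ℂ (range (fourier (T := 2 * π)))).topologicalClosure := by
    rw [span_fourier_closure_eq_top]; trivial
  have key : ∀ T ∈ Submodule.span ℂ (range (fourier (T := 2 * π))),
      ∃ P Q : ℂ → ℂ, Differentiable ℂ P ∧ Differentiable ℂ Q ∧
        ∀ x, T x = P (AddCircle.toCircle x) + (starRingEnd ℂ) (Q (AddCircle.toCircle x)) := by
    intro T hT
    induction hT using Submodule.span_induction with
    | mem T hT =>
      obtain ⟨k, rfl⟩ := hT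
      rcases Int.le_total 0 k with hk | hk
      · obtain ⟨m, rfl⟩ := Int.eq_ofNat_of_zero_le hk
        refine ⟨fun z => z ^ m, fun _ => 0, by fun_prop, by fun_prop, fun x => ?_⟩
        simp [fourier_apply, AddCircle.toCircle_nsmul]
      · obtain ⟨m, hm⟩ := Int.eq_ofNat_of_zero_le (neg_nonneg.2 hk)
        obtain rfl : k = -(m : ℤ) := by omega
        refine ⟨fun _ => 0, fun z => z ^ m, by fun_prop, by fun_prop, fun x => ?_⟩
        simp [fourier_apply, AddCircle.toCircle_nsmul, AddCircle.toCircle_neg, ← Circle.coe_inv_eq_conj]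
    | zero => exact ⟨fun _ => 0, fun _ => 0, by fun_prop, by fun_prop, by simp⟩
    | add S T _ _ hS hT =>
      obtain ⟨P, Q, hP, hQ, h⟩ := hS
      obtain ⟨P', Q', hP', hQ', h'⟩ := hT
      refine ⟨P + P', Q + Q', by fun_prop, by fun_prop, fun x => ?_⟩
      simp only [ContinuousMap.add_apply, h, h', Pi.add_apply, map_add]; ring
    | smul c T _ hT =>
      obtain ⟨P, Q, hP, hQ, h⟩ := hT
      refine ⟨c • P, (starRingEnd ℂ c) • Q, by fun_prop, by fun_prop, fun x => ?_⟩
      simp [h, mul_add]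
  obtain ⟨T, hT, hd⟩ := Metric.mem_closure_iff.1 hv ε hε
  obtain ⟨P, Q, hP, hQ, h⟩ := key T hT
  -- Since `Re (P + conj Q) = Re (P + Q)` and `u` is real, the antiholomorphic half can be replaced
  -- by its conjugate.
  refine ⟨P + Q, by fun_prop, fun z hz => ?_⟩
  obtain ⟨x, hx⟩ : ∃ x : AddCircle (2 * π), (AddCircle.toCircle x : ℂ) = z := by
    have hz' : ‖z‖ = 1 := by simpa using hz
    refine ⟨((Complex.arg z : ℝ) : AddCircle (2 * π)), ?_⟩
    rw [AddCircle.toCircle_apply_mk]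
    have h2 : 2 * π / (2 * π) = 1 := by field_simp
    rw [h2, one_mul, Circle.coe_exp]
    conv_rhs => rw [← Complex.norm_mul_exp_arg_mul_I z, hz']
    simp
  have h1 : ‖v x - T x‖ ≤ ε := by
    rw [← dist_eq_norm]
    exact (ContinuousMap.dist_apply_le_dist x).trans hd.le
  have h2 := (Complex.abs_re_le_norm (v x - T x)).trans h1
  have h3 : (v x - T x).re = u z - ((P + Q) z).re := by
    rw [h x, hx]
    change ((u (AddCircle.toCircle x) : ℂ) - _).re = _
    rw [hx]
    simp
  rwa [h3] at h2

theorem circleAverage_poissonKernel_eq_one {w : ℂ} (hw : w ∈ Metric.ball (0 : ℂ) 1) :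
    circleAverage (poissonKernel 0 w) 0 1 = 1 := by
  have h := InnerProductSpace.HarmonicOnNhd.circleAverage_poissonKernel_smul (R := 1) (c := 0)
    (f := fun _ => (1 : ℝ)) (w := w) (fun x _ => by
      simp) hw
  rwa [show (poissonKernel 0 w • fun _ => (1 : ℝ)) = poissonKernel 0 w by ext; simp] at h

theorem poissonKernel_nonneg {w z : ℂ} (hw : w ∈ Metric.ball (0 : ℂ) 1)
    (hz : z ∈ Metric.sphere (0 : ℂ) 1) : 0 ≤ poissonKernel 0 w z := by
  rw [poissonKernel_def]
  have h1 : ‖w‖ < 1 := by simpa using hw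
  have h2 : ‖z‖ = 1 := by simpa using hz
  refine div_nonneg ?_ (by positivity)
  simp only [sub_zero, h2]
  nlinarith [norm_nonneg w]

theorem continuousOn_poissonKernel {w : ℂ} (hw : w ∈ Metric.ball (0 : ℂ) 1) :
    ContinuousOn (poissonKernel 0 w) (Metric.sphere 0 1) := by
  have h : ContinuousOn (herglotzRieszKernel 0 w) (Metric.sphere 0 |1|) :=
    continuousOn_herglotzRieszKernel_sphere hw
  rw [poissonKernel_eq_re_herglotzRieszKernel]
  rw [abs_one] at h
  exact Complex.continuous_re.comp_continuousOn h

/-- If `u` is nearly `Re P` on the circle, then `F · exp (-P)` is nearly bounded by `1` there, hence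
inside by the maximum principle; and `Re P` is its own Poisson integral. This avoids a theory of
subharmonic functions and any discussion of the zeros of `F`. -/
theorem norm_le_exp_poisson {F : ℂ → ℂ} (hF : DiffContOnCl ℂ F (Metric.ball 0 1)) {u : ℂ → ℝ}
    (hu : ContinuousOn u (Metric.sphere 0 1))
    (hFu : ∀ z ∈ Metric.sphere (0 : ℂ) 1, ‖F z‖ ≤ Real.exp (u z))
    {w : ℂ} (hw : w ∈ Metric.ball (0 : ℂ) 1) :
    ‖F w‖ ≤ Real.exp (circleAverage (poissonKernel 0 w * u) 0 1) := by
  set I := circleAverage (poissonKernel 0 w * u) 0 1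
  have main : ∀ ε > 0, ‖F w‖ ≤ Real.exp (I + 2 * ε) := by
    intro ε hε
    obtain ⟨P, hP, hPu⟩ := exists_entire_re_approx u hu hε
    have h1 : ‖F w * Complex.exp (-P w)‖ ≤ Real.exp ε := by
      refine Complex.norm_le_of_forall_mem_frontier_norm_le (U := Metric.ball 0 1)
        (f := fun w => F w * Complex.exp (-P w)) Metric.isBounded_ball ?_ ?_ (subset_closure hw)
      · exact DiffContOnCl.smul hF ((hP.neg.cexp).diffContOnCl)
      · intro z hz
        rw [frontier_ball _ one_ne_zero] at hz
        rw [norm_mul, Complex.norm_exp]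
        calc ‖F z‖ * Real.exp (-P z).re ≤ Real.exp (u z) * Real.exp (-P z).re := by
              gcongr; exact hFu z hz
          _ = Real.exp (u z - (P z).re) := by rw [← Real.exp_add]; simp [sub_eq_add_neg]
          _ ≤ _ := Real.exp_le_exp.2 ((le_abs_self _).trans (hPu z hz))
    have h2 : (P w).re ≤ I + ε := by
      have hh : InnerProductSpace.HarmonicOnNhd (fun z => (P z).re) (Metric.closedBall 0 1) :=
        fun z _ => ((hP.analyticAt z).harmonicAt_re)
      rw [← hh.circleAverage_poissonKernel_smul hw]
      have hc1 := continuousOn_poissonKernel hw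
      have hc2 : Continuous fun z => (P z).re := Complex.continuous_re.comp hP.continuous
      have hi : CircleIntegrable (poissonKernel 0 w * u) 0 1 :=
        (ContinuousOn.mul hc1 hu).circleIntegrable zero_le_one
      have hi2 : CircleIntegrable (poissonKernel 0 w) 0 1 := hc1.circleIntegrable zero_le_one
      have e : I + ε = circleAverage (poissonKernel 0 w * u + ε • poissonKernel 0 w) 0 1 := by
        rw [circleAverage_add hi (hi2.const_smul), circleAverage_smul,
          circleAverage_poissonKernel_eq_one hw]
        simp [I]
      rw [e]
      refine circleAverage_mono ?_ ?_ ?_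
      · exact (ContinuousOn.mul hc1 hc2.continuousOn).circleIntegrable zero_le_one
      · exact hi.add hi2.const_smul
      · intro z hz
        rw [abs_one] at hz
        have hp := poissonKernel_nonneg hw hz
        have := abs_le.1 (hPu z hz)
        simp only [Pi.smul_apply', Pi.add_apply, Pi.mul_apply, Pi.smul_apply, smul_eq_mul]
        nlinarith
    have h3 : ‖F w‖ = ‖F w * Complex.exp (-P w)‖ * Real.exp (P w).re := by
      rw [norm_mul, Complex.norm_exp, mul_assoc, ← Real.exp_add]; simp
    rw [h3]
    calc _ ≤ Real.exp ε * Real.exp (I + ε) := by gcongr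
      _ = _ := by rw [← Real.exp_add]; ring_nf
  have hlim : Tendsto (fun ε : ℝ => Real.exp (I + 2 * ε)) (𝓝[>] 0) (𝓝 (Real.exp I)) := by
    have : Continuous fun ε : ℝ => Real.exp (I + 2 * ε) := by fun_prop
    simpa using (this.tendsto 0).mono_left nhdsWithin_le_nhds
  exact ge_of_tendsto hlim (eventually_mem_nhdsWithin.mono fun ε hε => main ε hε)

end Disc

/-! ### The unit disc: Poisson majorants of `|F|^s` and monotone circular means. -/

section Disc

open Real Complex

/-- The normalized length measure on `(0, 2π]`. -/
def arcMeasure : Measure ℝ := (ENNReal.ofReal (2 * π))⁻¹ • volume.restrict (Ioc 0 (2 * π))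

instance : IsProbabilityMeasure arcMeasure := ⟨by
  have h : ENNReal.ofReal (2 * π) ≠ 0 := by simp [Real.pi_pos]
  simp only [arcMeasure, Measure.smul_apply, Measure.restrict_apply, MeasurableSet.univ, univ_inter,
    Real.volume_Ioc, sub_zero, smul_eq_mul]
  exact ENNReal.inv_mul_cancel h ENNReal.ofReal_ne_top⟩

theorem circleAverage_eq_integral_arcMeasure (g : ℂ → ℝ) (c : ℂ) (R : ℝ) :
    circleAverage g c R = ∫ θ, g (circleMap c R θ) ∂arcMeasure := by
  rw [circleAverage_def, arcMeasure, integral_smul_measure,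
    intervalIntegral.integral_of_le (by positivity), ENNReal.toReal_inv,
    ENNReal.toReal_ofReal (by positivity)]

theorem circleIntegrable_iff_integrable_arcMeasure {g : ℂ → ℝ} {c : ℂ} {R : ℝ} :
    CircleIntegrable g c R ↔ Integrable (fun θ => g (circleMap c R θ)) arcMeasure := by
  rw [circleIntegrable_def, intervalIntegrable_iff_integrableOn_Ioc_of_le (by positivity),
    arcMeasure, integrable_smul_measure (ENNReal.inv_ne_zero.2 ENNReal.ofReal_ne_top)
      (by simp [Real.pi_pos]), IntegrableOn]

theorem ofReal_circleAverage {g : ℂ → ℝ} {c : ℂ} {R : ℝ} (hg : CircleIntegrable g c R)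
    (h0 : ∀ θ, 0 ≤ g (circleMap c R θ)) :
    ENNReal.ofReal (circleAverage g c R) =
      ∫⁻ θ, ENNReal.ofReal (g (circleMap c R θ)) ∂arcMeasure := by
  rw [circleAverage_eq_integral_arcMeasure]
  exact ofReal_integral_eq_lintegral_ofReal (circleIntegrable_iff_integrable_arcMeasure.1 hg)
    (Eventually.of_forall h0)

theorem circleMap_mem_unitSphere (θ : ℝ) : circleMap 0 1 θ ∈ Metric.sphere (0 : ℂ) 1 :=
  circleMap_mem_sphere _ zero_le_one _

/-- `|F|^s` is dominated by the Poisson integral of its boundary values. -/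
theorem norm_rpow_le_circleAverage_poisson {F : ℂ → ℂ} (hF : DiffContOnCl ℂ F (Metric.ball 0 1))
    {s : ℝ} (hs : 0 < s) {w : ℂ} (hw : w ∈ Metric.ball (0 : ℂ) 1) :
    ‖F w‖ ^ s ≤ circleAverage (poissonKernel 0 w * fun z => ‖F z‖ ^ s) 0 1 := by
  refine le_of_forall_pos_le_add fun ε hε => ?_
  have hFc : ContinuousOn F (Metric.sphere 0 1) := by
    refine hF.continuousOn.mono ?_
    rw [closure_ball _ one_ne_zero]
    exact Metric.sphere_subset_closedBall
  -- Adding `ε` keeps the logarithm finite and continuous at the zeros of `F`.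
  set v : ℂ → ℝ := fun z => ‖F z‖ ^ s + ε
  have hvpos : ∀ z, 0 < v z := fun z => by positivity
  have hvc : ContinuousOn v (Metric.sphere 0 1) :=
    (hFc.norm.rpow_const fun _ _ => Or.inr hs.le).add continuousOn_const
  set u : ℂ → ℝ := fun z => Real.log (v z) / s
  have huc : ContinuousOn u (Metric.sphere 0 1) :=
    (hvc.log fun z _ => (hvpos z).ne').div_const s
  have hexp : ∀ z, Real.exp (s * u z) = v z := fun z => by
    simp only [u]
    rw [mul_div_cancel₀ _ hs.ne', Real.exp_log (hvpos z)]
  have h1 := norm_le_exp_poisson hF huc (fun z _ => by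
    have : ‖F z‖ ^ s ≤ (Real.exp (u z)) ^ s := by
      rw [← Real.exp_mul, mul_comm, hexp]; simp [v, hε.le]
    exact (Real.rpow_le_rpow_iff (norm_nonneg _) (Real.exp_pos _).le hs).1 this) hw
  set I := circleAverage (poissonKernel 0 w * u) 0 1
  have h2 : ‖F w‖ ^ s ≤ Real.exp (s * I) := by
    calc ‖F w‖ ^ s ≤ (Real.exp I) ^ s := by gcongr
      _ = _ := by rw [← Real.exp_mul, mul_comm]
  have hP := continuousOn_poissonKernel hw
  have ci : ∀ {k : ℂ → ℝ}, ContinuousOn k (Metric.sphere 0 1) → CircleIntegrable k 0 1 :=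
    fun hk => hk.circleIntegrable zero_le_one
  have h3 : Real.exp (s * I) ≤ circleAverage (poissonKernel 0 w * v) 0 1 := by
    set E := Real.exp (s * I)
    have e : E = circleAverage ((E * (1 - s * I)) • poissonKernel 0 w +
        (E * s) • (poissonKernel 0 w * u)) 0 1 := by
      rw [circleAverage_add (ci hP).const_smul (ci (hP.mul huc)).const_smul, circleAverage_smul,
        circleAverage_smul, circleAverage_poissonKernel_eq_one hw]
      simp only [smul_eq_mul, I]; ring
    rw [e]
    refine circleAverage_mono ((ci hP).const_smul.add (ci (hP.mul huc)).const_smul)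
      (ci (hP.mul hvc)) fun z hz => ?_
    rw [abs_one] at hz
    have hp := poissonKernel_nonneg hw hz
    -- Jensen's inequality for the Poisson probability measure: the graph of `exp` lies above its
    -- tangent at the mean value `s * I`.
    have ht : E * (1 - s * I) + E * s * u z ≤ v z := by
      rw [← hexp z]
      have := Real.add_one_le_exp (s * u z - s * I)
      have h4 : Real.exp (s * u z) = E * Real.exp (s * u z - s * I) := by
        rw [← Real.exp_add]; ring_nf
      rw [h4]
      have hE : 0 < E := Real.exp_pos _
      nlinarith
    simp only [Pi.add_apply, Pi.smul_apply, Pi.mul_apply, smul_eq_mul]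
    nlinarith
  have h4 : circleAverage (poissonKernel 0 w * v) 0 1 =
      circleAverage (poissonKernel 0 w * fun z => ‖F z‖ ^ s) 0 1 + ε := by
    have hs' : ContinuousOn (fun z => ‖F z‖ ^ s) (Metric.sphere 0 1) :=
      hFc.norm.rpow_const fun _ _ => Or.inr hs.le
    have : poissonKernel 0 w * v = (poissonKernel 0 w * fun z => ‖F z‖ ^ s) +
        ε • poissonKernel 0 w := by
      ext z; simp [v]; ring
    rw [this, circleAverage_add (ci (hP.mul hs')) (ci hP).const_smul, circleAverage_smul,
      circleAverage_poissonKernel_eq_one hw]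
    simp
  linarith

theorem mul_circleMap_mem_ball {t : ℝ} (ht0 : 0 ≤ t) (ht : t < 1) (θ : ℝ) :
    (t : ℂ) * circleMap 0 1 θ ∈ Metric.ball (0 : ℂ) 1 := by
  simp [circleMap_zero, abs_of_nonneg ht0, ht]

/-- Both denominators agree because `|a - t b| = |b - t a|` for unimodular `a`, `b` and real `t`.
The symmetry lets the kernel be integrated to `1` in its other variable. -/
theorem poissonKernel_symm (t : ℝ) (θ α : ℝ) :
    poissonKernel 0 (t * circleMap 0 1 θ) (circleMap 0 1 α) =
      poissonKernel 0 (t * circleMap 0 1 α) (circleMap 0 1 θ) := by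
  have hn : ∀ θ, ‖circleMap 0 1 θ‖ = 1 := fun θ => by simp
  have h1 : ∀ θ, circleMap 0 1 θ * (starRingEnd ℂ) (circleMap 0 1 θ) = 1 := fun θ => by
    rw [Complex.mul_conj, Complex.normSq_eq_norm_sq, hn]; simp
  have key : ∀ a b : ℂ, a * (starRingEnd ℂ) a = 1 → b * (starRingEnd ℂ) b = 1 →
      ‖a - t * b‖ ^ 2 = ‖b - t * a‖ ^ 2 := by
    intro a b ha hb
    have : ((‖a - t * b‖ ^ 2 : ℝ) : ℂ) = ((‖b - t * a‖ ^ 2 : ℝ) : ℂ) := by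
      rw [← Complex.normSq_eq_norm_sq, ← Complex.normSq_eq_norm_sq, ← Complex.mul_conj,
        ← Complex.mul_conj]
      simp only [map_sub, map_mul, Complex.conj_ofReal]
      linear_combination (1 - (t : ℂ) ^ 2) * ha - (1 - (t : ℂ) ^ 2) * hb
    exact_mod_cast this
  rw [poissonKernel_def, poissonKernel_def]
  simp only [sub_zero, norm_mul, hn]
  rw [key _ _ (h1 α) (h1 θ)]

theorem lintegral_poissonKernel_eq_one {w : ℂ} (hw : w ∈ Metric.ball (0 : ℂ) 1) :
    ∫⁻ α, ENNReal.ofReal (poissonKernel 0 w (circleMap 0 1 α)) ∂arcMeasure = 1 := by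
  rw [← ofReal_circleAverage ((continuousOn_poissonKernel hw).circleIntegrable zero_le_one)
    (fun θ => poissonKernel_nonneg hw (circleMap_mem_unitSphere θ)),
    circleAverage_poissonKernel_eq_one hw, ENNReal.ofReal_one]

theorem lintegral_lintegral_poissonKernel {t : ℝ} (ht0 : 0 ≤ t) (ht : t < 1) {G : ℝ → ℝ≥0∞}
    (hG : AEMeasurable G arcMeasure) :
    ∫⁻ θ, ∫⁻ α, ENNReal.ofReal (poissonKernel 0 (t * circleMap 0 1 θ) (circleMap 0 1 α)) * G α
      ∂arcMeasure ∂arcMeasure = ∫⁻ α, G α ∂arcMeasure := by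
  let K : ℝ → ℝ → ℝ≥0∞ := fun θ α =>
    ENNReal.ofReal (poissonKernel 0 (t * circleMap 0 1 θ) (circleMap 0 1 α))
  have hc : Measurable (Function.uncurry K) := by
    refine ENNReal.measurable_ofReal.comp ?_
    simp only [poissonKernel_def]
    refine Measurable.div ?_ ?_
    · exact Continuous.measurable (by fun_prop)
    · exact Continuous.measurable (by fun_prop)
  have hm : AEMeasurable (Function.uncurry fun θ α => K θ α * G α) (arcMeasure.prod arcMeasure) :=
    hc.aemeasurable.mul hG.comp_snd
  have hK : ∀ α, ∫⁻ θ, K θ α ∂arcMeasure = 1 := fun α => by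
    simp_rw [K, poissonKernel_symm t _ α]
    exact lintegral_poissonKernel_eq_one (mul_circleMap_mem_ball ht0 ht α)
  calc ∫⁻ θ, ∫⁻ α, K θ α * G α ∂arcMeasure ∂arcMeasure
      = ∫⁻ α, ∫⁻ θ, K θ α * G α ∂arcMeasure ∂arcMeasure := lintegral_lintegral_swap hm
    _ = ∫⁻ α, G α ∂arcMeasure := lintegral_congr fun α => by
        have hα : Measurable fun θ => K θ α := hc.of_uncurry_right
        rw [lintegral_mul_const _ hα, hK, one_mul]

theorem lintegral_circle_le_of_diffContOnCl {F : ℂ → ℂ} (hF : DiffContOnCl ℂ F (Metric.ball 0 1))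
    {s : ℝ} (hs : 0 < s) {t : ℝ} (ht0 : 0 ≤ t) (ht : t < 1) :
    ∫⁻ θ, ‖F (t * circleMap 0 1 θ)‖ₑ ^ s ∂arcMeasure ≤
      ∫⁻ θ, ‖F (circleMap 0 1 θ)‖ₑ ^ s ∂arcMeasure := by
  have hFc : ContinuousOn F (Metric.sphere 0 1) := by
    refine hF.continuousOn.mono ?_
    rw [closure_ball _ one_ne_zero]
    exact Metric.sphere_subset_closedBall
  have hFc' : Continuous fun θ => F (circleMap 0 1 θ) :=
    hFc.comp_continuous (by fun_prop) circleMap_mem_unitSphere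
  have hconv : ∀ z : ℂ, ‖z‖ₑ ^ s = ENNReal.ofReal (‖z‖ ^ s) := fun z => by
    rw [← ofReal_norm, ENNReal.ofReal_rpow_of_nonneg (norm_nonneg _) hs.le]
  rw [← lintegral_lintegral_poissonKernel (G := fun θ => ‖F (circleMap 0 1 θ)‖ₑ ^ s) ht0 ht
    (by exact (hFc'.measurable.enorm.pow_const s).aemeasurable)]
  refine lintegral_mono fun θ => ?_
  have hw := mul_circleMap_mem_ball ht0 ht θ
  have hs' : ContinuousOn (fun z => ‖F z‖ ^ s) (Metric.sphere 0 1) :=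
    hFc.norm.rpow_const fun _ _ => Or.inr hs.le
  rw [hconv]
  refine (ENNReal.ofReal_le_ofReal (norm_rpow_le_circleAverage_poisson hF hs hw)).trans ?_
  rw [ofReal_circleAverage (((continuousOn_poissonKernel hw).mul hs').circleIntegrable zero_le_one)]
  · refine lintegral_mono fun α => ?_
    simp only [Pi.mul_apply]
    rw [ENNReal.ofReal_mul (poissonKernel_nonneg hw (circleMap_mem_unitSphere α)), hconv]
  · intro α
    exact mul_nonneg (poissonKernel_nonneg hw (circleMap_mem_unitSphere α)) (by positivity)

/-- The means of `|F|^s` over concentric circles increase with the radius. -/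
theorem lintegral_circle_mono {F : ℂ → ℂ} (hF : DifferentiableOn ℂ F (Metric.ball 0 1))
    {s : ℝ} (hs : 0 < s) {t r : ℝ} (ht0 : 0 ≤ t) (htr : t ≤ r) (hr : r < 1) :
    ∫⁻ θ, ‖F (t * circleMap 0 1 θ)‖ₑ ^ s ∂arcMeasure ≤
      ∫⁻ θ, ‖F (r * circleMap 0 1 θ)‖ₑ ^ s ∂arcMeasure := by
  rcases htr.eq_or_lt with rfl | hlt
  · exact le_rfl
  have hr0 : 0 < r := ht0.trans_lt hlt
  have hm : MapsTo (fun z : ℂ => (r : ℂ) * z) (Metric.closedBall 0 1) (Metric.ball 0 1) := by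
    intro z hz
    have hz' : ‖z‖ ≤ 1 := by simpa using hz
    simp only [mem_ball_zero_iff, norm_mul, Complex.norm_real, Real.norm_eq_abs, abs_of_pos hr0]
    nlinarith [norm_nonneg z]
  have hd : DiffContOnCl ℂ (fun z : ℂ => F (r * z)) (Metric.ball 0 1) := by
    refine DifferentiableOn.diffContOnCl ?_
    rw [closure_ball _ one_ne_zero]
    exact hF.comp (by fun_prop) hm
  have h := lintegral_circle_le_of_diffContOnCl hd hs (t := t / r) (by positivity)
    ((div_lt_one hr0).2 hlt)
  have e : ∀ θ, (r : ℂ) * (((t / r : ℝ) : ℂ) * circleMap 0 1 θ) = t * circleMap 0 1 θ := fun θ => by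
    have : (r : ℂ) ≠ 0 := by exact_mod_cast hr0.ne'
    push_cast; field_simp
  simpa only [e] using h

end Disc

/-! ### The unit disc: Fatou's theorem for bounded holomorphic functions. -/

section Disc

open Real Complex

theorem norm_sub_one_le_norm_one_add_sub {z : ℂ} (hz : ‖z‖ ≤ 1) {δ : ℝ} (hδ : 0 ≤ δ) :
    ‖z - 1‖ ≤ ‖(1 + δ : ℂ) - z‖ := by
  have h1 : z.re ≤ 1 := (Complex.re_le_norm z).trans hz
  rw [← sq_le_sq₀ (norm_nonneg _) (norm_nonneg _), ← Complex.normSq_eq_norm_sq,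
    ← Complex.normSq_eq_norm_sq, Complex.normSq_apply, Complex.normSq_apply]
  simp
  nlinarith

theorem norm_half_one_add_sq {z : ℂ} (hz : ‖z‖ = 1) :
    ‖(1 + z) / 2‖ ^ 2 = 1 - ‖z - 1‖ ^ 2 / 4 := by
  have h1 : z.re * z.re + z.im * z.im = 1 := by
    rw [← Complex.normSq_apply, Complex.normSq_eq_norm_sq, hz]; norm_num
  simp only [norm_div, div_pow, ← Complex.normSq_eq_norm_sq, Complex.normSq_apply]
  simp
  linarith

/-- A holomorphic function on the disc that is `o(|ζ - 1|)` on the circle is `o(|z - 1|)`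
in the disc. -/
theorem littleO_disc_of_littleO_circle {G : ℂ → ℂ} (hG : DiffContOnCl ℂ G (Metric.ball 0 1))
    {M : ℝ} (hM : ∀ ζ ∈ Metric.sphere (0 : ℂ) 1, ‖G ζ‖ ≤ M * ‖ζ - 1‖)
    (ho : ∀ ε > 0, ∃ η > 0, ∀ ζ ∈ Metric.sphere (0 : ℂ) 1, ‖ζ - 1‖ < η → ‖G ζ‖ ≤ ε * ‖ζ - 1‖)
    {ε : ℝ} (hε : 0 < ε) :
    ∃ η > 0, ∀ z ∈ Metric.ball (0 : ℂ) 1, ‖z - 1‖ < η → ‖G z‖ ≤ ε * ‖z - 1‖ := by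
  obtain ⟨η₀, hη₀, ho⟩ := ho (ε / 2) (by positivity)
  set η := min η₀ 1
  have hη : 0 < η := by positivity
  have hη1 : η ≤ 1 := min_le_right _ _
  set c := 1 - η ^ 2 / 4
  have hc0 : 0 ≤ c := by simp only [c]; nlinarith
  have hc1 : c < 1 := by simp only [c]; nlinarith
  -- The peak function `(1 + z) / 2` has modulus at most `√c < 1` on the circle at distance `≥ η`
  -- from `1`. A high power of it makes the bound with the large constant `M` harmless there, and
  -- equals `1` at the point `1`.
  obtain ⟨N, hN⟩ : ∃ N : ℕ, M * c ^ N < ε / 2 := by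
    have := (tendsto_pow_atTop_nhds_zero_of_lt_one hc0 hc1).const_mul M
    rw [mul_zero] at this
    exact (this.eventually (gt_mem_nhds (by positivity))).exists
  have hbd : ∀ ζ ∈ Metric.sphere (0 : ℂ) 1, ‖G ζ * ((1 + ζ) / 2) ^ (2 * N)‖ ≤ ε / 2 * ‖ζ - 1‖ := by
    intro ζ hζ
    have hζ1 : ‖ζ‖ = 1 := by simpa using hζ
    have hq := norm_half_one_add_sq hζ1
    rw [norm_mul, norm_pow, pow_mul, hq]
    have hq0 : 0 ≤ 1 - ‖ζ - 1‖ ^ 2 / 4 := by rw [← hq]; positivity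
    rcases lt_or_ge ‖ζ - 1‖ η with h | h
    · have h1 : (1 - ‖ζ - 1‖ ^ 2 / 4) ^ N ≤ 1 :=
        pow_le_one₀ hq0 (by nlinarith [sq_nonneg ‖ζ - 1‖])
      calc _ ≤ (ε / 2 * ‖ζ - 1‖) * 1 := by
            gcongr
            exact ho ζ hζ (h.trans_le (min_le_left _ _))
        _ = _ := mul_one _
    · have h1 : (1 - ‖ζ - 1‖ ^ 2 / 4) ^ N ≤ c ^ N := by
        refine pow_le_pow_left₀ hq0 ?_ N
        simp only [c]; nlinarith
      calc _ ≤ (M * ‖ζ - 1‖) * c ^ N := by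
            gcongr
            · exact (norm_nonneg _).trans (hM ζ hζ)
            · exact hM ζ hζ
        _ = (M * c ^ N) * ‖ζ - 1‖ := by ring
        _ ≤ _ := by gcongr
  have hin : ∀ z ∈ Metric.ball (0 : ℂ) 1, ‖G z * ((1 + z) / 2) ^ (2 * N)‖ ≤ ε / 2 * ‖z - 1‖ := by
    intro z hz
    -- Dividing by `1 + δ - z` instead of `1 - z` keeps the quotient continuous on the closed disc,
    -- so that the maximum principle applies; then `δ → 0`.
    have hδ : ∀ δ > (0 : ℝ),
        ‖G z * ((1 + z) / 2) ^ (2 * N)‖ ≤ ε / 2 * ‖(1 + δ : ℂ) - z‖ := by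
      intro δ hδ
      have hne : ∀ w : ℂ, ‖w‖ ≤ 1 → (1 + δ : ℂ) - w ≠ 0 := by
        intro w hw h0
        have h2 : (1 + δ : ℂ) = w := sub_eq_zero.1 h0
        rw [← h2] at hw
        have : ‖((1 + δ : ℝ) : ℂ)‖ = 1 + δ := by
          rw [Complex.norm_real, Real.norm_of_nonneg (by linarith)]
        push_cast at this
        linarith
      have := Complex.norm_le_of_forall_mem_frontier_norm_le (U := Metric.ball 0 1)
        (f := fun w => ((1 + δ : ℂ) - w)⁻¹ * (G w * ((1 + w) / 2) ^ (2 * N))) (C := ε / 2)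
        Metric.isBounded_ball ?_ ?_ (subset_closure hz)
      · rw [norm_mul, norm_inv, inv_mul_le_iff₀ (norm_pos_iff.2 (hne z (by
          have : ‖z‖ < 1 := by simpa using hz
          exact this.le)))] at this
        linarith
      · have h1 : DiffContOnCl ℂ (fun w : ℂ => ((1 + δ : ℂ) - w)⁻¹) (Metric.ball 0 1) := by
          refine DifferentiableOn.diffContOnCl ?_
          rw [closure_ball _ one_ne_zero]
          intro w hw
          have hw' : ‖w‖ ≤ 1 := by simpa using hw
          exact (((differentiableAt_const _).sub differentiableAt_id).inv
            (hne w hw')).differentiableWithinAt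
        have h2 : Differentiable ℂ fun w : ℂ => ((1 + w) / 2) ^ (2 * N) := by fun_prop
        exact h1.smul (hG.smul h2.diffContOnCl)
      · intro ζ hζ
        rw [frontier_ball _ one_ne_zero] at hζ
        have hζ1 : ‖ζ‖ = 1 := by simpa using hζ
        rw [norm_mul, norm_inv, inv_mul_le_iff₀ (norm_pos_iff.2 (hne ζ hζ1.le))]
        calc _ ≤ ε / 2 * ‖ζ - 1‖ := hbd ζ hζ
          _ ≤ ε / 2 * ‖(1 + δ : ℂ) - ζ‖ := by
            gcongr; exact norm_sub_one_le_norm_one_add_sub hζ1.le hδ.le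
          _ = _ := mul_comm _ _
    have hlim : Tendsto (fun δ : ℝ => ε / 2 * ‖(1 + δ : ℂ) - z‖) (𝓝[>] 0)
        (𝓝 (ε / 2 * ‖z - 1‖)) := by
      have : Continuous fun δ : ℝ => ε / 2 * ‖(1 + δ : ℂ) - z‖ := by fun_prop
      have h := (this.tendsto 0).mono_left (nhdsWithin_le_nhds (s := Ioi 0))
      simpa [norm_sub_rev] using h
    exact ge_of_tendsto hlim (eventually_mem_nhdsWithin.mono hδ)
  -- Removing the peak factor near `1` costs a factor `2`, which is why the bound so far was kept at
  -- `ε / 2`.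
  have hev : ∀ᶠ z : ℂ in 𝓝 1, 1 / 2 < ‖((1 + z) / 2) ^ (2 * N)‖ := by
    have : Continuous fun z : ℂ => ‖((1 + z) / 2) ^ (2 * N)‖ := by fun_prop
    refine (this.tendsto 1).eventually (lt_mem_nhds ?_)
    norm_num
  obtain ⟨η', hη', hev⟩ := Metric.eventually_nhds_iff.1 hev
  refine ⟨η', hη', fun z hz hz1 => ?_⟩
  have h1 := hev (y := z) (by rwa [dist_eq_norm])
  have h2 := hin z hz
  rw [norm_mul] at h2
  nlinarith [norm_nonneg (G z)]

/-- Cauchy's estimate on the disc with centre `r` and radius `(1 - r) / 2`: there `|z - 1| ≤ 3/2 (1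
- r)`, so the derivative is at most `3ε/4`. -/
theorem tendsto_deriv_of_littleO {G : ℂ → ℂ} (hG : DifferentiableOn ℂ G (Metric.ball 0 1))
    (ho : ∀ ε > 0, ∃ η > 0, ∀ z ∈ Metric.ball (0 : ℂ) 1, ‖z - 1‖ < η → ‖G z‖ ≤ ε * ‖z - 1‖) :
    Tendsto (fun r : ℝ => deriv G r) (𝓝[<] 1) (𝓝 0) := by
  rw [Metric.tendsto_nhds]
  intro ε hε
  obtain ⟨η, hη, ho⟩ := ho (ε / 4) (by positivity)
  have hnear : ∀ᶠ r : ℝ in 𝓝[<] 1, 0 < r ∧ r < 1 ∧ 1 - r < η / 2 := by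
    filter_upwards [self_mem_nhdsWithin, mem_nhdsWithin_of_mem_nhds (lt_mem_nhds zero_lt_one),
      mem_nhdsWithin_of_mem_nhds (lt_mem_nhds (show 1 - η / 2 < 1 by linarith))] with r h1 h2 h3
    exact ⟨h2, h1, by linarith⟩
  filter_upwards [hnear] with r ⟨hr0, hr1, hrη⟩
  have hsub : ∀ z ∈ Metric.closedBall (r : ℂ) ((1 - r) / 2), z ∈ Metric.ball (0 : ℂ) 1 := by
    intro z hz
    rw [Metric.mem_closedBall, dist_eq_norm] at hz
    rw [mem_ball_zero_iff]
    calc ‖z‖ = ‖(z - r) + r‖ := by ring_nf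
      _ ≤ ‖z - r‖ + ‖(r : ℂ)‖ := norm_add_le _ _
      _ ≤ (1 - r) / 2 + r := by
        gcongr
        rw [Complex.norm_real, Real.norm_of_nonneg hr0.le]
      _ < 1 := by linarith
  have hR : 0 < (1 - r) / 2 := by linarith
  have h := Complex.norm_deriv_le_of_forall_mem_sphere_norm_le (c := (r : ℂ)) (f := G)
    (C := ε / 4 * (3 / 2 * (1 - r))) hR ?_ ?_
  · rw [dist_zero_right]
    refine h.trans_lt ?_
    rw [div_lt_iff₀ hR]
    nlinarith
  · refine DifferentiableOn.diffContOnCl (hG.mono ?_)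
    rw [closure_ball _ hR.ne']
    exact hsub
  · intro z hz
    have hz1 : ‖z - 1‖ ≤ 3 / 2 * (1 - r) := by
      have hzr : ‖z - r‖ = (1 - r) / 2 := by rwa [← dist_eq_norm]
      calc ‖z - 1‖ = ‖(z - r) + (r - 1)‖ := by ring_nf
        _ ≤ ‖z - r‖ + ‖(r - 1 : ℂ)‖ := norm_add_le _ _
        _ = (1 - r) / 2 + (1 - r) := by
          rw [hzr]
          congr 1
          have : (r - 1 : ℂ) = ((r - 1 : ℝ) : ℂ) := by push_cast; ring
          rw [this, Complex.norm_real, Real.norm_of_nonpos (by linarith)]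
          ring
        _ = _ := by ring
    refine (ho z (hsub z (Metric.sphere_subset_closedBall hz)) (by linarith)).trans ?_
    gcongr

/-- A Lipschitz function on the disc extends to a Lipschitz function on the plane. -/
theorem exists_lipschitz_extension {F : ℂ → ℂ} {s : Set ℂ} {K : ℝ≥0} (hF : LipschitzOnWith K F s) :
    ∃ (g : ℂ → ℂ) (K' : ℝ≥0), LipschitzWith K' g ∧ EqOn F g s := by
  have h1 : LipschitzOnWith K (fun z => (F z).re) s :=
    LipschitzOnWith.of_dist_le_mul fun x hx y hy => by
      refine le_trans ?_ (hF.dist_le_mul x hx y hy)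
      rw [Real.dist_eq, dist_eq_norm, ← Complex.sub_re]
      exact Complex.abs_re_le_norm _
  have h2 : LipschitzOnWith K (fun z => (F z).im) s :=
    LipschitzOnWith.of_dist_le_mul fun x hx y hy => by
      refine le_trans ?_ (hF.dist_le_mul x hx y hy)
      rw [Real.dist_eq, dist_eq_norm, ← Complex.sub_im]
      exact Complex.abs_im_le_norm _
  obtain ⟨u, hu, hu'⟩ := h1.extend_real
  obtain ⟨v, hv, hv'⟩ := h2.extend_real
  refine ⟨fun z => u z + v z * I, K + K, LipschitzWith.of_dist_le_mul fun x y => ?_, fun z hz => ?_⟩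
  · have e : ((u x : ℂ) + v x * I) - (u y + v y * I) = ((u x - u y : ℝ) : ℂ) +
        ((v x - v y : ℝ) : ℂ) * I := by push_cast; ring
    rw [dist_eq_norm, e]
    refine (norm_add_le _ _).trans ?_
    rw [norm_mul, Complex.norm_I, mul_one, Complex.norm_real, Complex.norm_real]
    have a := hu.dist_le_mul x y
    have b := hv.dist_le_mul x y
    rw [dist_eq_norm] at a b
    push_cast
    linarith
  · apply Complex.ext
    · simpa using hu' hz
    · simpa using hv' hz

theorem abs_arg_le_mul_norm_sub_one {z : ℂ} (hz : ‖z‖ = 1) : |Complex.arg z| ≤ π / 2 * ‖z - 1‖ := by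
  have h := Complex.angle_le_mul_norm_sub (x := z) (y := 1) hz (by simp)
  rwa [Complex.angle_one_right (by rintro rfl; simp at hz)] at h

/-- Fatou: a bounded holomorphic function on the disc has radial limits almost everywhere. -/
theorem ae_exists_radial_limit_of_bounded {f : ℂ → ℂ} (hf : DifferentiableOn ℂ f (Metric.ball 0 1))
    {M : ℝ} (hM : ∀ z ∈ Metric.ball (0 : ℂ) 1, ‖f z‖ ≤ M) :
    ∀ᵐ θ : ℝ, ∃ L, Tendsto (fun r : ℝ => f (r * circleMap 0 1 θ)) (𝓝[<] 1) (𝓝 L) := by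
  -- A primitive of a bounded function is Lipschitz, so its boundary values are differentiable at
  -- almost every angle. The radial limit of `f` is recovered as the derivative of this primitive.
  obtain ⟨F, hF⟩ := hf.isExactOn_ball
  have hM0 : 0 ≤ M := (norm_nonneg _).trans (hM 0 (by simp))
  have hL : LipschitzOnWith M.toNNReal F (Metric.ball 0 1) :=
    (convex_ball (0 : ℂ) 1).lipschitzOnWith_of_nnnorm_hasDerivWithin_le
      (fun z hz => (hF z hz).hasDerivWithinAt) fun z hz => by
        rw [← NNReal.coe_le_coe, coe_nnnorm, Real.coe_toNNReal _ hM0]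
        exact hM z hz
  obtain ⟨g, K, hg, hFg⟩ := exists_lipschitz_extension hL
  have hg' : ∀ z ∈ Metric.ball (0 : ℂ) 1, HasDerivAt g (f z) z := fun z hz =>
    (hF z hz).congr_of_eventuallyEq
      (eventually_of_mem (Metric.isOpen_ball.mem_nhds hz) fun w hw => (hFg hw).symm)
  have hb : LipschitzWith (K * 1) fun θ => g (circleMap 0 1 θ) := by
    refine hg.comp ?_
    simpa using lipschitzWith_circleMap 0 1
  filter_upwards [hb.ae_differentiableAt] with θ₀ hd
  set a := circleMap 0 1 θ₀
  have ha : ‖a‖ = 1 := by simp [a]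
  have ha0 : a ≠ 0 := by rintro h; simp [h] at ha
  set b' := deriv (fun θ => g (circleMap 0 1 θ)) θ₀
  -- `L` is the tangential derivative read as a complex one: `θ ↦ e^{iθ}` has derivative `a * I` at
  -- `θ₀`.
  set L := b' / (a * I)
  refine ⟨L, ?_⟩
  have hk : HasDerivAt (fun θ => g (circleMap 0 1 θ) - L * circleMap 0 1 θ) 0 θ₀ := by
    have h := hd.hasDerivAt.sub ((hasDerivAt_circleMap 0 1 θ₀).const_mul L)
    have e : b' - L * (a * I) = 0 := by
      simp only [L]; rw [div_mul_cancel₀ _ (mul_ne_zero ha0 I_ne_zero), sub_self]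
    exact h.congr_deriv e
  -- First-order Taylor remainder of the primitive at `a`, rotated to the point `1`. It is `o(|ζ -
  -- 1|)` along the circle by the choice of `L`, hence in the disc, and its derivative at `r` is `a
  -- * (f (r a) - L)`.
  set G : ℂ → ℂ := fun z => g (a * z) - g a - L * a * (z - 1)
  have hmap : ∀ z ∈ Metric.ball (0 : ℂ) 1, a * z ∈ Metric.ball (0 : ℂ) 1 := by
    intro z hz; simpa [ha] using hz
  have hGd : ∀ z ∈ Metric.ball (0 : ℂ) 1, HasDerivAt G (a * f (a * z) - L * a) z := by
    intro z hz
    have h1 : HasDerivAt (fun z => a * z) a z := by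
      simpa using (hasDerivAt_id z).const_mul a
    have h2 := (hg' _ (hmap z hz)).comp z h1
    have h3 : HasDerivAt (fun z => L * a * (z - 1)) (L * a) z := by
      simpa using ((hasDerivAt_id z).sub_const 1).const_mul (L * a)
    have h4 := (h2.sub_const (g a)).sub h3
    rw [mul_comm (f _) a] at h4
    exact h4
  have hGdo : DifferentiableOn ℂ G (Metric.ball 0 1) := fun z hz =>
    (hGd z hz).differentiableAt.differentiableWithinAt
  have hGc : Continuous G := by
    have := hg.continuous
    fun_prop
  have hGbd : ∀ ζ : ℂ, ‖G ζ‖ ≤ (K + ‖L‖) * ‖ζ - 1‖ := by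
    intro ζ
    have h1 : ‖g (a * ζ) - g a‖ ≤ K * ‖ζ - 1‖ := by
      have := hg.dist_le_mul (a * ζ) a
      rw [dist_eq_norm, dist_eq_norm, show a * ζ - a = a * (ζ - 1) by ring, norm_mul, ha,
        one_mul] at this
      exact this
    calc ‖G ζ‖ ≤ ‖g (a * ζ) - g a‖ + ‖L * a * (ζ - 1)‖ := norm_sub_le _ _
      _ ≤ K * ‖ζ - 1‖ + ‖L‖ * ‖ζ - 1‖ := by
        gcongr
        rw [norm_mul, norm_mul, ha, mul_one]
      _ = _ := by ring
  have hGo : ∀ ε > 0, ∃ η > 0, ∀ ζ ∈ Metric.sphere (0 : ℂ) 1, ‖ζ - 1‖ < η →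
      ‖G ζ‖ ≤ ε * ‖ζ - 1‖ := by
    intro ε hε
    have h1 := (hasDerivAt_iff_isLittleO.1 hk).bound (show 0 < ε / (π / 2) by positivity)
    obtain ⟨η, hη, h1⟩ := Metric.eventually_nhds_iff.1 h1
    refine ⟨η / (π / 2), by positivity, fun ζ hζ hζη => ?_⟩
    have hζ1 : ‖ζ‖ = 1 := by simpa using hζ
    have harg := abs_arg_le_mul_norm_sub_one hζ1
    have hlt : |Complex.arg ζ| < η := by
      refine harg.trans_lt ?_
      rw [lt_div_iff₀ (by positivity)] at hζη
      linarith
    have h2 := h1 (y := θ₀ + Complex.arg ζ) (by simpa [Real.dist_eq] using hlt)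
    have h3 : circleMap 0 1 (θ₀ + Complex.arg ζ) = a * ζ := by
      have : Complex.exp (Complex.arg ζ * I) = ζ := by
        conv_rhs => rw [← Complex.norm_mul_exp_arg_mul_I ζ, hζ1]
        simp
      simp only [a, circleMap_zero, Complex.ofReal_add, add_mul, Complex.exp_add, this,
        Complex.ofReal_one, one_mul]
    simp only [h3, smul_zero, sub_zero, add_sub_cancel_left] at h2
    have h4 : G ζ = g (a * ζ) - L * (a * ζ) - (g a - L * a) := by simp only [G]; ring
    rw [h4]
    refine h2.trans ?_
    rw [Real.norm_eq_abs]
    calc ε / (π / 2) * |ζ.arg| ≤ ε / (π / 2) * (π / 2 * ‖ζ - 1‖) := by gcongr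
      _ = _ := by field_simp
  have hlim := tendsto_deriv_of_littleO hGdo fun ε hε =>
    littleO_disc_of_littleO_circle ⟨hGdo, hGc.continuousOn⟩ (fun ζ _ => hGbd ζ) hGo hε
  have hlim2 : Tendsto (fun r : ℝ => a⁻¹ * deriv G r + L) (𝓝[<] 1) (𝓝 L) := by
    simpa using (hlim.const_mul a⁻¹).add_const L
  refine hlim2.congr' ?_
  filter_upwards [self_mem_nhdsWithin, mem_nhdsWithin_of_mem_nhds (lt_mem_nhds zero_lt_one)]
    with r h1 h2
  have hr : (r : ℂ) ∈ Metric.ball (0 : ℂ) 1 := by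
    simpa [abs_of_pos h2] using h1
  rw [(hGd r hr).deriv, mul_comm (r : ℂ)]
  field_simp
  ring

end Disc

/-! ### The unit disc: radial limits under an integrable majorant. -/

section Disc

open Real Complex

theorem arcMeasure_absolutelyContinuous : arcMeasure ≪ volume :=
  (Measure.absolutelyContinuous_of_le Measure.restrict_le_self).smul_left _

/-- With `H` the Herglotz integral of the majorant, `|f|^q ≤ Re H`, so `h = exp (-H/q)` and `f h`
are both bounded by `1`. Each has radial limits almost everywhere, and `f` is their quotient
wherever the limit of `h` is not zero. -/
theorem ae_exists_radial_limit_of_dominated {f : ℂ → ℂ}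
    (hf : DifferentiableOn ℂ f (Metric.ball 0 1)) {q : ℝ} (hq : 0 < q) {g : ℂ → ℝ}
    (hg : CircleIntegrable g 0 1) (hg0 : ∀ θ, 0 ≤ g (circleMap 0 1 θ))
    (hfg : ∀ r ∈ Ioo (0 : ℝ) 1, ∀ᵐ θ ∂arcMeasure,
      ‖f (r * circleMap 0 1 θ)‖ ^ q ≤ g (circleMap 0 1 θ)) :
    ∀ᵐ θ ∂arcMeasure, ∃ L, Tendsto (fun r : ℝ => f (r * circleMap 0 1 θ)) (𝓝[<] 1) (𝓝 L) := by
  have hgc : CircleIntegrable (fun ζ => (g ζ : ℂ)) 0 1 := by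
    simp only [CircleIntegrable, intervalIntegrable_iff] at hg ⊢
    exact Complex.ofRealCLM.integrable_comp hg
  set H : ℂ → ℂ := fun w => circleAverage (fun ζ => herglotzRieszKernel 0 w ζ • (g ζ : ℂ)) 0 1
  have hHd : DifferentiableOn ℂ H (Metric.ball 0 1) :=
    differentiableOn_circleAverage_herglotzRieszKernel_smul hgc
  have hHre : ∀ w ∈ Metric.ball (0 : ℂ) 1,
      (H w).re = circleAverage (poissonKernel 0 w * g) 0 1 := fun w hw => by
    simp only [H]
    rw [re_circleAverage_herglotzRieszKernel_smul hg hw, ← poissonKernel_eq_re_herglotzRieszKernel]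
    rfl
  have hPg : ∀ w ∈ Metric.ball (0 : ℂ) 1, CircleIntegrable (poissonKernel 0 w * g) 0 1 := by
    intro w hw
    have hc : Continuous fun θ => poissonKernel 0 w (circleMap 0 1 θ) :=
      (continuousOn_poissonKernel hw).comp_continuous (by fun_prop) circleMap_mem_unitSphere
    rw [circleIntegrable_def] at hg ⊢
    exact hg.continuousOn_mul hc.continuousOn
  have hfH : ∀ w ∈ Metric.ball (0 : ℂ) 1, ‖f w‖ ^ q ≤ (H w).re := by
    intro w hw
    have hw1 : ‖w‖ < 1 := by simpa using hw
    -- The Poisson majorant needs continuity up to the circle, so it is applied to dilates of `f`.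
    have hρ : ∀ ρ ∈ Ioo (0 : ℝ) 1, ‖f (ρ * w)‖ ^ q ≤ (H w).re := by
      intro ρ hρ
      have hm : MapsTo (fun z : ℂ => (ρ : ℂ) * z) (Metric.closedBall 0 1) (Metric.ball 0 1) := by
        intro z hz
        have hz' : ‖z‖ ≤ 1 := by simpa using hz
        simp only [mem_ball_zero_iff, norm_mul, Complex.norm_real, Real.norm_eq_abs,
          abs_of_pos hρ.1]
        nlinarith [norm_nonneg z, hρ.1, hρ.2]
      have hd : DifferentiableOn ℂ (fun z : ℂ => f (ρ * z)) (Metric.closedBall 0 1) :=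
        hf.comp (by fun_prop) hm
      have hdc : DiffContOnCl ℂ (fun z : ℂ => f (ρ * z)) (Metric.ball 0 1) := by
        refine DifferentiableOn.diffContOnCl ?_
        rwa [closure_ball _ one_ne_zero]
      refine (norm_rpow_le_circleAverage_poisson hdc hq hw).trans ?_
      rw [hHre w hw]
      have hci : CircleIntegrable (poissonKernel 0 w * fun z => ‖f (ρ * z)‖ ^ q) 0 1 := by
        refine ContinuousOn.circleIntegrable zero_le_one ?_
        exact (continuousOn_poissonKernel hw).mul
          ((hd.continuousOn.mono Metric.sphere_subset_closedBall).norm.rpow_const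
            fun _ _ => Or.inr hq.le)
      rw [circleAverage_eq_integral_arcMeasure, circleAverage_eq_integral_arcMeasure]
      refine integral_mono_ae (circleIntegrable_iff_integrable_arcMeasure.1 hci)
        (circleIntegrable_iff_integrable_arcMeasure.1 (hPg w hw)) ?_
      filter_upwards [hfg ρ hρ] with θ hθ
      exact mul_le_mul_of_nonneg_left hθ (poissonKernel_nonneg hw (circleMap_mem_unitSphere θ))
    have hlim : Tendsto (fun ρ : ℝ => ‖f (ρ * w)‖ ^ q) (𝓝[<] 1) (𝓝 (‖f w‖ ^ q)) := by
      have h1 : Tendsto (fun ρ : ℝ => (ρ : ℂ) * w) (𝓝[<] 1) (𝓝 w) := by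
        have : Continuous fun ρ : ℝ => (ρ : ℂ) * w := by fun_prop
        simpa using (this.tendsto 1).mono_left nhdsWithin_le_nhds
      have h2 := (hf.continuousOn.continuousAt (Metric.isOpen_ball.mem_nhds hw)).tendsto.comp h1
      exact h2.norm.rpow_const (Or.inr hq.le)
    refine le_of_tendsto hlim ?_
    filter_upwards [self_mem_nhdsWithin, mem_nhdsWithin_of_mem_nhds (lt_mem_nhds zero_lt_one)]
      with ρ h1 h2
    exact hρ ρ ⟨h2, h1⟩
  have hH0 : ∀ w ∈ Metric.ball (0 : ℂ) 1, 0 ≤ (H w).re := fun w hw =>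
    (by positivity : (0 : ℝ) ≤ _).trans (hfH w hw)
  set h : ℂ → ℂ := fun w => Complex.exp (-(H w) / q)
  have hre : ∀ w, (-(H w) / (q : ℂ)).re = -((H w).re / q) := fun w => by
    rw [Complex.div_ofReal_re, Complex.neg_re, neg_div]
  have hhd : DifferentiableOn ℂ h (Metric.ball 0 1) := (hHd.neg.div_const _).cexp
  have hh1 : ∀ w ∈ Metric.ball (0 : ℂ) 1, ‖h w‖ ≤ 1 := fun w hw => by
    rw [Complex.norm_exp, hre, Real.exp_le_one_iff]
    have := div_nonneg (hH0 w hw) hq.le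
    linarith
  have hfh1 : ∀ w ∈ Metric.ball (0 : ℂ) 1, ‖f w * h w‖ ≤ 1 := fun w hw => by
    rw [norm_mul, Complex.norm_exp, hre, Real.exp_neg, ← div_eq_mul_inv,
      div_le_one (Real.exp_pos _), ← Real.rpow_le_rpow_iff (norm_nonneg _) (Real.exp_pos _).le hq,
      ← Real.exp_mul, div_mul_cancel₀ _ hq.ne']
    have := Real.add_one_le_exp (H w).re
    linarith [hfH w hw]
  have a1 := arcMeasure_absolutelyContinuous.ae_le (ae_exists_radial_limit_of_bounded hhd hh1)
  have a2 := arcMeasure_absolutelyContinuous.ae_le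
    (ae_exists_radial_limit_of_bounded (hf.mul hhd) hfh1)
  set r : ℕ → ℝ := fun k => 1 - 1 / ((k : ℝ) + 2)
  have hr0 : ∀ k, 0 ≤ r k := fun k => by
    simp only [r]
    rw [sub_nonneg, div_le_one (by positivity)]
    linarith [(Nat.cast_nonneg k : (0 : ℝ) ≤ k)]
  have hr1 : ∀ k, r k < 1 := fun k => by
    simp only [r]
    linarith [(by positivity : 0 < 1 / ((k : ℝ) + 2))]
  have hrt : Tendsto r atTop (𝓝[<] 1) := by
    refine tendsto_nhdsWithin_iff.2 ⟨?_, Eventually.of_forall hr1⟩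
    have h1 : Tendsto (fun k : ℕ => (k : ℝ) + 2) atTop atTop :=
      tendsto_atTop_add_const_right _ _ tendsto_natCast_atTop_atTop
    have h2 := (tendsto_const_nhds (x := (1 : ℝ))).sub (tendsto_const_nhds.div_atTop h1 (a := (1:ℝ)))
    simpa [r] using h2
  set U : ℕ → ℝ → ℝ≥0∞ := fun k θ => ENNReal.ofReal (H (r k * circleMap 0 1 θ)).re
  have hU : ∀ k, ∫⁻ θ, U k θ ∂arcMeasure =
      ∫⁻ α, ENNReal.ofReal (g (circleMap 0 1 α)) ∂arcMeasure := fun k => by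
    rw [← lintegral_lintegral_poissonKernel (hr0 k) (hr1 k)
      (circleIntegrable_iff_integrable_arcMeasure.1 hg).aemeasurable.ennreal_ofReal]
    refine lintegral_congr fun θ => ?_
    have hw := mul_circleMap_mem_ball (hr0 k) (hr1 k) θ
    simp only [U]
    rw [hHre _ hw, ofReal_circleAverage (hPg _ hw)]
    · refine lintegral_congr fun α => ?_
      rw [Pi.mul_apply,
        ENNReal.ofReal_mul (poissonKernel_nonneg hw (circleMap_mem_unitSphere α))]
    · exact fun α => mul_nonneg (poissonKernel_nonneg hw (circleMap_mem_unitSphere α)) (hg0 α)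
  have hUm : ∀ k, Measurable (U k) := fun k => by
    refine ENNReal.measurable_ofReal.comp (Continuous.measurable ?_)
    exact Complex.continuous_re.comp (hHd.continuousOn.comp_continuous (by fun_prop)
      fun θ => mul_circleMap_mem_ball (hr0 k) (hr1 k) θ)
  -- The mean of `Re H` over each circle is `∫ g`. Fatou's lemma therefore forbids `Re H → ∞` along
  -- the radii `r k` except on a null set, which is what a zero limit of `h` would force.
  have hfin : ∀ᵐ θ ∂arcMeasure, liminf (fun k => U k θ) atTop < ∞ := by
    refine ae_lt_top (Measurable.liminf hUm) (ne_of_lt ?_)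
    refine (lintegral_liminf_le hUm).trans_lt ?_
    simp only [hU, liminf_const]
    have := (circleIntegrable_iff_integrable_arcMeasure.1 hg).hasFiniteIntegral
    refine lt_of_le_of_lt (lintegral_mono fun α => ?_) this
    exact Real.ofReal_le_enorm _
  filter_upwards [a1, a2, hfin] with θ ⟨L1, h1⟩ ⟨L2, h2⟩ h3
  have hL1 : L1 ≠ 0 := by
    rintro rfl
    have h4 : Tendsto (fun k => ‖h (r k * circleMap 0 1 θ)‖) atTop (𝓝[>] 0) := by
      refine tendsto_nhdsWithin_iff.2 ⟨?_, Eventually.of_forall fun k => ?_⟩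
      · simpa using (h1.comp hrt).norm
      · simp [h, Complex.norm_exp, Real.exp_pos]
    have h5 := Real.tendsto_log_nhdsGT_zero.comp h4
    have h6 : Tendsto (fun k => (H (r k * circleMap 0 1 θ)).re) atTop atTop := by
      have h7 := (tendsto_neg_atBot_atTop.comp h5).const_mul_atTop hq
      refine h7.congr fun k => ?_
      simp only [Function.comp_apply, h, Complex.norm_exp, Real.log_exp, hre]
      field_simp
    have h8 : Tendsto (fun k => U k θ) atTop (𝓝 ∞) := ENNReal.tendsto_ofReal_nhds_top.2 h6
    rw [h8.liminf_eq] at h3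
    exact lt_irrefl _ h3
  refine ⟨L2 / L1, (h2.div h1 hL1).congr fun r => ?_⟩
  simp only [Pi.mul_apply]
  exact mul_div_cancel_right₀ _ (Complex.exp_ne_zero _)

end Disc

/-! ### The sphere: slices by complex lines, monotone spherical means, polar coordinates. -/

section Sphere

open scoped Pointwise

open Real Complex

variable {n : ℕ}

theorem norm_unitSphere (ξ : unitSphere n) : ‖(ξ : Cn n)‖ = 1 := by simp

theorem toSphere_univ_ne_zero (hn : 1 ≤ n) : (volume : Measure (Cn n)).toSphere univ ≠ 0 := by
  have : NeZero n := ⟨by omega⟩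
  rw [Measure.measure_univ_ne_zero]
  exact Measure.toSphere_ne_zero _

theorem isProbabilityMeasure_sphereMeasure (hn : 1 ≤ n) :
    IsProbabilityMeasure (sphereMeasure n) := ⟨by
  rw [sphereMeasure, Measure.smul_apply, smul_eq_mul]
  exact ENNReal.inv_mul_cancel (toSphere_univ_ne_zero hn) (measure_ne_top _ _)⟩

instance : IsFiniteMeasure (sphereMeasure n) := ⟨by
  rcases Nat.eq_zero_or_pos n with rfl | hn
  · have : IsEmpty (unitSphere 0) := ⟨fun ξ => by
      have h := norm_unitSphere ξ
      rw [Subsingleton.elim (ξ : Cn 0) 0, norm_zero] at h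
      exact zero_ne_one h⟩
    rw [univ_eq_empty_iff.2 this]
    simp
  · have := isProbabilityMeasure_sphereMeasure hn
    exact measure_lt_top _ _⟩

/-- Rotation of a point of the sphere by the unimodular scalar `exp (iθ)`. -/
def rot (θ : ℝ) (ξ : unitSphere n) : unitSphere n :=
  ⟨circleMap 0 1 θ • (ξ : Cn n), by simp [norm_smul]⟩

@[simp] theorem coe_rot (θ : ℝ) (ξ : unitSphere n) :
    (rot θ ξ : Cn n) = circleMap 0 1 θ • (ξ : Cn n) := rfl

theorem continuous_rot : Continuous fun p : ℝ × unitSphere n => rot p.1 p.2 := by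
  refine Continuous.subtype_mk ?_ _
  have h1 : Continuous fun p : ℝ × unitSphere n => circleMap 0 1 p.1 := by fun_prop
  exact h1.smul (continuous_subtype_val.comp continuous_snd)

theorem rot_smul (t : ℝ) (θ : ℝ) (ξ : unitSphere n) :
    t • (rot θ ξ : Cn n) = ((t : ℂ) * circleMap 0 1 θ) • (ξ : Cn n) := by
  rw [coe_rot, ← Complex.coe_smul, smul_smul]

/-- The surface measure of `s` is defined by the volume of the cone over `s`, and multiplication by
`e^{iθ}` is a real linear isometry carrying cones to cones. -/
theorem measurePreserving_rot (θ : ℝ) :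
    MeasurePreserving (rot θ) (sphereMeasure n) (sphereMeasure n) := by
  have hm : Measurable (rot (n := n) θ) :=
    (continuous_rot.comp (Continuous.prodMk_right θ)).measurable
  refine ⟨hm, Measure.ext fun s hs => ?_⟩
  rw [Measure.map_apply hm hs, sphereMeasure, Measure.smul_apply, Measure.smul_apply,
    Measure.toSphere_apply' _ hs, Measure.toSphere_apply' _ (hm hs)]
  congr 2
  let A : Cn n ≃ₗᵢ[ℝ] Cn n :=
    { toFun := fun z => circleMap 0 1 θ • z
      invFun := fun z => (circleMap 0 1 θ)⁻¹ • z
      map_add' := fun x y => smul_add _ x y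
      map_smul' := fun r x => smul_comm _ r x
      left_inv := fun z => inv_smul_smul₀ (circleMap_ne_center one_ne_zero) z
      right_inv := fun z => smul_inv_smul₀ (circleMap_ne_center one_ne_zero) z
      norm_map' := fun z => by simp [norm_smul] }
  have hA : ∀ z, A z = circleMap 0 1 θ • z := fun z => rfl
  have e : Ioo (0 : ℝ) 1 • (Subtype.val '' (rot θ ⁻¹' s) : Set (Cn n)) =
      A ⁻¹' (Ioo (0 : ℝ) 1 • (Subtype.val '' s)) := by
    ext z
    simp only [Set.mem_smul, mem_preimage, mem_image]
    constructor
    · rintro ⟨r, hr, _, ⟨ξ, hξ, rfl⟩, rfl⟩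
      exact ⟨r, hr, _, ⟨_, hξ, rfl⟩, by rw [map_smul, hA, coe_rot]⟩
    · rintro ⟨r, hr, _, ⟨ξ, hξ, rfl⟩, h⟩
      have h1 : z = r • A.symm (ξ : Cn n) := by
        rw [← map_smul, h, A.symm_apply_apply]
      refine ⟨r, hr, _, ⟨⟨A.symm ξ, by simp⟩, ?_, rfl⟩, h1.symm⟩
      have : rot θ ⟨A.symm ξ, by simp⟩ = ξ := by
        ext1
        rw [coe_rot, ← hA, A.apply_symm_apply]
      rwa [this]
  rw [e]
  exact A.measurePreserving.measure_preimage_emb A.toHomeomorph.measurableEmbedding _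

/-- Integration over the sphere by slices. -/
theorem lintegral_slice {F : unitSphere n → ℝ≥0∞} (hF : Measurable F) :
    ∫⁻ ξ, ∫⁻ θ, F (rot θ ξ) ∂arcMeasure ∂(sphereMeasure n) = ∫⁻ ξ, F ξ ∂(sphereMeasure n) := by
  have hm : Measurable (Function.uncurry fun (θ : ℝ) (ξ : unitSphere n) => F (rot θ ξ)) :=
    hF.comp continuous_rot.measurable
  rw [← lintegral_lintegral_swap hm.aemeasurable]
  have : ∀ θ, ∫⁻ ξ, F (rot θ ξ) ∂(sphereMeasure n) = ∫⁻ ξ, F ξ ∂(sphereMeasure n) := fun θ =>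
    (measurePreserving_rot θ).lintegral_comp hF
  simp [this]

theorem ae_of_ae_slice {p : unitSphere n → Prop} (hp : MeasurableSet {ξ | p ξ})
    (h : ∀ᵐ ξ ∂(sphereMeasure n), ∀ᵐ θ ∂arcMeasure, p (rot θ ξ)) :
    ∀ᵐ ξ ∂(sphereMeasure n), p ξ := by
  have h1 := lintegral_slice (n := n) (F := {ξ | p ξ}ᶜ.indicator 1) (measurable_one.indicator hp.compl)
  rw [lintegral_indicator_one hp.compl] at h1
  have h2 : ∫⁻ ξ, ∫⁻ θ, {ξ | p ξ}ᶜ.indicator (1 : unitSphere n → ℝ≥0∞) (rot θ ξ) ∂arcMeasure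
      ∂(sphereMeasure n) = 0 := by
    rw [← lintegral_zero (μ := sphereMeasure n)]
    refine lintegral_congr_ae ?_
    filter_upwards [h] with ξ hξ
    rw [← lintegral_zero (μ := arcMeasure)]
    refine lintegral_congr_ae ?_
    filter_upwards [hξ] with θ hθ
    simp [hθ]
  rw [h2] at h1
  exact h1.symm

theorem smul_mem_unitBall {z : ℂ} (hz : z ∈ Metric.ball (0 : ℂ) 1) (ξ : unitSphere n) :
    z • (ξ : Cn n) ∈ unitBall n := by
  simpa [norm_smul] using hz

theorem real_smul_mem_unitBall {t : ℝ} (ht0 : 0 ≤ t) (ht : t < 1) (ξ : unitSphere n) :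
    t • (ξ : Cn n) ∈ unitBall n := by
  simpa [norm_smul, abs_of_nonneg ht0] using ht

theorem continuous_dilate_sphere {X : Type*} [TopologicalSpace X] {f : Cn n → X}
    (hf : ContinuousOn f (unitBall n)) {t : ℝ} (ht0 : 0 ≤ t) (ht : t < 1) :
    Continuous fun ξ : unitSphere n => f (t • (ξ : Cn n)) :=
  hf.comp_continuous (by fun_prop) fun ξ => real_smul_mem_unitBall ht0 ht ξ

theorem differentiableOn_slice {f : Cn n → ℂ} (hf : DifferentiableOn ℂ f (unitBall n))
    (ξ : unitSphere n) : DifferentiableOn ℂ (fun z : ℂ => f (z • (ξ : Cn n))) (Metric.ball 0 1) :=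
  hf.comp (by fun_prop) fun _ hz => smul_mem_unitBall hz ξ

/-- The means of `|f|^s` over concentric spheres increase with the radius. -/
theorem lintegral_sphere_mono {f : Cn n → ℂ} (hf : DifferentiableOn ℂ f (unitBall n))
    {s : ℝ} (hs : 0 < s) {t r : ℝ} (ht0 : 0 ≤ t) (htr : t ≤ r) (hr : r < 1) :
    ∫⁻ ξ : unitSphere n, ‖f (t • (ξ : Cn n))‖ₑ ^ s ∂(sphereMeasure n) ≤
      ∫⁻ ξ : unitSphere n, ‖f (r • (ξ : Cn n))‖ₑ ^ s ∂(sphereMeasure n) := by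
  have hm : ∀ t : ℝ, 0 ≤ t → t < 1 →
      Measurable fun ξ : unitSphere n => ‖f (t • (ξ : Cn n))‖ₑ ^ s := fun t h0 h1 =>
    (continuous_dilate_sphere hf.continuousOn h0 h1).measurable.enorm.pow_const s
  rw [← lintegral_slice (hm t ht0 (htr.trans_lt hr)), ← lintegral_slice (hm r (ht0.trans htr) hr)]
  refine lintegral_mono fun ξ => ?_
  simp only [rot_smul]
  exact lintegral_circle_mono (differentiableOn_slice hf ξ) hs ht0 htr hr

/-- The sub-mean value property is monotonicity of the means, started at radius `0`. -/
theorem enorm_rpow_le_lintegral_sphere (hn : 1 ≤ n) {f : Cn n → ℂ}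
    (hf : DifferentiableOn ℂ f (unitBall n)) {s : ℝ} (hs : 0 < s) {r : ℝ} (hr0 : 0 ≤ r)
    (hr : r < 1) :
    ‖f 0‖ₑ ^ s ≤ ∫⁻ ξ : unitSphere n, ‖f (r • (ξ : Cn n))‖ₑ ^ s ∂(sphereMeasure n) := by
  have := isProbabilityMeasure_sphereMeasure hn
  simpa using lintegral_sphere_mono hf hs le_rfl hr0 hr

/-- Integration in polar coordinates. -/
theorem lintegral_polar (hn : 1 ≤ n) {F : Cn n → ℝ≥0∞} (hF : Measurable F) :
    ∫⁻ z, F z = (volume : Measure (Cn n)).toSphere univ *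
      ∫⁻ t in Ioi (0 : ℝ), ENNReal.ofReal (t ^ (2 * n - 1)) *
        ∫⁻ ξ : unitSphere n, F (t • (ξ : Cn n)) ∂(sphereMeasure n) := by
  have : NeZero n := ⟨by omega⟩
  set σ := (volume : Measure (Cn n)).toSphere
  have hσ : σ = σ univ • sphereMeasure n := by
    rw [sphereMeasure, smul_smul, ENNReal.mul_inv_cancel (toSphere_univ_ne_zero hn)
      (measure_ne_top _ _), one_smul]
  have hdim : Module.finrank ℝ (Cn n) - 1 = 2 * n - 1 := by
    rw [← Module.finrank_mul_finrank ℝ ℂ (Cn n)]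
    simp
  have h0 : ∫⁻ z, F z = ∫⁻ z : ({0}ᶜ : Set (Cn n)), F z ∂(volume.comap Subtype.val) := by
    rw [lintegral_subtype_comap (measurableSet_singleton _).compl]
    rw [← setLIntegral_univ F]
    exact (setLIntegral_congr (ae_eq_univ.2 (by simp))).symm
  rw [h0]
  have hmp := (volume : Measure (Cn n)).measurePreserving_homeomorphUnitSphereProd
  have hG : Measurable fun p : unitSphere n × Ioi (0 : ℝ) => F ((p.2 : ℝ) • (p.1 : Cn n)) := by
    refine hF.comp (Continuous.measurable ?_)
    exact (continuous_subtype_val.comp continuous_snd).smul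
      (continuous_subtype_val.comp continuous_fst)
  have h1 : ∫⁻ z : ({0}ᶜ : Set (Cn n)), F z ∂(volume.comap Subtype.val) =
      ∫⁻ p, F ((p.2 : ℝ) • (p.1 : Cn n)) ∂(σ.prod (Measure.volumeIoiPow (2 * n - 1))) := by
    rw [← hdim, ← hmp.lintegral_comp hG]
    refine lintegral_congr fun z => ?_
    have hz : (z : Cn n) ≠ 0 := z.2
    simp [smul_smul, hz]
  rw [h1, lintegral_prod_symm _ hG.aemeasurable, Measure.volumeIoiPow]
  rw [lintegral_withDensity_eq_lintegral_mul _ (by fun_prop) (hG.lintegral_prod_left')]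
  rw [← lintegral_subtype_comap measurableSet_Ioi, ← lintegral_const_mul' _ _ (measure_ne_top _ _)]
  refine lintegral_congr fun t => ?_
  rw [Pi.mul_apply]
  conv_lhs => rw [hσ, lintegral_smul_measure]
  rw [smul_eq_mul]
  ring

end Sphere

/-! ### Nonisotropic dilations: size `h` along `ζ`, size `√h` in the complex tangential directions.
-/

section Stretch

open Complex

variable {n : ℕ}

/-- The linear map that multiplies `ζ` by `h` and the orthogonal complement of `ζ` by `√h`. -/
def stretch (ζ : Cn n) (h : ℝ) : Cn n →ₗ[ℂ] Cn n :=
  (√h : ℂ) • LinearMap.transvection (innerSL ℂ ζ : Cn n →L[ℂ] ℂ).toLinearMap (((√h : ℂ) - 1) • ζ)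

theorem stretch_apply (ζ : Cn n) (h : ℝ) (u : Cn n) :
    stretch ζ h u = (√h : ℂ) • (u + (inner ℂ ζ u : ℂ) • (((√h : ℂ) - 1) • ζ)) := by
  simp [stretch, LinearMap.transvection.apply]

/-- The complex determinant is `h · (√h)^{n-1} = (√h)^{n+1}`; the real one is its squared modulus.
-/
theorem det_stretch {ζ : Cn n} (hζ : ‖ζ‖ = 1) {h : ℝ} (hh : 0 ≤ h) :
    LinearMap.det ((stretch ζ h).restrictScalars ℝ) = h ^ (n + 1) := by
  have h1 : LinearMap.det (stretch ζ h) = (√h : ℂ) ^ (n + 1) := by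
    rw [stretch, LinearMap.det_smul, LinearMap.transvection.det]
    simp [inner_self_eq_norm_sq_to_K, hζ, pow_succ]
  rw [LinearMap.det_restrictScalars, h1, Algebra.norm_complex_apply, map_pow]
  congr 1
  rw [Complex.normSq_ofReal, Real.mul_self_sqrt hh]

theorem inner_stretch {ζ : Cn n} (hζ : ‖ζ‖ = 1) {h : ℝ} (hh : 0 ≤ h) (u : Cn n) :
    inner ℂ ζ (stretch ζ h u) = (h : ℂ) * inner ℂ ζ u := by
  have h2 : (√h : ℂ) * √h = h := by
    rw [← Complex.ofReal_mul, Real.mul_self_sqrt hh]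
  rw [stretch_apply, inner_smul_right, inner_add_right, inner_smul_right, inner_smul_right,
    inner_self_eq_norm_sq_to_K, hζ, ← h2]
  simp
  ring

theorem norm_sq_eq_inner_add {ζ : Cn n} (hζ : ‖ζ‖ = 1) (u : Cn n) :
    ‖u‖ ^ 2 = ‖(inner ℂ ζ u : ℂ)‖ ^ 2 + ‖u - (inner ℂ ζ u : ℂ) • ζ‖ ^ 2 := by
  have h : inner ℂ ((inner ℂ ζ u : ℂ) • ζ) (u - (inner ℂ ζ u : ℂ) • ζ) = 0 := by
    rw [inner_smul_left, inner_sub_right, inner_smul_right, inner_self_eq_norm_sq_to_K, hζ]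
    simp
  have h2 := norm_add_sq_eq_norm_sq_add_norm_sq_of_inner_eq_zero _ _ h
  rw [add_sub_cancel, norm_smul, hζ, mul_one] at h2
  linarith

theorem stretch_sub_inner {ζ : Cn n} (hζ : ‖ζ‖ = 1) {h : ℝ} (hh : 0 ≤ h) (u : Cn n) :
    stretch ζ h u - (inner ℂ ζ (stretch ζ h u) : ℂ) • ζ =
      (√h : ℂ) • (u - (inner ℂ ζ u : ℂ) • ζ) := by
  have h2 : (√h : ℂ) * √h = h := by
    rw [← Complex.ofReal_mul, Real.mul_self_sqrt hh]
  rw [inner_stretch hζ hh, stretch_apply, ← h2]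
  module

/-- Pythagoras: a tangential displacement of size `√h` changes the squared norm only to order `h`,
the same order as a displacement of size `h` along `ζ`. -/
theorem norm_sq_add_stretch {ζ : Cn n} (hζ : ‖ζ‖ = 1) {h : ℝ} (hh : 0 ≤ h) (r : ℂ) (u : Cn n) :
    ‖r • ζ + stretch ζ h u‖ ^ 2 =
      ‖r + h * inner ℂ ζ u‖ ^ 2 + h * ‖u - (inner ℂ ζ u : ℂ) • ζ‖ ^ 2 := by
  have h1 : inner ℂ ζ (r • ζ + stretch ζ h u) = r + h * inner ℂ ζ u := by
    rw [inner_add_right, inner_smul_right, inner_stretch hζ hh, inner_self_eq_norm_sq_to_K, hζ]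
    simp
  have h2 : r • ζ + stretch ζ h u - (r + h * inner ℂ ζ u : ℂ) • ζ =
      (√h : ℂ) • (u - (inner ℂ ζ u : ℂ) • ζ) := by
    rw [← stretch_sub_inner hζ hh, inner_stretch hζ hh]
    module
  rw [norm_sq_eq_inner_add hζ, h1, h2, norm_smul, mul_pow, Complex.norm_real, Real.norm_eq_abs,
    sq_abs, Real.sq_sqrt hh]

/-- The factor `1/2` leaves room: the squared norm is below `(1 - δ/2)² + δ/4 < 1`. So an ellipsoid
of volume comparable to `δ^{n+1}` fits in a shell of thickness `2δ` inside the ball. -/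
theorem norm_unit_add_half_stretch {ζ : Cn n} (hζ : ‖ζ‖ = 1) {δ : ℝ} (hδ0 : 0 < δ) (hδ1 : δ ≤ 1)
    {u : Cn n} (hu : ‖u‖ < 1) :
    ‖((1 - δ : ℝ) : ℂ) • ζ + stretch ζ δ ((1 / 2 : ℝ) • u)‖ ∈ Ioo (1 - 2 * δ) 1 := by
  set v : Cn n := (1 / 2 : ℝ) • u
  have hv : ‖v‖ < 1 / 2 := by
    simp only [v, norm_smul]
    norm_num
    linarith
  have h1 := norm_sq_add_stretch hζ hδ0.le ((1 - δ : ℝ) : ℂ) v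
  have h2 := norm_sq_eq_inner_add hζ v
  set x : ℂ := inner ℂ ζ v
  set y := ‖v - x • ζ‖
  set N := ‖((1 - δ : ℝ) : ℂ) • ζ + stretch ζ δ v‖
  have hN : 0 ≤ N := norm_nonneg _
  have hx : ‖x‖ < 1 / 2 := by
    have : ‖x‖ ^ 2 < (1 / 2) ^ 2 := by nlinarith [sq_nonneg y, norm_nonneg v]
    exact lt_of_pow_lt_pow_left₀ 2 (by norm_num) this
  have hy : y ^ 2 < 1 / 4 := by nlinarith [sq_nonneg ‖x‖, norm_nonneg v]
  have hr : ‖((1 - δ : ℝ) : ℂ)‖ = 1 - δ := by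
    rw [Complex.norm_real, Real.norm_of_nonneg (by linarith)]
  have hdx : ‖(δ : ℂ) * x‖ = δ * ‖x‖ := by
    rw [norm_mul, Complex.norm_real, Real.norm_of_nonneg hδ0.le]
  have hup : ‖((1 - δ : ℝ) : ℂ) + δ * x‖ ≤ 1 - δ + δ * ‖x‖ := by
    exact (norm_add_le _ _).trans (by rw [hr, hdx])
  have hlo : 1 - δ - δ * ‖x‖ ≤ ‖((1 - δ : ℝ) : ℂ) + δ * x‖ := by
    have := norm_sub_norm_le ((1 - δ : ℝ) : ℂ) (-((δ : ℂ) * x))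
    rwa [norm_neg, sub_neg_eq_add, hr, hdx] at this
  set A := ‖((1 - δ : ℝ) : ℂ) + δ * x‖
  have hA0 : 0 ≤ A := norm_nonneg _
  have hA1 : A ≤ 1 - δ / 2 := by nlinarith
  constructor
  · have h3 : A ^ 2 ≤ N ^ 2 := by rw [h1]; nlinarith [sq_nonneg y]
    have h4 : A ≤ N := (sq_le_sq₀ hA0 hN).1 h3
    nlinarith
  · have h3 : N ^ 2 < 1 ^ 2 := by
      rw [h1]
      have : A ^ 2 ≤ (1 - δ / 2) ^ 2 := by gcongr
      nlinarith
    exact lt_of_pow_lt_pow_left₀ 2 (by norm_num) h3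

end Stretch

/-! ### Growth of point evaluations. -/

section PointEvaluation

variable {n : ℕ}

theorem lintegral_pow_Ioo_pos (n : ℕ) : 0 < ∫⁻ t in Ioo (0 : ℝ) 1, ENNReal.ofReal (t ^ n) := by
  rw [setLIntegral_pos_iff (by fun_prop)]
  have : Function.support (fun t : ℝ => ENNReal.ofReal (t ^ n)) ∩ Ioo 0 1 = Ioo 0 1 := by
    refine inter_eq_right.2 fun t ht => ?_
    simp [pow_pos ht.1]
  rw [this]; simp

theorem lintegral_comp_half_stretch {ζ : Cn n} (hζ : ‖ζ‖ = 1) {δ : ℝ} (hδ : 0 < δ) (z : Cn n)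
    {G : Cn n → ℝ≥0∞} (hG : Measurable G) :
    ∫⁻ u, G (z + stretch ζ δ ((1 / 2 : ℝ) • u)) =
      ENNReal.ofReal (2 ^ (2 * n)) * ENNReal.ofReal ((δ ^ (n + 1))⁻¹) * ∫⁻ w, G w := by
  have hdet := det_stretch hζ hδ.le
  have hne : LinearMap.det ((stretch ζ δ).restrictScalars ℝ) ≠ 0 := by
    rw [hdet]; positivity
  have h1 := Measure.map_linearMap_addHaar_eq_smul_addHaar (volume : Measure (Cn n)) hne
  rw [hdet, abs_of_pos (by positivity)] at h1
  have hcont : Continuous ((stretch ζ δ).restrictScalars ℝ) :=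
    LinearMap.continuous_of_finiteDimensional _
  have hdim : Module.finrank ℝ (Cn n) = 2 * n := by
    rw [← Module.finrank_mul_finrank ℝ ℂ (Cn n)]
    simp
  have h2 := Measure.map_addHaar_smul (volume : Measure (Cn n)) (r := 1 / 2) (by norm_num)
  rw [hdim, abs_of_pos (by positivity), one_div, inv_pow, inv_inv, ← one_div] at h2
  have hm : Measurable fun w => G (z + w) := hG.comp (measurable_const_add z)
  have hm' : Measurable fun u => G (z + stretch ζ δ u) := hm.comp hcont.measurable
  calc ∫⁻ u, G (z + stretch ζ δ ((1 / 2 : ℝ) • u))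
      = ∫⁻ u, G (z + stretch ζ δ u) ∂(Measure.map ((1 / 2 : ℝ) • ·) volume) :=
        (lintegral_map hm' (measurable_const_smul _)).symm
    _ = ENNReal.ofReal (2 ^ (2 * n)) * ∫⁻ u, G (z + stretch ζ δ u) := by
        rw [h2, lintegral_smul_measure, smul_eq_mul]
    _ = ENNReal.ofReal (2 ^ (2 * n)) *
        ∫⁻ w, G (z + w) ∂(Measure.map ((stretch ζ δ).restrictScalars ℝ) volume) := by
        rw [lintegral_map hm hcont.measurable]
        rfl
    _ = _ := by
        rw [h1, lintegral_smul_measure, smul_eq_mul, lintegral_add_left_eq_self G z, mul_assoc]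

/-- Point evaluations are bounded on Hardy spaces, with the sharp order of growth. -/
theorem exists_point_evaluation_bound (hn : 1 ≤ n) : ∃ C : ℝ≥0, ∀ (f : Cn n → ℂ),
    DifferentiableOn ℂ f (unitBall n) → ∀ s : ℝ, 0 < s → ∀ N : ℝ≥0∞,
    (∀ t ∈ Ioo (0 : ℝ) 1, ∫⁻ ξ : unitSphere n, ‖f (t • (ξ : Cn n))‖ₑ ^ s ∂(sphereMeasure n) ≤ N) →
    ∀ ζ : Cn n, ‖ζ‖ = 1 → ∀ δ ∈ Ioc (0 : ℝ) 1,
      ‖f ((1 - δ : ℝ) • ζ)‖ₑ ^ s ≤ C * ENNReal.ofReal ((δ ^ n)⁻¹) * N := by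
  set S := (volume : Measure (Cn n)).toSphere univ
  set k := ∫⁻ t in Ioo (0 : ℝ) 1, ENNReal.ofReal (t ^ (2 * n - 1))
  have hk : k ≠ 0 := (lintegral_pow_Ioo_pos _).ne'
  have hS0 : S ≠ 0 := toSphere_univ_ne_zero hn
  have hS1 : S ≠ ∞ := measure_ne_top _ _
  have hC : k⁻¹ * ENNReal.ofReal (2 * 2 ^ (2 * n)) ≠ ∞ :=
    ENNReal.mul_ne_top (ENNReal.inv_ne_top.2 hk) ENNReal.ofReal_ne_top
  have hk1 : k ≠ ∞ := by
    refine ne_of_lt (lt_of_le_of_lt (setLIntegral_mono (g := fun _ => 1) measurable_const ?_)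
      (by simp))
    intro t ht
    rw [← ENNReal.ofReal_one]
    exact ENNReal.ofReal_le_ofReal (pow_le_one₀ ht.1.le ht.2.le)
  refine ⟨(k⁻¹ * ENNReal.ofReal (2 * 2 ^ (2 * n))).toNNReal, fun f hf s hs N hN ζ hζ δ hδ => ?_⟩
  rw [ENNReal.coe_toNNReal hC]
  set z : Cn n := (1 - δ : ℝ) • ζ
  have hz : z = ((1 - δ : ℝ) : ℂ) • ζ := by rw [Complex.coe_smul]
  set E : Set (Cn n) := {w | ‖w‖ ∈ Ioo (1 - 2 * δ) 1}
  have hE : MeasurableSet E := measurable_norm measurableSet_Ioo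
  have hEB : E ⊆ unitBall n := fun w hw => by simpa using hw.2
  set G : Cn n → ℝ≥0∞ := E.indicator fun w => ‖f w‖ₑ ^ s
  have hG : Measurable G := by
    have h1 : ContinuousOn f E := hf.continuousOn.mono hEB
    have h2 : Measurable (E.indicator f) := by
      rw [← piecewise_eq_indicator]
      exact h1.measurable_piecewise continuousOn_const hE
    have h3 : G = fun w => ‖E.indicator f w‖ₑ ^ s := by
      ext w
      by_cases hw : w ∈ E
      · simp [G, hw]
      · simp [G, hw, hs]
    rw [h3]
    exact h2.enorm.pow_const s
  set T : Cn n → Cn n := fun u => z + stretch ζ δ ((1 / 2 : ℝ) • u)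
  have hT : ∀ u, ‖u‖ < 1 → T u ∈ E := fun u hu => by
    simp only [T, hz]
    exact norm_unit_add_half_stretch hζ hδ.1 hδ.2 hu
  have hTd : Differentiable ℂ T := by
    have h1 : Differentiable ℂ (stretch ζ δ) :=
      (LinearMap.toContinuousLinearMap (stretch ζ δ)).differentiable
    have h2 : Differentiable ℂ fun u : Cn n => (1 / 2 : ℝ) • u := by fun_prop
    exact (h1.comp h2).const_add z
  have hfT : DifferentiableOn ℂ (fun u => f (T u)) (unitBall n) :=
    hf.comp hTd.differentiableOn fun u hu => hEB (hT u (by simpa using hu))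
  have hTm : Measurable T := hTd.continuous.measurable
  -- lower bound for the integral over the ellipsoid
  have hlow : S * k * ‖f z‖ₑ ^ s ≤ ∫⁻ u, G (T u) := by
    rw [lintegral_polar hn (F := fun u => G (T u)) (hG.comp hTm), mul_assoc]
    refine mul_le_mul_right ?_ S
    calc k * ‖f z‖ₑ ^ s = ∫⁻ t in Ioo (0 : ℝ) 1, ENNReal.ofReal (t ^ (2 * n - 1)) * ‖f z‖ₑ ^ s := by
          rw [lintegral_mul_const _ (by fun_prop)]
      _ ≤ ∫⁻ t in Ioo (0 : ℝ) 1, ENNReal.ofReal (t ^ (2 * n - 1)) *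
          ∫⁻ ξ : unitSphere n, G (T (t • (ξ : Cn n))) ∂(sphereMeasure n) := by
        refine setLIntegral_mono' measurableSet_Ioo fun t ht => mul_le_mul_right ?_ _
        -- The sub-mean value property is used for `f ∘ T`, whose value at the centre is `f z`.
        have h1 := enorm_rpow_le_lintegral_sphere hn hfT hs ht.1.le ht.2
        have h2 : T 0 = z := by simp [T]
        rw [h2] at h1
        refine h1.trans (lintegral_mono fun ξ => ?_)
        have h3 : T (t • (ξ : Cn n)) ∈ E :=
          hT _ (by simpa using real_smul_mem_unitBall ht.1.le ht.2 ξ)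
        simp [G, h3]
      _ ≤ _ := lintegral_mono_set Ioo_subset_Ioi_self
  -- upper bound
  have hup : ∫⁻ u, G (T u) ≤ ENNReal.ofReal (2 ^ (2 * n)) * ENNReal.ofReal ((δ ^ (n + 1))⁻¹) *
      (S * (ENNReal.ofReal (2 * δ) * N)) := by
    rw [lintegral_comp_half_stretch hζ hδ.1 z hG]
    refine mul_le_mul_right ?_ _
    rw [lintegral_polar hn hG]
    refine mul_le_mul_right ?_ _
    have h2 : ∀ t ∈ Ioi (0 : ℝ), ENNReal.ofReal (t ^ (2 * n - 1)) *
        ∫⁻ ξ : unitSphere n, G (t • (ξ : Cn n)) ∂(sphereMeasure n) ≤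
        (Ioo (1 - 2 * δ) 1).indicator (fun _ => N) t := by
      intro t ht
      have ht0 : 0 < t := ht
      have hnorm : ∀ ξ : unitSphere n, ‖t • (ξ : Cn n)‖ = t := fun ξ => by
        simp [norm_smul, abs_of_pos ht0]
      by_cases htE : t ∈ Ioo (1 - 2 * δ) 1
      · rw [indicator_of_mem htE]
        have h3 : ENNReal.ofReal (t ^ (2 * n - 1)) ≤ 1 := by
          rw [← ENNReal.ofReal_one]
          exact ENNReal.ofReal_le_ofReal (pow_le_one₀ ht0.le htE.2.le)
        calc _ ≤ 1 * N := by
              refine mul_le_mul' h3 ((lintegral_mono fun ξ => ?_).trans (hN t ⟨ht0, htE.2⟩))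
              have h4 : t • (ξ : Cn n) ∈ E := by
                change ‖t • (ξ : Cn n)‖ ∈ Ioo (1 - 2 * δ) 1
                rwa [hnorm]
              simp [G, h4]
          _ = N := one_mul _
      · have h3 : ∀ ξ : unitSphere n, G (t • (ξ : Cn n)) = 0 := fun ξ => by
          have h4 : t • (ξ : Cn n) ∉ E := by
            change ¬ ‖t • (ξ : Cn n)‖ ∈ Ioo (1 - 2 * δ) 1
            rwa [hnorm]
          simp [G, h4]
        simp [h3]
    calc _ ≤ ∫⁻ t in Ioi (0 : ℝ), (Ioo (1 - 2 * δ) 1).indicator (fun _ => N) t :=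
          setLIntegral_mono' measurableSet_Ioi h2
      _ ≤ ∫⁻ t, (Ioo (1 - 2 * δ) 1).indicator (fun _ => N) t := setLIntegral_le_lintegral _ _
      _ = ENNReal.ofReal (2 * δ) * N := by
        rw [lintegral_indicator_const measurableSet_Ioo, Real.volume_Ioo, mul_comm]
        ring_nf
  have hfin := hlow.trans hup
  -- The inverse Jacobian `δ^{-(n+1)}` against the shell thickness `2δ` leaves exactly `δ^{-n}`.
  have hδn : ENNReal.ofReal ((δ ^ (n + 1))⁻¹) * ENNReal.ofReal (2 * δ) =
      ENNReal.ofReal 2 * ENNReal.ofReal ((δ ^ n)⁻¹) := by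
    have := hδ.1
    rw [← ENNReal.ofReal_mul (by positivity), ← ENNReal.ofReal_mul (by positivity)]
    congr 1
    rw [pow_succ]; field_simp
  have hrhs : ENNReal.ofReal (2 ^ (2 * n)) * ENNReal.ofReal ((δ ^ (n + 1))⁻¹) *
      (S * (ENNReal.ofReal (2 * δ) * N)) =
      S * (ENNReal.ofReal (2 * 2 ^ (2 * n)) * ENNReal.ofReal ((δ ^ n)⁻¹) * N) := by
    have key : ∀ a b c d e : ℝ≥0∞, a * b * (c * (d * e)) = c * a * (b * d) * e := by
      intros; ring
    have key2 : ∀ a b c d e : ℝ≥0∞, c * a * (d * b) * e = c * (d * a * b * e) := by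
      intros; ring
    rw [key, hδn, ENNReal.ofReal_mul (by norm_num : (0 : ℝ) ≤ 2), key2]
  rw [hrhs, mul_assoc, ENNReal.mul_le_mul_iff_right hS0 hS1] at hfin
  calc ‖f z‖ₑ ^ s = k⁻¹ * (k * ‖f z‖ₑ ^ s) := by
        rw [← mul_assoc, ENNReal.inv_mul_cancel hk hk1, one_mul]
    _ ≤ k⁻¹ * (ENNReal.ofReal (2 * 2 ^ (2 * n)) * ENNReal.ofReal ((δ ^ n)⁻¹) * N) := by gcongr
    _ = _ := by simp only [mul_assoc]

end PointEvaluation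

/-! ### Surface measure of nonisotropic balls. -/

section QuasiBall

variable {n : ℕ}

/-- The nonisotropic ball on the sphere with centre `ζ` and radius `t`. -/
def quasiBall (ζ : Cn n) (t : ℝ) : Set (unitSphere n) := {ξ | ‖1 - inner ℂ ζ (ξ : Cn n)‖ < t}

theorem isOpen_quasiBall (ζ : Cn n) (t : ℝ) : IsOpen (quasiBall ζ t) :=
  isOpen_lt (by fun_prop) continuous_const

theorem norm_inner_le_one {ζ w : Cn n} (hζ : ‖ζ‖ ≤ 1) (hw : ‖w‖ ≤ 1) :
    ‖(inner ℂ ζ w : ℂ)‖ ≤ 1 :=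
  (norm_inner_le_norm ζ w).trans (mul_le_one₀ hζ (norm_nonneg _) hw)

/-- The region is contained in `ζ + stretch ζ h (B(0, 4))`. Its component along `ζ` is controlled by
definition. The tangential one satisfies `|w'|² ≤ 1 - |⟨w, ζ⟩|² ≤ 1 - (1 - 2h)² ≤ 4h`, where `h ≤
1/2` permits squaring. -/
theorem volume_image_stretch_le {ζ : Cn n} (hζ : ‖ζ‖ = 1) {h : ℝ} (hh0 : 0 < h) (hh : h ≤ 1 / 2) :
    (volume : Measure (Cn n)) {w | ‖w‖ < 1 ∧ ‖1 - inner ℂ ζ w‖ < 2 * h} ≤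
      ENNReal.ofReal (h ^ (n + 1)) * volume (Metric.ball (0 : Cn n) 4) := by
  set L := (stretch ζ h).restrictScalars ℝ
  have hdet : LinearMap.det L = h ^ (n + 1) := det_stretch hζ hh0.le
  have hsub : {w | ‖w‖ < 1 ∧ ‖1 - inner ℂ ζ w‖ < 2 * h} ⊆
      (fun u => ζ + u) '' (L '' Metric.ball (0 : Cn n) 4) := by
    rintro w ⟨hw1, hw2⟩
    have hunit : IsUnit (LinearMap.det L) := by
      rw [hdet]; exact (pow_pos hh0 _).ne'.isUnit
    obtain ⟨u, hu⟩ : ∃ u, L u = w - ζ := by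
      obtain ⟨u, hu⟩ := (L.equivOfIsUnitDet hunit).surjective (w - ζ)
      exact ⟨u, by simpa using hu⟩
    have hu' : stretch ζ h u = w - ζ := hu
    refine ⟨w - ζ, ⟨u, ?_, hu⟩, by simp⟩
    have h1 := inner_stretch hζ hh0.le u
    rw [hu', inner_sub_right, inner_self_eq_norm_sq_to_K, hζ] at h1
    have h2 : h * ‖(inner ℂ ζ u : ℂ)‖ < 2 * h := by
      rw [← Real.norm_of_nonneg hh0.le, ← Complex.norm_real, ← norm_mul, ← h1, norm_sub_rev]
      simpa [abs_of_pos hh0] using hw2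
    have h3 : ‖(inner ℂ ζ u : ℂ)‖ < 2 := by nlinarith
    have h4 := norm_sq_add_stretch hζ hh0.le 1 u
    rw [one_smul, hu', add_sub_cancel, ← inner_stretch hζ hh0.le, hu', inner_sub_right,
      inner_self_eq_norm_sq_to_K, hζ] at h4
    have h5 : 1 - 2 * h ≤ ‖(inner ℂ ζ w : ℂ)‖ := by
      have := norm_sub_norm_le (1 : ℂ) (1 - inner ℂ ζ w)
      rw [sub_sub_cancel, norm_one] at this
      linarith
    simp only [Complex.coe_algebraMap, Complex.ofReal_one, one_pow, add_sub_cancel] at h4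
    have h6 : ‖u - (inner ℂ ζ u : ℂ) • ζ‖ ^ 2 ≤ 4 := by
      have a1 : (1 - 2 * h) ^ 2 ≤ ‖(inner ℂ ζ w : ℂ)‖ ^ 2 := by gcongr; linarith
      have a2 : ‖w‖ ^ 2 ≤ 1 := by nlinarith [norm_nonneg w]
      have a3 : h * ‖u - (inner ℂ ζ u : ℂ) • ζ‖ ^ 2 ≤ h * 4 := by nlinarith
      exact le_of_mul_le_mul_left a3 hh0
    have h7 := norm_sq_eq_inner_add hζ u
    rw [mem_ball_zero_iff]
    have : ‖u‖ ^ 2 < 4 ^ 2 := by nlinarith [norm_nonneg (inner ℂ ζ u : ℂ)]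
    exact lt_of_pow_lt_pow_left₀ 2 (by norm_num) this
  refine (measure_mono hsub).trans ?_
  rw [image_add_left, measure_preimage_add, Measure.addHaar_image_linearMap, hdet,
    abs_of_pos (pow_pos hh0 _)]

/-- The surface measure of a nonisotropic ball of radius `h` is at most a constant times `h ^ n`. -/
theorem exists_sphereMeasure_quasiBall_le (hn : 1 ≤ n) : ∃ C : ℝ≥0, ∀ ζ : Cn n, ‖ζ‖ = 1 →
    ∀ h : ℝ, 0 < h → sphereMeasure n (quasiBall ζ h) ≤ C * ENNReal.ofReal (h ^ n) := by
  have := isProbabilityMeasure_sphereMeasure hn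
  set S := (volume : Measure (Cn n)).toSphere univ
  have hS0 : S ≠ 0 := toSphere_univ_ne_zero hn
  have hS1 : S ≠ ∞ := measure_ne_top _ _
  set V := (volume : Measure (Cn n)) (Metric.ball (0 : Cn n) 4)
  have hV : V ≠ ∞ := measure_ball_lt_top.ne
  set C₁ : ℝ≥0∞ := S⁻¹ * (ENNReal.ofReal (2 ^ (2 * n - 1)) * V)
  have hC₁ : C₁ ≠ ∞ := ENNReal.mul_ne_top (ENNReal.inv_ne_top.2 hS0)
    (ENNReal.mul_ne_top ENNReal.ofReal_ne_top hV)
  refine ⟨(C₁ + ENNReal.ofReal (2 ^ n)).toNNReal, fun ζ hζ h hh0 => ?_⟩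
  rw [ENNReal.coe_toNNReal (ENNReal.add_ne_top.2 ⟨hC₁, ENNReal.ofReal_ne_top⟩)]
  rcases lt_or_ge (1 / 2) h with hh | hh
  · calc sphereMeasure n (quasiBall ζ h) ≤ 1 := prob_le_one
      _ ≤ ENNReal.ofReal (2 ^ n) * ENNReal.ofReal (h ^ n) := by
        rw [← ENNReal.ofReal_mul (by positivity), ← mul_pow, ← ENNReal.ofReal_one]
        exact ENNReal.ofReal_le_ofReal (one_le_pow₀ (by linarith))
      _ ≤ _ := by gcongr; exact le_add_self
  · set A : Set (Cn n) := {w | ‖w‖ < 1 ∧ ‖1 - inner ℂ ζ w‖ < 2 * h}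
    have hA : MeasurableSet A := by
      have h1 : MeasurableSet {w : Cn n | ‖w‖ < 1} :=
        (isOpen_lt continuous_norm continuous_const).measurableSet
      have h2 : MeasurableSet {w : Cn n | ‖1 - inner ℂ ζ w‖ < 2 * h} :=
        (isOpen_lt (by fun_prop) continuous_const).measurableSet
      exact h1.inter h2
    have hvol : volume A ≤ ENNReal.ofReal (h ^ (n + 1)) * V := volume_image_stretch_le hζ hh0 hh
    rw [← lintegral_indicator_one hA, lintegral_polar hn (measurable_one.indicator hA)] at hvol
    -- Thickening the nonisotropic ball radially over `1 - h < t < 1` stays inside `A`, at the price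
    -- of doubling `h`. Hence `h · σ(Q)` is bounded by a constant times the volume `h^{n+1}`. On
    -- this range `t ≥ 1/2` because `h ≤ 1/2`.
    have hlow : ENNReal.ofReal (((1 / 2) ^ (2 * n - 1)) * h) * sphereMeasure n (quasiBall ζ h) ≤
        ∫⁻ t in Ioi (0 : ℝ), ENNReal.ofReal (t ^ (2 * n - 1)) *
          ∫⁻ ξ : unitSphere n, A.indicator 1 (t • (ξ : Cn n)) ∂(sphereMeasure n) := by
      calc _ = ∫⁻ t in Ioo (1 - h) 1, ENNReal.ofReal ((1 / 2) ^ (2 * n - 1)) *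
            sphereMeasure n (quasiBall ζ h) := by
            rw [setLIntegral_const, Real.volume_Ioo, ENNReal.ofReal_mul (by positivity),
              sub_sub_cancel]
            ring
        _ ≤ ∫⁻ t in Ioo (1 - h) 1, ENNReal.ofReal (t ^ (2 * n - 1)) *
            ∫⁻ ξ : unitSphere n, A.indicator 1 (t • (ξ : Cn n)) ∂(sphereMeasure n) := by
            refine setLIntegral_mono' measurableSet_Ioo fun t ht => ?_
            refine mul_le_mul' (ENNReal.ofReal_le_ofReal ?_) ?_
            · exact pow_le_pow_left₀ (by norm_num) (by linarith [ht.1]) _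
            · rw [← lintegral_indicator_one (isOpen_quasiBall ζ h).measurableSet]
              refine lintegral_mono fun ξ => ?_
              by_cases hξ : ξ ∈ quasiBall ζ h
              swap
              · simp [hξ]
              have ht0 : 0 ≤ t := by linarith [ht.1]
              have hξA : t • (ξ : Cn n) ∈ A := by
                refine ⟨by simpa using real_smul_mem_unitBall ht0 ht.2 ξ, ?_⟩
                have hξ' : ‖1 - inner ℂ ζ (ξ : Cn n)‖ < h := hξ
                rw [← Complex.coe_smul, inner_smul_right]
                have e : (1 : ℂ) - t * inner ℂ ζ (ξ : Cn n) =
                    (1 - inner ℂ ζ (ξ : Cn n)) + ((1 - t : ℝ) : ℂ) * inner ℂ ζ (ξ : Cn n) := by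
                  push_cast; ring
                rw [e]
                refine (norm_add_le _ _).trans_lt ?_
                rw [norm_mul, Complex.norm_real, Real.norm_of_nonneg (by linarith [ht.2])]
                have := norm_inner_le_one hζ.le (norm_unitSphere ξ).le
                nlinarith [ht.1, ht.2]
              simp [hξA, hξ]
        _ ≤ _ := lintegral_mono_set fun t ht => by
            have : (0 : ℝ) < t := by linarith [ht.1]
            exact this
    have h1 : S * (ENNReal.ofReal (((1 / 2) ^ (2 * n - 1)) * h) *
        sphereMeasure n (quasiBall ζ h)) ≤ ENNReal.ofReal (h ^ (n + 1)) * V :=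
      (mul_le_mul_right hlow S).trans hvol
    have h2 : sphereMeasure n (quasiBall ζ h) ≤ C₁ * ENNReal.ofReal (h ^ n) := by
      have e1 : ENNReal.ofReal (2 ^ (2 * n - 1) * h⁻¹) *
          ENNReal.ofReal (((1 / 2) ^ (2 * n - 1)) * h) = 1 := by
        rw [← ENNReal.ofReal_mul (by positivity), ← ENNReal.ofReal_one]
        congr 1
        rw [one_div, inv_pow]; field_simp
      have e2 : ENNReal.ofReal (2 ^ (2 * n - 1) * h⁻¹) * ENNReal.ofReal (h ^ (n + 1)) =
          ENNReal.ofReal (2 ^ (2 * n - 1)) * ENNReal.ofReal (h ^ n) := by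
        rw [← ENNReal.ofReal_mul (by positivity), ← ENNReal.ofReal_mul (by positivity)]
        congr 1
        rw [pow_succ]; field_simp
      set a := ENNReal.ofReal (2 ^ (2 * n - 1) * h⁻¹)
      set b := ENNReal.ofReal (((1 / 2) ^ (2 * n - 1)) * h)
      set σQ := sphereMeasure n (quasiBall ζ h)
      calc σQ = (S⁻¹ * S) * (a * b) * σQ := by
            rw [ENNReal.inv_mul_cancel hS0 hS1, e1, one_mul, one_mul]
        _ = S⁻¹ * a * (S * (b * σQ)) := by ring
        _ ≤ S⁻¹ * a * (ENNReal.ofReal (h ^ (n + 1)) * V) := by gcongr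
        _ = S⁻¹ * (a * ENNReal.ofReal (h ^ (n + 1))) * V := by ring
        _ = _ := by rw [e2]; simp only [C₁]; ring
    exact h2.trans (by gcongr; exact le_self_add)

end QuasiBall

/-! ### Szegő kernel powers and the Poisson–Szegő majorant. -/

section PoissonBound

variable {n : ℕ}

/-- Powers of a normalized Szegő-type kernel. -/
def testFunction (z : Cn n) (κ : ℝ) (w : Cn n) : ℂ :=
  (((1 - ‖z‖ ^ 2 : ℝ) : ℂ) / (1 - inner ℂ z w)) ^ (κ : ℂ)

theorem one_sub_ne_zero_of_norm_lt {a : ℂ} (ha : ‖a‖ < 1) : 1 - a ≠ 0 := by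
  intro h
  rw [← sub_eq_zero.1 h] at ha
  simp at ha

/-- The base stays in the right half-plane, so the principal branch of any real power is
holomorphic. -/
theorem testFunction_base_re_pos {z w : Cn n} (hz : ‖z‖ < 1) (h : ‖(inner ℂ z w : ℂ)‖ < 1) :
    0 < (((1 - ‖z‖ ^ 2 : ℝ) : ℂ) / (1 - inner ℂ z w)).re := by
  have h1 : (inner ℂ z w : ℂ).re < 1 := (Complex.re_le_norm _).trans_lt h
  have h2 : 0 < 1 - ‖z‖ ^ 2 := by nlinarith [norm_nonneg z]
  have h3 := Complex.normSq_pos.2 (one_sub_ne_zero_of_norm_lt h)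
  rw [Complex.div_re]
  simp only [Complex.ofReal_re, Complex.ofReal_im, zero_mul, zero_div, add_zero, Complex.sub_re,
    Complex.one_re]
  have : 0 < 1 - (inner ℂ z w : ℂ).re := by linarith
  positivity

theorem differentiableAt_testFunction {z w : Cn n} (hz : ‖z‖ < 1) (h : ‖(inner ℂ z w : ℂ)‖ < 1)
    (κ : ℝ) : DifferentiableAt ℂ (testFunction z κ) w := by
  have hi : DifferentiableAt ℂ (fun w : Cn n => (inner ℂ z w : ℂ)) w :=
    (innerSL ℂ z).differentiableAt
  refine DifferentiableAt.cpow_const ?_ (Or.inl (testFunction_base_re_pos hz h))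
  simp only [div_eq_mul_inv]
  exact ((hi.const_sub 1).fun_inv (one_sub_ne_zero_of_norm_lt h)).const_mul _

theorem norm_testFunction {z : Cn n} (hz : ‖z‖ < 1) (κ : ℝ) (w : Cn n) :
    ‖testFunction z κ w‖ = ((1 - ‖z‖ ^ 2) / ‖1 - inner ℂ z w‖) ^ κ := by
  have h2 : 0 ≤ 1 - ‖z‖ ^ 2 := by nlinarith [norm_nonneg z]
  rw [testFunction, Complex.norm_cpow_real, norm_div, Complex.norm_real, Real.norm_of_nonneg h2]

theorem norm_testFunction_self {z : Cn n} (hz : ‖z‖ < 1) (κ : ℝ) : ‖testFunction z κ z‖ = 1 := by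
  have h2 : 0 < 1 - ‖z‖ ^ 2 := by nlinarith [norm_nonneg z]
  have h3 : ‖1 - (inner ℂ z z : ℂ)‖ = 1 - ‖z‖ ^ 2 := by
    have : (1 : ℂ) - inner ℂ z z = ((1 - ‖z‖ ^ 2 : ℝ) : ℂ) := by
      rw [inner_self_eq_norm_sq_to_K]; simp
    rw [this, Complex.norm_real, Real.norm_of_nonneg h2.le]
  rw [norm_testFunction hz, h3, div_self h2.ne', Real.one_rpow]

theorem lintegral_sphere_le_boundary {f : Cn n → ℂ} {R : ℝ} (hR : 1 < R)
    (hf : DifferentiableOn ℂ f (Metric.ball 0 R)) {s : ℝ} (hs : 0 < s) {t : ℝ} (ht0 : 0 ≤ t)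
    (ht : t ≤ 1) :
    ∫⁻ ξ : unitSphere n, ‖f (t • (ξ : Cn n))‖ₑ ^ s ∂(sphereMeasure n) ≤
      ∫⁻ ξ : unitSphere n, ‖f ξ‖ₑ ^ s ∂(sphereMeasure n) := by
  have hR0 : 0 < R := by linarith
  have hd : DifferentiableOn ℂ (fun w : Cn n => f (R • w)) (unitBall n) := by
    refine hf.comp (by fun_prop) fun w hw => ?_
    have hw' : ‖w‖ < 1 := by simpa using hw
    rw [mem_ball_zero_iff, norm_smul, Real.norm_of_nonneg hR0.le]
    nlinarith [norm_nonneg w]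
  have h := lintegral_sphere_mono hd hs (t := t / R) (r := 1 / R) (by positivity) (by gcongr)
    ((div_lt_one hR0).2 hR)
  simpa [smul_smul, mul_div_cancel₀, hR0.ne'] using h

/-- `|f|^s` is dominated by the invariant Poisson integral of its boundary values, up to
a constant. -/
theorem exists_poisson_szego_bound (hn : 1 ≤ n) : ∃ C : ℝ≥0, ∀ (f : Cn n → ℂ) (R : ℝ), 1 < R →
    DifferentiableOn ℂ f (Metric.ball 0 R) → ∀ s : ℝ, 0 < s →
    ∀ ζ : Cn n, ‖ζ‖ = 1 → ∀ δ ∈ Ioc (0 : ℝ) 1, ∀ z : Cn n, z = (1 - δ) • ζ →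
      ‖f z‖ₑ ^ s ≤ C * ∫⁻ ξ : unitSphere n, ‖f ξ‖ₑ ^ s *
        ENNReal.ofReal ((1 - ‖z‖ ^ 2) ^ (n : ℝ) / ‖1 - inner ℂ z (ξ : Cn n)‖ ^ (2 * (n : ℝ)))
          ∂(sphereMeasure n) := by
  obtain ⟨C, hC⟩ := exists_point_evaluation_bound hn
  refine ⟨C * 2 ^ n, fun f R hR hf s hs ζ hζ δ hδ z hzdef => ?_⟩
  have hz : ‖z‖ = 1 - δ := by
    rw [hzdef, norm_smul, hζ, mul_one, Real.norm_of_nonneg (by linarith [hδ.2])]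
  have hz1 : ‖z‖ < 1 := by linarith [hδ.1]
  -- With this exponent `|h z| = 1`, while `|h|^s` on the sphere is `(1 - |z|²)^n` times the
  -- Poisson–Szegő kernel. That extra factor absorbs the `δ^{-n}` of the point evaluation bound
  -- applied to `f * h`.
  set h := testFunction z (2 * n / s)
  -- The radius is shrunk so that `1 - ⟨w, z⟩` has no zero and `f * h` is still holomorphic across
  -- the sphere.
  obtain ⟨R', hR'1, hR'R, hR'z⟩ : ∃ R', 1 < R' ∧ R' ≤ R ∧ R' * ‖z‖ ≤ 1 := by
    rcases (norm_nonneg z).eq_or_lt with h0 | h0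
    · exact ⟨R, hR, le_rfl, by rw [← h0]; simp⟩
    · refine ⟨min R (1 / ‖z‖), lt_min hR ?_, min_le_left _ _, ?_⟩
      · rwa [lt_div_iff₀ h0, one_mul]
      · calc min R (1 / ‖z‖) * ‖z‖ ≤ (1 / ‖z‖) * ‖z‖ := by gcongr; exact min_le_right _ _
          _ = 1 := by field_simp
  have hin : ∀ w ∈ Metric.ball (0 : Cn n) R', ‖(inner ℂ z w : ℂ)‖ < 1 := by
    intro w hw
    have hw' : ‖w‖ < R' := by simpa using hw
    refine (norm_inner_le_norm z w).trans_lt ?_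
    rcases (norm_nonneg z).eq_or_lt with h0 | h0
    · rw [← h0]; simp
    · nlinarith
  have hd : DifferentiableOn ℂ (fun w => f w * h w) (Metric.ball 0 R') :=
    (hf.mono (Metric.ball_subset_ball hR'R)).mul fun w hw =>
      (differentiableAt_testFunction hz1 (hin w hw) _).differentiableWithinAt
  have key := hC (fun w => f w * h w) (hd.mono (Metric.ball_subset_ball hR'1.le)) s hs _
    (fun t ht => lintegral_sphere_le_boundary hR'1 hd hs ht.1.le ht.2.le) ζ hζ δ hδ
  rw [← hzdef] at key
  have hh1 : ‖h z‖ₑ = 1 := by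
    rw [← ofReal_norm, norm_testFunction_self hz1, ENNReal.ofReal_one]
  rw [enorm_mul, hh1, mul_one] at key
  refine key.trans ?_
  have hδ0 := hδ.1
  rw [ENNReal.coe_mul, mul_assoc, mul_assoc]
  refine mul_le_mul_right ?_ _
  rw [← lintegral_const_mul' _ _ ENNReal.ofReal_ne_top, ← lintegral_const_mul' _ _ ENNReal.coe_ne_top]
  refine lintegral_mono fun ξ => ?_
  have hξ := hin ξ (by rw [mem_ball_zero_iff, norm_unitSphere]; exact hR'1)
  have hd0 : 0 < ‖1 - inner ℂ z (ξ : Cn n)‖ := norm_pos_iff.2 (one_sub_ne_zero_of_norm_lt hξ)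
  have h2 : 0 < 1 - ‖z‖ ^ 2 := by nlinarith [norm_nonneg z]
  have h3 : ‖h ξ‖ₑ ^ s = ENNReal.ofReal
      ((1 - ‖z‖ ^ 2) ^ (2 * n) / ‖1 - inner ℂ z (ξ : Cn n)‖ ^ (2 * n)) := by
    rw [← ofReal_norm, ENNReal.ofReal_rpow_of_nonneg (norm_nonneg _) hs.le,
      norm_testFunction hz1, ← Real.rpow_mul (by positivity), div_mul_cancel₀ _ hs.ne', ← div_pow]
    norm_cast
  have h4 : (1 - ‖z‖ ^ 2) ^ (n : ℝ) / ‖1 - inner ℂ z (ξ : Cn n)‖ ^ (2 * (n : ℝ)) =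
      (1 - ‖z‖ ^ 2) ^ n / ‖1 - inner ℂ z (ξ : Cn n)‖ ^ (2 * n) := by norm_cast
  have h5 : ((2 ^ n : ℝ≥0) : ℝ≥0∞) = ENNReal.ofReal (2 ^ n) := by
    rw [← ENNReal.ofReal_coe_nnreal]; simp
  rw [enorm_mul, ENNReal.mul_rpow_of_nonneg _ _ hs.le, h3, h4, h5]
  calc _ = ‖f ξ‖ₑ ^ s * (ENNReal.ofReal (δ ^ n)⁻¹ * ENNReal.ofReal
        ((1 - ‖z‖ ^ 2) ^ (2 * n) / ‖1 - inner ℂ z (ξ : Cn n)‖ ^ (2 * n))) := by ring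
    _ ≤ ‖f ξ‖ₑ ^ s * (ENNReal.ofReal (2 ^ n) * ENNReal.ofReal
        ((1 - ‖z‖ ^ 2) ^ n / ‖1 - inner ℂ z (ξ : Cn n)‖ ^ (2 * n))) := by
      gcongr ‖f ξ‖ₑ ^ s * ?_
      rw [← ENNReal.ofReal_mul (by positivity), ← ENNReal.ofReal_mul (by positivity)]
      refine ENNReal.ofReal_le_ofReal ?_
      have h6 : (1 - ‖z‖ ^ 2) ^ n ≤ 2 ^ n * δ ^ n := by
        rw [← mul_pow]
        exact pow_le_pow_left₀ h2.le (by rw [hz]; nlinarith) n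
      have h7 : (δ ^ n)⁻¹ * (1 - ‖z‖ ^ 2) ^ n ≤ 2 ^ n := by
        rw [inv_mul_le_iff₀ (by positivity)]; linarith
      calc _ = ((δ ^ n)⁻¹ * (1 - ‖z‖ ^ 2) ^ n) *
            ((1 - ‖z‖ ^ 2) ^ n / ‖1 - inner ℂ z (ξ : Cn n)‖ ^ (2 * n)) := by ring
        _ ≤ _ := by gcongr
    _ = _ := by ring

end PoissonBound

/-! ### The quasi-metric `|1 - ⟨z, w⟩|` and dyadic integration of the kernel. -/

section Geometry

variable {n : ℕ}

/-- The quasi-triangle inequality for `|1 - ⟨z, w⟩|` with intermediate point on the sphere. -/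
theorem norm_one_sub_inner_le {z w u : Cn n} (hz : ‖z‖ ≤ 1) (hw : ‖w‖ ≤ 1) (hu : ‖u‖ = 1) :
    ‖1 - inner ℂ z w‖ ≤ 2 * (‖1 - inner ℂ u z‖ + ‖1 - inner ℂ u w‖) := by
  set a : ℂ := inner ℂ u z
  set b : ℂ := inner ℂ u w
  set α := ‖1 - a‖
  set β := ‖1 - b‖
  have ha1 : ‖a‖ ≤ 1 := norm_inner_le_one hu.le hz
  have hb1 : ‖b‖ ≤ 1 := norm_inner_le_one hu.le hw
  have hrem : ∀ v : Cn n, ‖v‖ ≤ 1 →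
      ‖v - (inner ℂ u v : ℂ) • u‖ ^ 2 ≤ 2 * ‖1 - (inner ℂ u v : ℂ)‖ := by
    intro v hv
    have h1 := norm_sq_eq_inner_add hu v
    have h2 : ‖(inner ℂ u v : ℂ)‖ ≤ 1 := norm_inner_le_one hu.le hv
    have h3 := norm_sub_norm_le (1 : ℂ) (1 - inner ℂ u v)
    rw [sub_sub_cancel, norm_one] at h3
    nlinarith [norm_nonneg v, norm_nonneg (inner ℂ u v : ℂ)]
  have hx := hrem z hz
  have hy := hrem w hw
  change ‖z - a • u‖ ^ 2 ≤ 2 * α at hx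
  change ‖w - b • u‖ ^ 2 ≤ 2 * β at hy
  -- Split `z` and `w` along `u` and orthogonally to it. The orthogonal parts have squared norms at
  -- most `2α` and `2β`, so Cauchy–Schwarz bounds their inner product by `α + β`.
  have hdec : (1 : ℂ) - inner ℂ z w =
      (1 - b) + (1 - (starRingEnd ℂ) a) * b - inner ℂ (z - a • u) (w - b • u) := by
    have e1 : (inner ℂ z u : ℂ) = (starRingEnd ℂ) a := (inner_conj_symm z u).symm
    rw [inner_sub_left, inner_sub_right, inner_sub_right, inner_smul_left, inner_smul_right,
      inner_smul_left, inner_smul_right, inner_self_eq_norm_sq_to_K, hu, e1]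
    change _ = (1 - b) + (1 - (starRingEnd ℂ) a) * b -
      (inner ℂ z w - b * (starRingEnd ℂ) a - ((starRingEnd ℂ) a * b - _))
    simp
    ring
  have h1 : ‖1 - (starRingEnd ℂ) a‖ = α := by
    rw [← Complex.norm_conj]; simp [α]
  have h2 : ‖(inner ℂ (z - a • u) (w - b • u) : ℂ)‖ ≤ α + β := by
    refine (norm_inner_le_norm _ _).trans ?_
    nlinarith [sq_nonneg (‖z - a • u‖ - ‖w - b • u‖)]
  calc ‖(1 : ℂ) - inner ℂ z w‖ ≤ (β + α * 1) + (α + β) := by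
        rw [hdec]
        refine (norm_sub_le _ _).trans (add_le_add ((norm_add_le _ _).trans ?_) h2)
        rw [norm_mul, h1]
        gcongr
    _ = _ := by ring

/-- Moving the pole inward from `ζ` by `δ` changes `1 - ⟨w, ζ⟩` by at most `δ`, and the new quantity
is itself at least `δ`. -/
theorem norm_one_sub_inner_le_two_mul {ζ w : Cn n} (hζ : ‖ζ‖ = 1) (hw : ‖w‖ ≤ 1) {δ : ℝ}
    (hδ0 : 0 ≤ δ) (hδ1 : δ ≤ 1) :
    δ ≤ ‖1 - inner ℂ ((1 - δ) • ζ) w‖ ∧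
      ‖1 - inner ℂ ζ w‖ ≤ 2 * ‖1 - inner ℂ ((1 - δ) • ζ) w‖ := by
  have e : (inner ℂ ((1 - δ) • ζ) w : ℂ) = ((1 - δ : ℝ) : ℂ) * inner ℂ ζ w := by
    rw [← Complex.coe_smul, inner_smul_left, Complex.conj_ofReal]
  rw [e]
  set a : ℂ := inner ℂ ζ w
  have ha : ‖a‖ ≤ 1 := norm_inner_le_one hζ.le hw
  have hn : ‖((1 - δ : ℝ) : ℂ) * a‖ ≤ 1 - δ := by
    rw [norm_mul, Complex.norm_real, Real.norm_of_nonneg (by linarith)]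
    nlinarith
  have h1 : δ ≤ ‖1 - ((1 - δ : ℝ) : ℂ) * a‖ := by
    have := norm_sub_norm_le (1 : ℂ) (((1 - δ : ℝ) : ℂ) * a)
    rw [norm_one] at this
    linarith
  refine ⟨h1, ?_⟩
  have e2 : 1 - a = (1 - ((1 - δ : ℝ) : ℂ) * a) - (δ : ℂ) * a := by push_cast; ring
  calc ‖1 - a‖ ≤ ‖1 - ((1 - δ : ℝ) : ℂ) * a‖ + ‖(δ : ℂ) * a‖ := by
        rw [e2]; exact norm_sub_le _ _
    _ ≤ ‖1 - ((1 - δ : ℝ) : ℂ) * a‖ + δ := by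
        gcongr
        rw [norm_mul, Complex.norm_real, Real.norm_of_nonneg hδ0]
        nlinarith
    _ ≤ _ := by linarith

theorem measurableSet_carlesonSet (ζ : Cn n) (h : ℝ) : MeasurableSet (carlesonSet ζ h) := by
  have h1 : MeasurableSet {w : Cn n | ‖1 - inner ℂ ζ w‖ < h} :=
    (isOpen_lt (by fun_prop) continuous_const).measurableSet
  exact Metric.isClosed_closedBall.measurableSet.inter h1

/-- A measure with the growth of a Carleson measure at scales `t ≥ δ` integrates the kernel
centred at distance `δ` from the sphere. -/
theorem exists_lintegral_kernel_le {κ : ℝ} (hκ : 0 < κ) : ∃ C : ℝ≥0, ∀ (ν : Measure (Cn n))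
    (ζ : Cn n), ‖ζ‖ = 1 → ∀ δ ∈ Ioc (0 : ℝ) 1, ∀ A : ℝ≥0∞,
    (∀ t ≥ δ, ν (carlesonSet ζ t) ≤ A * ENNReal.ofReal (t ^ κ)) →
    ∀ z : Cn n, z = (1 - δ) • ζ →
      ∫⁻ w in closedUnitBall n,
        ENNReal.ofReal ((1 - ‖z‖ ^ 2) ^ κ / ‖1 - inner ℂ z w‖ ^ (2 * κ)) ∂ν ≤ C * A := by
  set ρ : ℝ≥0∞ := ENNReal.ofReal ((1 / 2 : ℝ) ^ κ)
  have hρ : ρ < 1 := by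
    rw [← ENNReal.ofReal_one]
    exact (ENNReal.ofReal_lt_ofReal_iff one_pos).2
      (Real.rpow_lt_one (by norm_num) (by norm_num) hκ)
  have hC : ENNReal.ofReal ((32 : ℝ) ^ κ) * (1 - ρ)⁻¹ ≠ ∞ :=
    ENNReal.mul_ne_top ENNReal.ofReal_ne_top (ENNReal.inv_ne_top.2 (tsub_pos_of_lt hρ).ne')
  refine ⟨(ENNReal.ofReal ((32 : ℝ) ^ κ) * (1 - ρ)⁻¹).toNNReal,
    fun ν ζ hζ δ hδ A hA z hzdef => ?_⟩
  rw [ENNReal.coe_toNNReal hC]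
  have hδ0 := hδ.1
  have hz : ‖z‖ = 1 - δ := by
    rw [hzdef, norm_smul, hζ, mul_one, Real.norm_of_nonneg (by linarith [hδ.2])]
  set a : ℕ → ℝ := fun k => (2 * δ) ^ κ / ((2 : ℝ) ^ k * δ / 4) ^ (2 * κ)
  have hpt : ∀ w ∈ closedUnitBall n,
      ENNReal.ofReal ((1 - ‖z‖ ^ 2) ^ κ / ‖1 - inner ℂ z w‖ ^ (2 * κ)) ≤
        ∑' k : ℕ, (carlesonSet ζ ((2 : ℝ) ^ k * δ)).indicator
          (fun _ => ENNReal.ofReal (a k)) w := by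
    intro w hw
    have hw1 : ‖w‖ ≤ 1 := by simpa using hw
    obtain ⟨h1, h2⟩ := norm_one_sub_inner_le_two_mul hζ hw1 hδ0.le hδ.2
    rw [← hzdef] at h1 h2
    set d := ‖1 - inner ℂ ζ w‖
    set D := ‖1 - inner ℂ z w‖
    have hex : ∃ k : ℕ, d < (2 : ℝ) ^ k * δ := by
      obtain ⟨k, hk⟩ := pow_unbounded_of_one_lt (d / δ) (one_lt_two (α := ℝ))
      exact ⟨k, by rwa [div_lt_iff₀ hδ0] at hk⟩
    classical
    -- The smallest dyadic scale containing `w`. Minimality bounds the denominator below by `2^k δ /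
    -- 4`; for `k = 0` the bound `D ≥ δ` does this.
    set k := Nat.find hex
    have hk : d < (2 : ℝ) ^ k * δ := Nat.find_spec hex
    have hkD : (2 : ℝ) ^ k * δ / 4 ≤ D := by
      rcases Nat.eq_zero_or_pos k with h0 | h0
      · rw [h0, pow_zero, one_mul]; linarith
      · obtain ⟨j, hj⟩ := Nat.exists_eq_succ_of_ne_zero h0.ne'
        have := Nat.find_min hex (m := j) (by change j < k; omega)
        push Not at this
        rw [hj, pow_succ]
        linarith
    refine le_trans ?_ (ENNReal.le_tsum k)
    have hmem : w ∈ carlesonSet ζ ((2 : ℝ) ^ k * δ) := ⟨hw, hk⟩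
    rw [indicator_of_mem hmem]
    refine ENNReal.ofReal_le_ofReal ?_
    have hz2 : 0 ≤ 1 - ‖z‖ ^ 2 := by rw [hz]; nlinarith [hδ.2]
    simp only [a]
    gcongr
    rw [hz]; nlinarith
  calc _ ≤ ∫⁻ w in closedUnitBall n, ∑' k : ℕ, (carlesonSet ζ ((2 : ℝ) ^ k * δ)).indicator
          (fun _ => ENNReal.ofReal (a k)) w ∂ν :=
        setLIntegral_mono' Metric.isClosed_closedBall.measurableSet hpt
    _ ≤ ∫⁻ w, ∑' k : ℕ, (carlesonSet ζ ((2 : ℝ) ^ k * δ)).indicator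
          (fun _ => ENNReal.ofReal (a k)) w ∂ν := setLIntegral_le_lintegral _ _
    _ = ∑' k : ℕ, ENNReal.ofReal (a k) * ν (carlesonSet ζ ((2 : ℝ) ^ k * δ)) := by
        rw [lintegral_tsum fun k => (measurable_const.indicator
          (measurableSet_carlesonSet _ _)).aemeasurable]
        simp_rw [lintegral_indicator_const (measurableSet_carlesonSet _ _)]
    _ ≤ ∑' k : ℕ, ENNReal.ofReal ((32 : ℝ) ^ κ) * A * ρ ^ k := by
        refine ENNReal.tsum_le_tsum fun k => ?_
        have h2k : (1 : ℝ) ≤ 2 ^ k := one_le_pow₀ (by norm_num)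
        have ht := hA ((2 : ℝ) ^ k * δ) (by nlinarith)
        -- `2δ · 2^k δ / (2^k δ / 4)² = 32 / 2^k`: the squared denominator beats the growth of the
        -- measure, leaving a geometric series.
        have e : a k * ((2 : ℝ) ^ k * δ) ^ κ = (32 : ℝ) ^ κ * ((1 / 2 : ℝ) ^ κ) ^ k := by
          have p : (0 : ℝ) < 2 ^ k := by positivity
          have e1 : ((1 / 2 : ℝ) ^ κ) ^ k = ((1 / 2 : ℝ) ^ k) ^ κ := by
            rw [← Real.rpow_natCast, ← Real.rpow_natCast, ← Real.rpow_mul (by norm_num),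
              ← Real.rpow_mul (by norm_num), mul_comm]
          simp only [a]
          rw [e1, Real.rpow_mul (by positivity), ← Real.div_rpow (by positivity) (by positivity),
            ← Real.mul_rpow (by positivity) (by positivity),
            ← Real.mul_rpow (by positivity) (by positivity)]
          congr 1
          rw [Real.rpow_two, one_div, inv_pow]
          field_simp
          norm_num
        calc ENNReal.ofReal (a k) * ν (carlesonSet ζ ((2 : ℝ) ^ k * δ))
            ≤ ENNReal.ofReal (a k) * (A * ENNReal.ofReal (((2 : ℝ) ^ k * δ) ^ κ)) := by gcongr
          _ = ENNReal.ofReal (a k * ((2 : ℝ) ^ k * δ) ^ κ) * A := by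
            rw [ENNReal.ofReal_mul (by positivity)]; ring
          _ = _ := by
            rw [e, ENNReal.ofReal_mul (by positivity), ENNReal.ofReal_pow (by positivity)]
            ring
    _ = _ := by
        rw [ENNReal.tsum_mul_left, ENNReal.tsum_geometric]
        ring

end Geometry

/-! ### Tent sets: weak type estimate and interpolation. -/

section WeakType

variable {n : ℕ}

/-- The union of the Carleson sets over the nonisotropic balls where the mean of `g` exceeds
`lam`. -/
def tentSet (g : unitSphere n → ℝ≥0∞) (lam : ℝ) : Set (Cn n) :=
  {z | ∃ ζ : Cn n, ‖ζ‖ = 1 ∧ ∃ t > 0, z ∈ carlesonSet ζ (2 * t) ∧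
    ENNReal.ofReal (lam * t ^ n) < ∫⁻ ξ in quasiBall ζ t, g ξ ∂(sphereMeasure n)}

/-- Each term is at most the sum, so `x i ^ β ≤ (∑ x) ^ (β - 1) * x i`. This is where `p ≤ q` enters
the embedding. -/
theorem tsum_rpow_le_rpow_tsum {ι : Type*} (x : ι → ℝ≥0∞) {β : ℝ} (hβ : 1 ≤ β) :
    ∑' i, x i ^ β ≤ (∑' i, x i) ^ β := by
  have h : ∀ y : ℝ≥0∞, y ^ β = y ^ (β - 1) * y := fun y => by
    conv_lhs => rw [show β = (β - 1) + 1 by ring]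
    rw [ENNReal.rpow_add_of_nonneg _ _ (by linarith) zero_le_one, ENNReal.rpow_one]
  rw [h (∑' i, x i), ← ENNReal.tsum_mul_left]
  refine ENNReal.tsum_le_tsum fun i => ?_
  rw [h]
  gcongr
  exact ENNReal.le_tsum i

theorem mem_quasiBall_iff {ζ : Cn n} {t : ℝ} {ξ : unitSphere n} :
    ξ ∈ quasiBall ζ t ↔ ‖1 - inner ℂ ζ (ξ : Cn n)‖ < t := Iff.rfl

/-- Weak type estimate for the tent sets. -/
theorem measure_tentSet_le (hn : 1 ≤ n) {μ : Measure (Cn n)} {β : ℝ} (hβ : 1 ≤ β) {M : ℝ≥0∞}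
    (hM : ∀ ζ : Cn n, ‖ζ‖ = 1 → ∀ h > 0,
      μ (carlesonSet ζ h) ≤ M * ENNReal.ofReal (h ^ ((n : ℝ) * β)))
    {g : unitSphere n → ℝ≥0∞} (hg : ∫⁻ ξ, g ξ ∂(sphereMeasure n) ≠ ∞)
    {lam : ℝ} (hlam : 0 < lam) :
    μ (tentSet g lam) ≤ M * ENNReal.ofReal (20 ^ ((n : ℝ) * β)) *
      (ENNReal.ofReal lam⁻¹ * ∫⁻ ξ, g ξ ∂(sphereMeasure n)) ^ β := by
  set I := ∫⁻ ξ, g ξ ∂(sphereMeasure n)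
  set T : Set (Cn n × ℝ) := {p | ‖p.1‖ = 1 ∧ 0 < p.2 ∧
    ENNReal.ofReal (lam * p.2 ^ n) < ∫⁻ ξ in quasiBall p.1 p.2, g ξ ∂(sphereMeasure n)}
  have hT1 : ∀ p ∈ T, ‖p.1‖ = 1 := fun p hp => hp.1
  have hT2 : ∀ p ∈ T, 0 < p.2 := fun p hp => hp.2.1
  have hT3 : ∀ p ∈ T, ENNReal.ofReal (lam * p.2 ^ n) <
    ∫⁻ ξ in quasiBall p.1 p.2, g ξ ∂(sphereMeasure n) := fun p hp => hp.2.2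
  have hne : ∀ p ∈ T, (quasiBall p.1 p.2).Nonempty := by
    intro p hp
    refine ⟨⟨p.1, by simpa using hT1 p hp⟩, ?_⟩
    rw [mem_quasiBall_iff, inner_self_eq_norm_sq_to_K, hT1 p hp]
    simpa using hT2 p hp
  -- Vitali's lemma needs bounded radii: for radius `t ≥ 1` one has `lam * t ≤ lam * t ^ n ≤ I`.
  have hbd : ∀ p ∈ T, p.2 ≤ max 1 (I.toReal / lam) := by
    intro p hp
    rcases le_total p.2 1 with h | h
    · exact h.trans (le_max_left _ _)
    · refine le_trans ?_ (le_max_right _ _)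
      rw [le_div_iff₀ hlam]
      have h1 : ENNReal.ofReal (lam * p.2 ^ n) ≤ I :=
        (hT3 p hp).le.trans (setLIntegral_le_lintegral _ _)
      have h2 := (ENNReal.ofReal_le_iff_le_toReal hg).1 h1
      have h3 : p.2 ≤ p.2 ^ n := le_self_pow₀ h (by omega)
      nlinarith
  obtain ⟨u, huT, hdisj, hcov⟩ := Vitali.exists_disjoint_subfamily_covering_enlargement
    (fun p : Cn n × ℝ => quasiBall p.1 p.2) T (fun p => p.2) 2 one_lt_two
    (fun p hp => (hT2 p hp).le) _ hbd hne
  have hcount : u.Countable := hdisj.countable_of_isOpen (fun p _ => isOpen_quasiBall _ _)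
    fun p hp => hne p (huT hp)
  have hsub : tentSet g lam ⊆ ⋃ b ∈ u, carlesonSet b.1 (20 * b.2) := by
    rintro z ⟨ζ, hζ, t, ht, hz, hlt⟩
    obtain ⟨b, hb, ⟨η, hη1, hη2⟩, hle⟩ := hcov (ζ, t) ⟨hζ, ht, hlt⟩
    have hbt := hT2 b (huT hb)
    have hb1 := hT1 b (huT hb)
    simp only [mem_quasiBall_iff] at hη1 hη2
    change t ≤ 2 * b.2 at hle
    have hz1 : ‖z‖ ≤ 1 := by simpa using hz.1
    refine mem_iUnion₂.2 ⟨b, hb, hz.1, ?_⟩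
    have hsymm : ∀ x y : Cn n, ‖1 - inner ℂ x y‖ = ‖1 - inner ℂ y x‖ := fun x y => by
      rw [← inner_conj_symm, ← Complex.norm_conj]; simp
    -- The constant `20`: with `t ≤ 2 b.2`, the centres are within `2 (b.2 + t) ≤ 6 b.2`, and then
    -- `z` is within `2 (6 b.2 + 2 t) ≤ 20 b.2` of the selected centre.
    have h1 := norm_one_sub_inner_le hb1.le hζ.le (norm_unitSphere η)
    have h2 := norm_one_sub_inner_le hb1.le hz1 hζ
    have a1 := hsymm (η : Cn n) b.1
    have a2 := hsymm (η : Cn n) ζ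
    have a3 := hsymm ζ b.1
    have h3 := hz.2
    linarith
  have hcl : ∀ b : u, μ (carlesonSet b.1.1 (20 * b.1.2)) ≤
      M * ENNReal.ofReal (20 ^ ((n : ℝ) * β)) *
        (ENNReal.ofReal lam⁻¹ * ∫⁻ ξ in quasiBall b.1.1 b.1.2, g ξ ∂(sphereMeasure n)) ^ β := by
    intro b
    have hbT := huT b.2
    have ht := hT2 _ hbT
    refine (hM _ (hT1 _ hbT) _ (by positivity)).trans ?_
    rw [mul_assoc]
    refine mul_le_mul_right ?_ M
    have e1 : ENNReal.ofReal (b.1.2 ^ ((n : ℝ) * β)) = ENNReal.ofReal (b.1.2 ^ n) ^ β := by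
      rw [Real.rpow_mul ht.le, Real.rpow_natCast,
        ENNReal.ofReal_rpow_of_nonneg (by positivity) (by linarith)]
    have e2 : ENNReal.ofReal (b.1.2 ^ n) =
        ENNReal.ofReal lam⁻¹ * ENNReal.ofReal (lam * b.1.2 ^ n) := by
      rw [← ENNReal.ofReal_mul (by positivity)]
      congr 1; field_simp
    rw [Real.mul_rpow (by norm_num) ht.le, ENNReal.ofReal_mul (by positivity), e1, e2]
    have h3 := (hT3 _ hbT).le
    gcongr
  have : Countable u := hcount
  calc μ (tentSet g lam) ≤ μ (⋃ b ∈ u, carlesonSet b.1 (20 * b.2)) := measure_mono hsub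
    _ ≤ ∑' b : u, μ (carlesonSet b.1.1 (20 * b.1.2)) := measure_biUnion_le _ hcount _
    _ ≤ ∑' b : u, M * ENNReal.ofReal (20 ^ ((n : ℝ) * β)) *
        (ENNReal.ofReal lam⁻¹ * ∫⁻ ξ in quasiBall b.1.1 b.1.2, g ξ ∂(sphereMeasure n)) ^ β :=
        ENNReal.tsum_le_tsum hcl
    _ ≤ M * ENNReal.ofReal (20 ^ ((n : ℝ) * β)) * (ENNReal.ofReal lam⁻¹ *
        ∑' b : u, ∫⁻ ξ in quasiBall b.1.1 b.1.2, g ξ ∂(sphereMeasure n)) ^ β := by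
        rw [ENNReal.tsum_mul_left, ← ENNReal.tsum_mul_left (a := ENNReal.ofReal lam⁻¹)]
        gcongr
        exact tsum_rpow_le_rpow_tsum _ hβ
    _ ≤ _ := by
        gcongr
        rw [← lintegral_iUnion (fun b => (isOpen_quasiBall _ _).measurableSet)]
        · exact setLIntegral_le_lintegral _ _
        · intro b c hbc
          exact hdisj b.2 c.2 (fun h => hbc (Subtype.ext h))

/-- Marcinkiewicz interpolation between the weak type estimate and the trivial bound. -/
theorem exists_strong_type (hn : 1 ≤ n) {μ : Measure (Cn n)} {β : ℝ} (hβ : 1 ≤ β) {M : ℝ≥0}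
    (hM : ∀ ζ : Cn n, ‖ζ‖ = 1 → ∀ h > 0,
      μ (carlesonSet ζ h) ≤ M * ENNReal.ofReal (h ^ ((n : ℝ) * β))) {C₁ : ℝ} (hC₁ : 0 < C₁) :
    ∃ C : ℝ≥0, ∀ g : unitSphere n → ℝ≥0∞, Measurable g → ∫⁻ ξ, g ξ ∂(sphereMeasure n) ≠ ∞ →
      ∀ {Y : Type} [MeasurableSpace Y] (ν : Measure Y) (F : Y → ℝ), (∀ y, 0 ≤ F y) →
      AEMeasurable F ν → (∀ lam > 0, ν {y | C₁ * lam < F y} ≤ μ (tentSet g lam)) →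
      ∫⁻ y, ENNReal.ofReal (F y ^ (2 * β)) ∂ν ≤
        C * (∫⁻ ξ, g ξ * g ξ ∂(sphereMeasure n)) ^ β := by
  obtain ⟨C₀', hC₀'⟩ := exists_sphereMeasure_quasiBall_le hn
  set C₀ : ℝ := C₀' + 1
  have hC₀pos : 0 < C₀ := by positivity
  have hC₀ : ∀ ζ : Cn n, ‖ζ‖ = 1 → ∀ h : ℝ, 0 < h →
      sphereMeasure n (quasiBall ζ h) ≤ ENNReal.ofReal (C₀ * h ^ n) := fun ζ hζ h hh => by
    refine (hC₀' ζ hζ h hh).trans ?_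
    rw [ENNReal.ofReal_mul hC₀pos.le]
    gcongr
    rw [← ENNReal.ofReal_coe_nnreal]
    exact ENNReal.ofReal_le_ofReal (by simp [C₀])
  -- Truncation level: the part of `g` below `c t` contributes at most `t / (2 C₁) * r ^ n` over a
  -- nonisotropic ball of radius `r`, half of the threshold at `lam = t / C₁`.
  set c : ℝ := (2 * C₀ * C₁)⁻¹
  have hc : 0 < c := by positivity
  set K : ℝ≥0 := 2 * β.toNNReal * M * (20 ^ ((n : ℝ) * β) : ℝ).toNNReal *
    ((2 * C₁) ^ β * (c⁻¹) ^ (β - 1) : ℝ).toNNReal * c⁻¹.toNNReal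
  refine ⟨K, fun g hg hgI Y _ ν F hF0 hFm hF => ?_⟩
  set G2 := ∫⁻ ξ, g ξ * g ξ ∂(sphereMeasure n)
  set J : ℝ → ℝ≥0∞ := fun t => ∫⁻ ξ, {ξ | ENNReal.ofReal (c * t) < g ξ}.indicator g ξ
    ∂(sphereMeasure n)
  have hms : ∀ a : ℝ≥0∞, MeasurableSet {ξ | a < g ξ} := fun a => measurableSet_lt measurable_const hg
  have htent : ∀ t > 0, ν {y | t < F y} ≤ M * ENNReal.ofReal (20 ^ ((n : ℝ) * β)) *
      (ENNReal.ofReal (2 * C₁ / t) * J t) ^ β := by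
    intro t ht
    have h1 := hF (t / C₁) (by positivity)
    rw [mul_div_cancel₀ _ hC₁.ne'] at h1
    have hsub : tentSet g (t / C₁) ⊆
        tentSet ({ξ | ENNReal.ofReal (c * t) < g ξ}.indicator g) (t / (2 * C₁)) := by
      rintro z ⟨ζ, hζ, r, hr, hz, hlt⟩
      refine ⟨ζ, hζ, r, hr, hz, ?_⟩
      have h2 : ∫⁻ ξ in quasiBall ζ r, g ξ ∂(sphereMeasure n) ≤
          (∫⁻ ξ in quasiBall ζ r, {ξ | ENNReal.ofReal (c * t) < g ξ}.indicator g ξ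
            ∂(sphereMeasure n)) + ENNReal.ofReal (t / (2 * C₁) * r ^ n) := by
        calc ∫⁻ ξ in quasiBall ζ r, g ξ ∂(sphereMeasure n)
            ≤ ∫⁻ ξ in quasiBall ζ r, ({ξ | ENNReal.ofReal (c * t) < g ξ}.indicator g ξ +
              ENNReal.ofReal (c * t)) ∂(sphereMeasure n) := by
              refine lintegral_mono fun ξ => ?_
              by_cases h : ENNReal.ofReal (c * t) < g ξ
              · rw [indicator_of_mem (by exact h)]
                exact le_self_add
              · rw [indicator_of_notMem (by exact h), zero_add]
                exact not_lt.1 h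
          _ = (∫⁻ ξ in quasiBall ζ r, {ξ | ENNReal.ofReal (c * t) < g ξ}.indicator g ξ
              ∂(sphereMeasure n)) + ENNReal.ofReal (c * t) * sphereMeasure n (quasiBall ζ r) := by
              rw [lintegral_add_right _ measurable_const, setLIntegral_const]
          _ ≤ _ := by
              gcongr
              calc _ ≤ ENNReal.ofReal (c * t) * ENNReal.ofReal (C₀ * r ^ n) := by
                    gcongr; exact hC₀ ζ hζ r hr
                _ = _ := by
                    rw [← ENNReal.ofReal_mul (by positivity)]
                    congr 1
                    simp only [c]; field_simp
      have h3 : ENNReal.ofReal (t / C₁ * r ^ n) = ENNReal.ofReal (t / (2 * C₁) * r ^ n) +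
          ENNReal.ofReal (t / (2 * C₁) * r ^ n) := by
        rw [← ENNReal.ofReal_add (by positivity) (by positivity)]
        congr 1; field_simp; ring
      rw [h3] at hlt
      exact lt_of_add_lt_add_right (hlt.trans_le h2)
    have hJfin : ∫⁻ ξ, {ξ | ENNReal.ofReal (c * t) < g ξ}.indicator g ξ ∂(sphereMeasure n) ≠ ∞ :=
      ne_top_of_le_ne_top hgI (lintegral_mono fun ξ => indicator_le_self _ _ ξ)
    have h4 := measure_tentSet_le hn hβ hM hJfin (lam := t / (2 * C₁)) (by positivity)
    rw [inv_div] at h4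
    exact h1.trans ((measure_mono hsub).trans h4)
  have hJ : ∀ t > 0, J t ≤ ENNReal.ofReal (c⁻¹ / t) * G2 := by
    intro t ht
    rw [← lintegral_const_mul' _ _ ENNReal.ofReal_ne_top]
    refine lintegral_mono fun ξ => ?_
    by_cases hξ' : ENNReal.ofReal (c * t) < g ξ
    swap
    · rw [indicator_of_notMem (by exact hξ')]
      exact zero_le
    rw [indicator_of_mem (by exact hξ')]
    calc g ξ = ENNReal.ofReal (c⁻¹ / t) * (ENNReal.ofReal (c * t) * g ξ) := by
          rw [← mul_assoc, ← ENNReal.ofReal_mul (by positivity)]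
          have : c⁻¹ / t * (c * t) = 1 := by field_simp
          rw [this, ENNReal.ofReal_one, one_mul]
      _ ≤ _ := by gcongr
  -- All but one power of `J t` is spent on the Chebyshev bound `J t ≤ G2 / (c t)`. The surviving
  -- power is linear in `g` and can be integrated in `t` by Tonelli.
  have hJβ : ∀ t > 0, J t ^ β ≤ ENNReal.ofReal ((c⁻¹ / t) ^ (β - 1)) * G2 ^ (β - 1) * J t := by
    intro t ht
    have e : J t ^ β = J t ^ (β - 1) * J t := by
      conv_lhs => rw [show β = (β - 1) + 1 by ring]
      rw [ENNReal.rpow_add_of_nonneg _ _ (by linarith) zero_le_one, ENNReal.rpow_one]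
    rw [e, ← ENNReal.ofReal_rpow_of_nonneg (by positivity) (by linarith),
      ← ENNReal.mul_rpow_of_nonneg _ _ (by linarith)]
    gcongr
    exact hJ t ht
  have hint : ∀ t ∈ Ioi (0 : ℝ), ν {y | t < F y} * ENNReal.ofReal (t ^ (2 * β - 1)) ≤
      M * ENNReal.ofReal (20 ^ ((n : ℝ) * β)) *
        ENNReal.ofReal ((2 * C₁) ^ β * (c⁻¹) ^ (β - 1)) * G2 ^ (β - 1) * J t := by
    intro t ht
    have ht0 : 0 < t := ht
    have h1 := htent t ht0
    rw [ENNReal.mul_rpow_of_nonneg _ _ (by linarith),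
      ENNReal.ofReal_rpow_of_nonneg (by positivity) (by linarith)] at h1
    -- The powers of `t` cancel exactly, which fixes the target exponent `2 * β`.
    have e : (2 * C₁ / t) ^ β * (c⁻¹ / t) ^ (β - 1) * t ^ (2 * β - 1) =
        (2 * C₁) ^ β * (c⁻¹) ^ (β - 1) := by
      rw [Real.div_rpow (by positivity) ht0.le, Real.div_rpow (by positivity) ht0.le,
        show 2 * β - 1 = β + (β - 1) by ring, Real.rpow_add ht0]
      have p1 : 0 < t ^ β := by positivity
      have p2 : 0 < t ^ (β - 1) := by positivity
      field_simp
    set m20 := ENNReal.ofReal (20 ^ ((n : ℝ) * β))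
    calc _ ≤ M * m20 * (ENNReal.ofReal ((2 * C₁ / t) ^ β) *
          (ENNReal.ofReal ((c⁻¹ / t) ^ (β - 1)) * G2 ^ (β - 1) * J t)) *
            ENNReal.ofReal (t ^ (2 * β - 1)) := by
          gcongr
          exact h1.trans (by gcongr; exact hJβ t ht0)
      _ = M * m20 * (ENNReal.ofReal ((2 * C₁ / t) ^ β) * ENNReal.ofReal ((c⁻¹ / t) ^ (β - 1)) *
            ENNReal.ofReal (t ^ (2 * β - 1))) * G2 ^ (β - 1) * J t := by ring
      _ = _ := by
          rw [← ENNReal.ofReal_mul (by positivity), ← ENNReal.ofReal_mul (by positivity), e]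
  have hJmeasure : Measurable (Function.uncurry fun (t : ℝ) (ξ : unitSphere n) =>
      {ξ | ENNReal.ofReal (c * t) < g ξ}.indicator g ξ) := by
    have hs : MeasurableSet {p : ℝ × unitSphere n | ENNReal.ofReal (c * p.1) < g p.2} :=
      measurableSet_lt (by fun_prop) (hg.comp measurable_snd)
    have : (Function.uncurry fun (t : ℝ) (ξ : unitSphere n) =>
        {ξ | ENNReal.ofReal (c * t) < g ξ}.indicator g ξ) =
        {p : ℝ × unitSphere n | ENNReal.ofReal (c * p.1) < g p.2}.indicator fun p => g p.2 := by
      ext ⟨t, ξ⟩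
      by_cases h : ENNReal.ofReal (c * t) < g ξ <;> simp [h]
    rw [this]
    exact (hg.comp measurable_snd).indicator hs
  -- For fixed `ξ` the set of `t > 0` with `c t < g ξ` has length `g ξ / c`, so a second factor `g
  -- ξ` appears.
  have hJint : ∫⁻ t in Ioi (0 : ℝ), J t ≤ ENNReal.ofReal c⁻¹ * G2 := by
    rw [lintegral_lintegral_swap hJmeasure.aemeasurable,
      ← lintegral_const_mul' _ _ ENNReal.ofReal_ne_top]
    refine lintegral_mono fun ξ => ?_
    have h1 : ∀ t : ℝ, {ξ | ENNReal.ofReal (c * t) < g ξ}.indicator g ξ =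
        {t : ℝ | ENNReal.ofReal (c * t) < g ξ}.indicator (fun _ => g ξ) t := fun t => by
      by_cases h : ENNReal.ofReal (c * t) < g ξ <;> simp [h]
    have hs : MeasurableSet {t : ℝ | ENNReal.ofReal (c * t) < g ξ} :=
      measurableSet_lt (by fun_prop) measurable_const
    simp_rw [h1]
    rw [lintegral_indicator_const hs, Measure.restrict_apply hs, mul_comm, ← mul_assoc]
    gcongr
    rcases eq_or_ne (g ξ) ∞ with h | h
    · rw [h, ENNReal.mul_top (by simpa using hc)]
      exact le_top
    · have hsub : {t : ℝ | ENNReal.ofReal (c * t) < g ξ} ∩ Ioi 0 ⊆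
          Ioo 0 (c⁻¹ * (g ξ).toReal) := by
        rintro t ⟨h1, h2⟩
        refine ⟨h2, ?_⟩
        have h3 := (ENNReal.ofReal_lt_iff_lt_toReal (by
          have : (0 : ℝ) < t := h2
          positivity) h).1 h1
        rwa [inv_mul_eq_div, lt_div_iff₀ hc, mul_comm]
      refine (measure_mono hsub).trans ?_
      rw [Real.volume_Ioo, sub_zero, ENNReal.ofReal_mul (by positivity), ENNReal.ofReal_toReal h]
  have hG2 : G2 ^ β = G2 ^ (β - 1) * G2 := by
    conv_lhs => rw [show β = (β - 1) + 1 by ring]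
    rw [ENNReal.rpow_add_of_nonneg _ _ (by linarith) zero_le_one, ENNReal.rpow_one]
  have hKeq : (K : ℝ≥0∞) = ENNReal.ofReal (2 * β) * (M * ENNReal.ofReal (20 ^ ((n : ℝ) * β)) *
      ENNReal.ofReal ((2 * C₁) ^ β * (c⁻¹) ^ (β - 1)) * ENNReal.ofReal c⁻¹) := by
    rw [ENNReal.ofReal_mul (by norm_num : (0 : ℝ) ≤ 2)]
    simp only [K, ENNReal.coe_mul, ENNReal.ofReal]
    have : ((2 : ℝ).toNNReal : ℝ≥0∞) = 2 := by simp
    rw [this]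
    push_cast
    ring
  rw [lintegral_rpow_eq_lintegral_meas_lt_mul ν (Eventually.of_forall hF0) hFm (by linarith)]
  calc _ ≤ ENNReal.ofReal (2 * β) * ∫⁻ t in Ioi (0 : ℝ),
        M * ENNReal.ofReal (20 ^ ((n : ℝ) * β)) *
          ENNReal.ofReal ((2 * C₁) ^ β * (c⁻¹) ^ (β - 1)) * G2 ^ (β - 1) * J t := by
        gcongr ENNReal.ofReal (2 * β) * ?_
        exact setLIntegral_mono' measurableSet_Ioi hint
    _ ≤ _ := by
        have hJm : Measurable J := hJmeasure.lintegral_prod_right'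
        rw [lintegral_const_mul _ hJm, hG2, hKeq]
        set m20 := ENNReal.ofReal (20 ^ ((n : ℝ) * β))
        set m3 := ENNReal.ofReal ((2 * C₁) ^ β * (c⁻¹) ^ (β - 1))
        calc _ ≤ ENNReal.ofReal (2 * β) * (M * m20 * m3 * G2 ^ (β - 1) *
              (ENNReal.ofReal c⁻¹ * G2)) := by gcongr
          _ = _ := by ring

end WeakType

/-! ### Carleson embedding and the radial maximal theorem. -/

section MaximalFunction

variable {n : ℕ}

theorem coe_preimage_carlesonSet (ζ : Cn n) (t : ℝ) :
    (Subtype.val : unitSphere n → Cn n) ⁻¹' carlesonSet ζ t = quasiBall ζ t := by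
  ext ξ
  simp [carlesonSet, mem_quasiBall_iff]

theorem coe_preimage_closedUnitBall :
    (Subtype.val : unitSphere n → Cn n) ⁻¹' closedUnitBall n = univ := by
  ext ξ; simp

theorem ofReal_norm_rpow (x : ℂ) {s : ℝ} (hs : 0 ≤ s) : ENNReal.ofReal (‖x‖ ^ s) = ‖x‖ₑ ^ s := by
  rw [← ENNReal.ofReal_rpow_of_nonneg (norm_nonneg _) hs, ofReal_norm]

theorem enorm_rpow_ne_top (x : ℂ) {s : ℝ} (hs : 0 ≤ s) : ‖x‖ₑ ^ s ≠ ∞ :=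
  ENNReal.rpow_ne_top_of_nonneg hs enorm_ne_top

theorem continuous_sphere_of_differentiableOn {f : Cn n → ℂ} {R : ℝ} (hR : 1 < R)
    (hf : DifferentiableOn ℂ f (Metric.ball 0 R)) :
    Continuous fun ξ : unitSphere n => f ξ :=
  hf.continuousOn.comp_continuous continuous_subtype_val fun ξ => by simpa using hR

/-- Points of the closed ball where `‖f‖ ^ s` is large lie in the tent set of its boundary
values. -/
theorem exists_mem_tentSet (hn : 1 ≤ n) : ∃ C₁ : ℝ, 0 < C₁ ∧ ∀ (f : Cn n → ℂ) (R : ℝ), 1 < R →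
    DifferentiableOn ℂ f (Metric.ball 0 R) → ∀ s : ℝ, 0 < s → ∀ lam : ℝ, 0 < lam →
    ∀ ζ : Cn n, ‖ζ‖ = 1 → ∀ δ ∈ Icc (0 : ℝ) 1, C₁ * lam < ‖f ((1 - δ) • ζ)‖ ^ s →
      (1 - δ) • ζ ∈ tentSet (fun ξ => ‖f ξ‖ₑ ^ s) lam ∧
      ζ ∈ tentSet (fun ξ => ‖f ξ‖ₑ ^ s) lam := by
  obtain ⟨A, hA⟩ := exists_poisson_szego_bound hn
  obtain ⟨B, hB⟩ := exists_lintegral_kernel_le (n := n) (κ := (n : ℝ)) (by positivity)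
  refine ⟨A * B + 1, by positivity, fun f R hR hf s hs lam hlam ζ hζ δ hδ hlt => ?_⟩
  have hfc := continuous_sphere_of_differentiableOn hR hf
  have hgm : Measurable fun ξ : unitSphere n => ‖f ξ‖ₑ ^ s :=
    hfc.enorm.measurable.pow_const s
  have hζζ : (inner ℂ ζ ζ : ℂ) = 1 := by rw [inner_self_eq_norm_sq_to_K, hζ]; simp
  have key : ∀ δ ∈ Ioc (0 : ℝ) 1, (A * B + 1) * lam < ‖f ((1 - δ) • ζ)‖ ^ s →
      ∃ t ≥ δ, ENNReal.ofReal (lam * t ^ n) <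
        ∫⁻ ξ in quasiBall ζ t, ‖f ξ‖ₑ ^ s ∂(sphereMeasure n) := by
    intro δ hδ hlt
    -- If every mean at scales `t ≥ δ` were small, the measure `|f|^s dσ` would satisfy the growth
    -- hypothesis of the kernel estimate, and the Poisson–Szegő bound would make `|f z|^s` at most
    -- `A * B * lam`.
    by_contra! hcon
    set ν : Measure (Cn n) :=
      ((sphereMeasure n).withDensity fun ξ => ‖f ξ‖ₑ ^ s).map Subtype.val
    have hν : ∀ t ≥ δ, ν (carlesonSet ζ t) ≤ ENNReal.ofReal lam * ENNReal.ofReal (t ^ (n : ℝ)) := by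
      intro t ht
      rw [Measure.map_apply measurable_subtype_coe (measurableSet_carlesonSet _ _),
        coe_preimage_carlesonSet,
        withDensity_apply _ (isOpen_quasiBall _ _).measurableSet, Real.rpow_natCast,
        ← ENNReal.ofReal_mul hlam.le]
      exact hcon t ht
    have h1 := hA f R hR hf s hs ζ hζ δ hδ _ rfl
    have h2 := hB ν ζ hζ δ hδ _ hν _ rfl
    set z := (1 - δ) • ζ
    have hKm : Measurable fun w : Cn n => ENNReal.ofReal ((1 - ‖z‖ ^ 2) ^ (n : ℝ) /
        ‖1 - inner ℂ z w‖ ^ (2 * (n : ℝ))) := by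
      refine ENNReal.measurable_ofReal.comp (measurable_const.div (Measurable.pow_const ?_ _))
      exact (by fun_prop : Continuous fun w : Cn n => ‖1 - inner ℂ z w‖).measurable
    rw [setLIntegral_map Metric.isClosed_closedBall.measurableSet hKm measurable_subtype_coe] at h2
    rw [coe_preimage_closedUnitBall, setLIntegral_univ, lintegral_withDensity_eq_lintegral_mul _ hgm
      (g := fun ξ : unitSphere n => ENNReal.ofReal ((1 - ‖z‖ ^ 2) ^ (n : ℝ) /
        ‖1 - inner ℂ z (ξ : Cn n)‖ ^ (2 * (n : ℝ)))) (hKm.comp measurable_subtype_coe)] at h2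
    have h3 : ‖f z‖ₑ ^ s ≤ A * (B * ENNReal.ofReal lam) :=
      h1.trans (mul_le_mul_right h2 _)
    rw [← ofReal_norm_rpow _ hs.le, ← ENNReal.ofReal_coe_nnreal, ← ENNReal.ofReal_coe_nnreal,
      ← ENNReal.ofReal_mul (by positivity), ← ENNReal.ofReal_mul (by positivity),
      ENNReal.ofReal_le_ofReal_iff (by positivity)] at h3
    nlinarith
  have hζmem : ∀ t > 0, ζ ∈ carlesonSet ζ (2 * t) := fun t ht => by
    refine ⟨by simp [hζ], ?_⟩
    rw [hζζ]; simpa using ht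
  rcases hδ.1.eq_or_lt with h0 | h0
  -- A boundary point is handled by moving slightly inward along its radius, where `|f|^s` is still
  -- above the threshold.
  · have hcont : ContinuousAt (fun δ : ℝ => ‖f ((1 - δ) • ζ)‖ ^ s) 0 := by
      refine ContinuousAt.rpow_const (ContinuousAt.norm ?_) (Or.inr hs.le)
      refine ContinuousAt.comp (g := f) ?_ (by fun_prop)
      refine hf.continuousOn.continuousAt (Metric.isOpen_ball.mem_nhds ?_)
      simpa [hζ] using hR
    rw [← h0] at hlt ⊢
    have hev := hcont.tendsto.eventually (lt_mem_nhds hlt)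
    obtain ⟨δ', h1, h2, h3⟩ := ((hev.filter_mono nhdsWithin_le_nhds).and
      (Ioc_mem_nhdsGT (zero_lt_one (α := ℝ)))).exists
    obtain ⟨t, ht, hlt'⟩ := key δ' ⟨h2, h3⟩ h1
    have ht0 : 0 < t := h2.trans_le ht
    have : ζ ∈ tentSet (fun ξ => ‖f ξ‖ₑ ^ s) lam := ⟨ζ, hζ, t, ht0, hζmem t ht0, hlt'⟩
    rw [sub_zero, one_smul]
    exact ⟨this, this⟩
  · obtain ⟨t, ht, hlt'⟩ := key δ ⟨h0, hδ.2⟩ hlt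
    have ht0 : 0 < t := h0.trans_le ht
    refine ⟨⟨ζ, hζ, t, ht0, ⟨?_, ?_⟩, hlt'⟩, ⟨ζ, hζ, t, ht0, hζmem t ht0, hlt'⟩⟩
    · rw [mem_closedBall_zero_iff, norm_smul, hζ, mul_one, Real.norm_of_nonneg (by linarith [hδ.2])]
      linarith
    · rw [← Complex.coe_smul, inner_smul_right, hζζ, mul_one]
      have : (1 : ℂ) - ((1 - δ : ℝ) : ℂ) = (δ : ℂ) := by push_cast; ring
      rw [this, Complex.norm_real, Real.norm_of_nonneg h0.le]
      linarith

theorem exists_norm_eq_one (hn : 1 ≤ n) : ∃ ζ : Cn n, ‖ζ‖ = 1 :=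
  ⟨EuclideanSpace.single ⟨0, hn⟩ 1, by simp⟩

theorem exists_eq_smul_sphere (hn : 1 ≤ n) {z : Cn n} (hz : ‖z‖ ≤ 1) :
    ∃ ζ : Cn n, ‖ζ‖ = 1 ∧ z = (1 - (1 - ‖z‖)) • ζ := by
  rcases eq_or_ne z 0 with rfl | h
  · obtain ⟨ζ, hζ⟩ := exists_norm_eq_one hn
    exact ⟨ζ, hζ, by simp⟩
  · refine ⟨‖z‖⁻¹ • z, ?_, ?_⟩
    · rw [norm_smul, norm_inv, norm_norm, inv_mul_cancel₀ (norm_ne_zero_iff.2 h)]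
    · rw [sub_sub_cancel, smul_smul, mul_inv_cancel₀ (norm_ne_zero_iff.2 h), one_smul]

theorem lintegral_sphere_enorm_rpow_ne_top {f : Cn n → ℂ} {R : ℝ} (hR : 1 < R)
    (hf : DifferentiableOn ℂ f (Metric.ball 0 R)) {s : ℝ} (hs : 0 < s) :
    ∫⁻ ξ : unitSphere n, ‖f ξ‖ₑ ^ s ∂(sphereMeasure n) ≠ ∞ := by
  have hfc := continuous_sphere_of_differentiableOn hR hf
  have hgc : Continuous fun ξ : unitSphere n => ‖f ξ‖ ^ s :=
    hfc.norm.rpow_const fun _ => Or.inr hs.le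
  obtain ⟨K, hK⟩ := (isCompact_range hgc).bddAbove
  refine ne_top_of_le_ne_top ?_ (lintegral_mono (g := fun _ => ENNReal.ofReal K) fun ξ => ?_)
  · rw [lintegral_const]
    exact ENNReal.mul_ne_top ENNReal.ofReal_ne_top (measure_ne_top _ _)
  · rw [← ofReal_norm_rpow _ hs.le]
    exact ENNReal.ofReal_le_ofReal (hK (mem_range_self ξ))

/-- Finiteness of the measure covers the scales `h ≥ 2`, which the enlarged sets of the covering
argument can reach. -/
theorem IsCarlesonMeasure.exists_le {μ : Measure (Cn n)} {β : ℝ} (hβ : 0 ≤ β)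
    (hμ : IsCarlesonMeasure β μ) : ∃ M : ℝ≥0, ∀ ζ : Cn n, ‖ζ‖ = 1 → ∀ h > 0,
      μ (carlesonSet ζ h) ≤ M * ENNReal.ofReal (h ^ ((n : ℝ) * β)) := by
  obtain ⟨hfin, M, hM⟩ := hμ
  refine ⟨M + (μ univ).toNNReal, fun ζ hζ h hh => ?_⟩
  rcases lt_or_ge h 2 with h2 | h2
  · refine (hM ζ (by simpa using hζ) h ⟨hh, h2⟩).trans ?_
    gcongr
    exact le_self_add
  · have h1 : 1 ≤ ENNReal.ofReal (h ^ ((n : ℝ) * β)) := by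
      rw [ENNReal.one_le_ofReal]
      exact Real.one_le_rpow (by linarith) (by positivity)
    calc μ (carlesonSet ζ h) ≤ μ univ := measure_mono (subset_univ _)
      _ = (μ univ).toNNReal * 1 := by rw [mul_one, ENNReal.coe_toNNReal (measure_ne_top _ _)]
      _ ≤ _ := by
        gcongr
        simp

theorem enorm_rpow_half_mul_self (x : ℂ) {p : ℝ} (hp : 0 ≤ p) :
    ‖x‖ₑ ^ (p / 2) * ‖x‖ₑ ^ (p / 2) = ‖x‖ₑ ^ p := by
  rw [← ENNReal.rpow_add_of_nonneg _ _ (by positivity) (by positivity), add_halves]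

/-- Carleson embedding for functions holomorphic across the sphere. -/
theorem exists_carleson_embedding (hn : 1 ≤ n) {p q : ℝ} (hp : 0 < p) (hpq : p ≤ q)
    {μ : Measure (Cn n)} (hμ : IsCarlesonMeasure (q / p) μ) :
    ∃ C : ℝ≥0, ∀ (f : Cn n → ℂ) (R : ℝ), 1 < R → DifferentiableOn ℂ f (Metric.ball 0 R) →
      ∫⁻ w in closedUnitBall n, ‖f w‖ₑ ^ q ∂μ ≤
        C * (∫⁻ ξ : unitSphere n, ‖f ξ‖ₑ ^ p ∂(sphereMeasure n)) ^ (q / p) := by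
  have hβ : 1 ≤ q / p := (one_le_div hp).2 hpq
  obtain ⟨C₁, hC₁, htent⟩ := exists_mem_tentSet hn
  obtain ⟨M, hM⟩ := hμ.exists_le (by linarith)
  obtain ⟨C, hC⟩ := exists_strong_type hn hβ hM hC₁
  refine ⟨C, fun f R hR hf => ?_⟩
  have hfc := continuous_sphere_of_differentiableOn hR hf
  have hcl : closedUnitBall n ⊆ Metric.ball 0 R := Metric.closedBall_subset_ball hR
  -- The exponent `p / 2` is available because `|f|^s` has a Poisson–Szegő majorant for every `s >
  -- 0`. It turns the `L²` estimate into an `L^p` one for all `p > 0`, including `p ≤ 1`.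
  have h := hC (fun ξ => ‖f ξ‖ₑ ^ (p / 2)) (hfc.enorm.measurable.pow_const _)
    (lintegral_sphere_enorm_rpow_ne_top hR hf (by positivity)) (μ.restrict (closedUnitBall n))
    (fun w => ‖f w‖ ^ (p / 2)) (fun _ => by positivity) ?_ ?_
  · simp_rw [enorm_rpow_half_mul_self _ hp.le] at h
    refine le_trans (le_of_eq (lintegral_congr fun w => ?_)) h
    rw [← Real.rpow_mul (norm_nonneg _), ofReal_norm_rpow _ (by positivity)]
    congr 1; field_simp
  · exact ((hf.continuousOn.mono hcl).norm.rpow_const fun _ _ => Or.inr (by positivity)).aemeasurable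
      Metric.isClosed_closedBall.measurableSet
  · intro lam hlam
    rw [Measure.restrict_apply' Metric.isClosed_closedBall.measurableSet]
    refine measure_mono fun w hw => ?_
    have hw1 : ‖w‖ ≤ 1 := by simpa using hw.2
    obtain ⟨ζ, hζ, e⟩ := exists_eq_smul_sphere hn hw1
    have hw2 : C₁ * lam < ‖f w‖ ^ (p / 2) := hw.1
    rw [e] at hw2 ⊢
    exact (htent f R hR hf _ (by positivity) lam hlam ζ hζ _
      ⟨by linarith, by linarith [norm_nonneg w]⟩ hw2).1

/-- The radial maximal function of `‖f‖ ^ p`. -/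
def radialMax (p : ℝ) (f : Cn n → ℂ) (ξ : unitSphere n) : ℝ≥0∞ :=
  ⨆ r ∈ Ioo (0 : ℝ) 1, ‖f (r • (ξ : Cn n))‖ₑ ^ p

theorem le_radialMax (p : ℝ) (f : Cn n → ℂ) (ξ : unitSphere n) {r : ℝ} (hr : r ∈ Ioo (0 : ℝ) 1) :
    ‖f (r • (ξ : Cn n))‖ₑ ^ p ≤ radialMax p f ξ :=
  le_iSup₂ (f := fun r (_ : r ∈ Ioo (0 : ℝ) 1) => ‖f (r • (ξ : Cn n))‖ₑ ^ p) r hr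

/-- A supremum of continuous functions is lower semicontinuous, so the uncountable family of radii
does no harm. -/
theorem measurable_radialMax {p : ℝ} {f : Cn n → ℂ} (hf : ContinuousOn f (unitBall n)) :
    Measurable (radialMax p f) := by
  refine LowerSemicontinuous.measurable (lowerSemicontinuous_biSup fun r hr => ?_)
  exact (ENNReal.continuous_rpow_const.comp
    (continuous_dilate_sphere hf hr.1.le hr.2).enorm).lowerSemicontinuous

/-- The surface measure, carried to `ℂⁿ`, has Carleson growth with `β = 1`. The endpoint `ζ` of a
radius lies in the same tent set as any point of the radius where `|f|^{p/2}` is large, so the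
strong type estimate controls the maximal function as well. -/
theorem exists_lintegral_radialMax_le_boundary (hn : 1 ≤ n) {p : ℝ} (hp : 0 < p) :
    ∃ C : ℝ≥0, ∀ (f : Cn n → ℂ) (R : ℝ), 1 < R → DifferentiableOn ℂ f (Metric.ball 0 R) →
      ∫⁻ ξ, radialMax p f ξ ∂(sphereMeasure n) ≤
        C * ∫⁻ ξ : unitSphere n, ‖f ξ‖ₑ ^ p ∂(sphereMeasure n) := by
  obtain ⟨C₁, hC₁, htent⟩ := exists_mem_tentSet hn
  obtain ⟨M, hM⟩ := exists_sphereMeasure_quasiBall_le hn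
  set μ : Measure (Cn n) := (sphereMeasure n).map Subtype.val
  have hμ : ∀ ζ : Cn n, ‖ζ‖ = 1 → ∀ h > 0,
      μ (carlesonSet ζ h) ≤ M * ENNReal.ofReal (h ^ ((n : ℝ) * 1)) := by
    intro ζ hζ h hh
    rw [Measure.map_apply measurable_subtype_coe (measurableSet_carlesonSet _ _),
      coe_preimage_carlesonSet, mul_one,
      Real.rpow_natCast]
    exact hM ζ hζ h hh
  obtain ⟨C, hC⟩ := exists_strong_type hn le_rfl hμ hC₁
  refine ⟨C, fun f R hR hf => ?_⟩
  have hfc := continuous_sphere_of_differentiableOn hR hf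
  have hcl : closedUnitBall n ⊆ Metric.ball 0 R := Metric.closedBall_subset_ball hR
  have hfb : ContinuousOn f (unitBall n) :=
    hf.continuousOn.mono (Metric.ball_subset_closedBall.trans hcl)
  have hfin : ∀ ξ, radialMax p f ξ ≠ ∞ := by
    obtain ⟨K, hK⟩ := (ProperSpace.isCompact_closedBall (0 : Cn n) 1).exists_bound_of_continuousOn
      (hf.continuousOn.mono hcl)
    intro ξ
    refine ne_top_of_le_ne_top (b := ENNReal.ofReal (K ^ p)) ENNReal.ofReal_ne_top
      (iSup₂_le fun r hr => ?_)
    rw [← ofReal_norm_rpow _ hp.le]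
    refine ENNReal.ofReal_le_ofReal (Real.rpow_le_rpow (norm_nonneg _) (hK _ ?_) hp.le)
    exact Metric.ball_subset_closedBall (real_smul_mem_unitBall hr.1.le hr.2 ξ)
  have h := hC (fun ξ => ‖f ξ‖ₑ ^ (p / 2)) (hfc.enorm.measurable.pow_const _)
    (lintegral_sphere_enorm_rpow_ne_top hR hf (by positivity)) (sphereMeasure n)
    (fun ξ => √(radialMax p f ξ).toReal) (fun _ => by positivity)
    (measurable_radialMax hfb).ennreal_toReal.sqrt.aemeasurable ?_
  · simp_rw [enorm_rpow_half_mul_self _ hp.le] at h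
    rw [ENNReal.rpow_one] at h
    refine le_trans (le_of_eq (lintegral_congr fun ξ => ?_)) h
    rw [mul_one, Real.rpow_two, Real.sq_sqrt ENNReal.toReal_nonneg, ENNReal.ofReal_toReal (hfin ξ)]
  · intro lam hlam
    refine le_trans (measure_mono ?_) (Measure.le_map_apply measurable_subtype_coe.aemeasurable _)
    intro ξ hξ
    have hξ1 : C₁ * lam < √(radialMax p f ξ).toReal := hξ
    rw [Real.lt_sqrt (by positivity), ← ENNReal.ofReal_lt_iff_lt_toReal (by positivity) (hfin ξ),
      radialMax, lt_iSup_iff] at hξ1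
    obtain ⟨r, hr⟩ := hξ1
    obtain ⟨hr, hlt⟩ := lt_iSup_iff.1 hr
    rw [← ofReal_norm_rpow _ hp.le, ENNReal.ofReal_lt_ofReal_iff_of_nonneg (by positivity)] at hlt
    have h2 : C₁ * lam < ‖f (r • (ξ : Cn n))‖ ^ (p / 2) := by
      refine lt_of_pow_lt_pow_left₀ 2 (by positivity) (hlt.trans_eq ?_)
      rw [← Real.rpow_natCast, ← Real.rpow_mul (norm_nonneg _)]
      congr 1; push_cast; ring
    rw [← sub_sub_cancel 1 r] at h2
    exact (htent f R hR hf _ (by positivity) lam hlam ξ (norm_unitSphere ξ) _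
      ⟨by linarith [hr.2], by linarith [hr.1]⟩ h2).2

/-- A sequence of radii increasing to `1`. -/
def radius (k : ℕ) : ℝ := 1 - 1 / (k + 2)

theorem radius_mem (k : ℕ) : radius k ∈ Ioo (0 : ℝ) 1 := by
  have h1 : (0 : ℝ) < 1 / (k + 2) := by positivity
  have h2 : (1 : ℝ) / (k + 2) < 1 := by
    rw [div_lt_one (by positivity)]
    have : (0 : ℝ) ≤ k := by positivity
    linarith
  exact ⟨by simp only [radius]; linarith, by simp only [radius]; linarith⟩

theorem monotone_radius : Monotone radius := fun j k hjk => by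
  have : (j : ℝ) ≤ k := by exact_mod_cast hjk
  simp only [radius]
  gcongr

theorem tendsto_radius : Tendsto radius atTop (𝓝[<] 1) := by
  refine tendsto_nhdsWithin_iff.2 ⟨?_, Eventually.of_forall fun k => (radius_mem k).2⟩
  have h : Tendsto (fun k : ℕ => (1 : ℝ) / ((k : ℝ) + 2)) atTop (𝓝 0) := by
    refine tendsto_const_nhds.div_atTop ?_
    exact tendsto_atTop_add_const_right _ _ tendsto_natCast_atTop_atTop
  have h1 := h.const_sub 1
  rwa [sub_zero] at h1

theorem differentiableOn_dilate {f : Cn n → ℂ} (hf : DifferentiableOn ℂ f (unitBall n)) {ρ : ℝ}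
    (hρ : ρ ∈ Ioo (0 : ℝ) 1) :
    1 < ρ⁻¹ ∧ DifferentiableOn ℂ (fun z => f (ρ • z)) (Metric.ball 0 ρ⁻¹) := by
  refine ⟨(one_lt_inv₀ hρ.1).2 hρ.2, hf.comp ?_ fun z hz => ?_⟩
  · have : (fun z : Cn n => ρ • z) = fun z => (ρ : ℂ) • z := by
      ext1 z; rw [Complex.coe_smul]
    change DifferentiableOn ℂ (fun z : Cn n => ρ • z) _
    rw [this]; fun_prop
  · rw [mem_ball_zero_iff] at hz ⊢
    rw [norm_smul, Real.norm_of_nonneg hρ.1.le]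
    calc ρ * ‖z‖ < ρ * ρ⁻¹ := by gcongr; exact hρ.1
      _ = 1 := mul_inv_cancel₀ hρ.1.ne'

/-- The radial maximal theorem. -/
theorem exists_lintegral_radialMax_le (hn : 1 ≤ n) {p : ℝ} (hp : 0 < p) :
    ∃ C : ℝ≥0, ∀ f : Cn n → ℂ, DifferentiableOn ℂ f (unitBall n) →
      ∫⁻ ξ, radialMax p f ξ ∂(sphereMeasure n) ≤
        C * ⨆ r ∈ Ioo (0 : ℝ) 1,
          ∫⁻ ξ : unitSphere n, ‖f (r • (ξ : Cn n))‖ₑ ^ p ∂(sphereMeasure n) := by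
  obtain ⟨C, hC⟩ := exists_lintegral_radialMax_le_boundary hn hp
  refine ⟨C, fun f hf => ?_⟩
  have hball : ∀ k, unitBall n ⊆ Metric.ball 0 (radius k)⁻¹ := fun k =>
    Metric.ball_subset_ball (differentiableOn_dilate hf (radius_mem k)).1.le
  have hsup : ∀ ξ, radialMax p f ξ ≤ ⨆ k, radialMax p (fun z => f (radius k • z)) ξ := by
    intro ξ
    refine iSup₂_le fun r hr => ?_
    have hev : ∀ᶠ k in atTop, r < radius k :=
      (tendsto_radius.mono_right nhdsWithin_le_nhds).eventually (lt_mem_nhds hr.2)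
    obtain ⟨k, hk⟩ := hev.exists
    have h0 := (radius_mem k).1
    have := le_radialMax p (fun z => f (radius k • z)) ξ (r := r / radius k)
      ⟨div_pos hr.1 h0, (div_lt_one h0).2 hk⟩
    simp only [smul_smul, mul_div_cancel₀ _ h0.ne'] at this
    exact this.trans (le_iSup (fun k => radialMax p (fun z => f (radius k • z)) ξ) k)
  calc _ ≤ ∫⁻ ξ, ⨆ k, radialMax p (fun z => f (radius k • z)) ξ ∂(sphereMeasure n) :=
        lintegral_mono hsup
    _ = ⨆ k, ∫⁻ ξ, radialMax p (fun z => f (radius k • z)) ξ ∂(sphereMeasure n) := by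
        -- Monotone convergence applies because the maximal function of a dilate is the supremum
        -- over a shorter radius, which grows with `k`.
        refine lintegral_iSup (fun k => measurable_radialMax
          ((differentiableOn_dilate hf (radius_mem k)).2.continuousOn.mono (hball k))) ?_
        intro j k hjk ξ
        refine iSup₂_le fun r hr => ?_
        have hj := radius_mem j
        have hk := radius_mem k
        have hjk' := monotone_radius hjk
        have := le_radialMax p (fun z => f (radius k • z)) ξ (r := radius j * r / radius k)
          ⟨div_pos (mul_pos hj.1 hr.1) hk.1, by
            rw [div_lt_one hk.1]
            nlinarith [hr.1, hr.2, hj.1]⟩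
        simp only [smul_smul, mul_div_cancel₀ _ hk.1.ne'] at this
        simpa only [smul_smul] using this
    _ ≤ _ := by
        refine iSup_le fun k => ?_
        obtain ⟨h1, h2⟩ := differentiableOn_dilate hf (radius_mem k)
        refine (hC _ _ h1 h2).trans (mul_le_mul_right ?_ _)
        exact le_iSup₂ (f := fun r (_ : r ∈ Ioo (0 : ℝ) 1) =>
          ∫⁻ ξ : unitSphere n, ‖f (r • (ξ : Cn n))‖ₑ ^ p ∂(sphereMeasure n)) _ (radius_mem k)

end MaximalFunction

/-! ### Radial limits on the sphere. -/

section RadialLimits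

variable {n : ℕ}

/-- Existence of the limit is a Cauchy condition. Tolerances and starting radii can be taken
countable, and the remaining uncountable intersections are of closed sets. -/
theorem measurableSet_exists_radial_limit {f : Cn n → ℂ} (hf : ContinuousOn f (unitBall n)) :
    MeasurableSet {ξ : unitSphere n |
      ∃ L, Tendsto (fun r : ℝ => f (r • (ξ : Cn n))) (𝓝[<] 1) (𝓝 L)} := by
  have e : {ξ : unitSphere n | ∃ L, Tendsto (fun r : ℝ => f (r • (ξ : Cn n))) (𝓝[<] 1) (𝓝 L)} =
      ⋂ k : ℕ, ⋃ m : ℕ, ⋂ r ∈ Ioo (radius m) 1, ⋂ s ∈ Ioo (radius m) 1,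
        {ξ : unitSphere n | dist (f (r • (ξ : Cn n))) (f (s • (ξ : Cn n))) ≤ 1 / ((k : ℝ) + 1)} := by
    ext ξ
    simp only [mem_ofPred_eq, mem_iInter, mem_iUnion]
    constructor
    · rintro ⟨L, hL⟩ k
      have h1 := hL.eventually (Metric.ball_mem_nhds L
        (by positivity : (0 : ℝ) < 1 / ((k : ℝ) + 1) / 2))
      obtain ⟨a, ha, h2⟩ := (mem_nhdsLT_iff_exists_Ioo_subset).1 h1
      obtain ⟨m, hm⟩ := ((tendsto_radius.mono_right nhdsWithin_le_nhds).eventually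
        (lt_mem_nhds ha)).exists
      refine ⟨m, fun r hr s hs => ?_⟩
      have h3 : dist (f (r • (ξ : Cn n))) L < 1 / ((k : ℝ) + 1) / 2 :=
        h2 ⟨hm.trans hr.1, hr.2⟩
      have h4 : dist (f (s • (ξ : Cn n))) L < 1 / ((k : ℝ) + 1) / 2 :=
        h2 ⟨hm.trans hs.1, hs.2⟩
      have := dist_triangle_right (f (r • (ξ : Cn n))) (f (s • (ξ : Cn n))) L
      linarith
    · intro h
      refine cauchy_map_iff_exists_tendsto.1 (Metric.cauchy_iff.2 ⟨inferInstance, fun ε hε => ?_⟩)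
      obtain ⟨k, hk⟩ := exists_nat_one_div_lt hε
      obtain ⟨m, hm⟩ := h k
      refine ⟨(fun r : ℝ => f (r • (ξ : Cn n))) '' Ioo (radius m) 1,
        image_mem_map (Ioo_mem_nhdsLT (radius_mem m).2), ?_⟩
      rintro _ ⟨r, hr, rfl⟩ _ ⟨s, hs, rfl⟩
      exact (hm r hr s hs).trans_lt hk
  rw [e]
  refine MeasurableSet.iInter fun k => MeasurableSet.iUnion fun m => IsClosed.measurableSet ?_
  refine isClosed_iInter fun r => isClosed_iInter fun hr => isClosed_iInter fun s =>
    isClosed_iInter fun hs => ?_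
  have h0 := (radius_mem m).1.le
  exact isClosed_le ((continuous_dilate_sphere hf (h0.trans hr.1.le) hr.2).dist
    (continuous_dilate_sphere hf (h0.trans hs.1.le) hs.2)) continuous_const

/-- Existence of radial limits almost everywhere. -/
theorem ae_exists_radial_limit {f : Cn n → ℂ} (hf : DifferentiableOn ℂ f (unitBall n)) {q : ℝ}
    (hq : 0 < q) (hmax : ∫⁻ ξ, radialMax q f ξ ∂(sphereMeasure n) ≠ ∞) :
    ∀ᵐ ξ : unitSphere n ∂(sphereMeasure n),
      ∃ L, Tendsto (fun r : ℝ => f (r • (ξ : Cn n))) (𝓝[<] 1) (𝓝 L) := by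
  apply ae_of_ae_slice (p := fun ξ : unitSphere n =>
    ∃ L, Tendsto (fun r : ℝ => f (r • (ξ : Cn n))) (𝓝[<] 1) (𝓝 L))
    (measurableSet_exists_radial_limit hf.continuousOn)
  have hm := measurable_radialMax (p := q) hf.continuousOn
  have hrot' : Measurable fun p : unitSphere n × ℝ => rot p.2 p.1 :=
    (continuous_rot.comp continuous_swap).measurable
  have hm2 : Measurable fun p : unitSphere n × ℝ => radialMax q f (rot p.2 p.1) :=
    hm.comp hrot'
  -- On almost every slice the maximal function is integrable over the circle and serves as the
  -- majorant required by the one-variable theorem.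
  have hslice : ∀ᵐ ξ ∂(sphereMeasure n), ∫⁻ θ, radialMax q f (rot θ ξ) ∂arcMeasure < ∞ := by
    have hm3 : Measurable fun ξ : unitSphere n => ∫⁻ θ, radialMax q f (rot θ ξ) ∂arcMeasure :=
      hm2.lintegral_prod_right'
    have hfin : ∫⁻ ξ, ∫⁻ θ, radialMax q f (rot θ ξ) ∂arcMeasure ∂(sphereMeasure n) ≠ ∞ := by
      rwa [lintegral_slice hm]
    exact ae_lt_top hm3 hfin
  filter_upwards [hslice] with ξ hξ
  have hmθ : Measurable fun θ : ℝ => radialMax q f (rot θ ξ) :=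
    hm.comp (continuous_rot.comp (by fun_prop : Continuous fun θ : ℝ => (θ, ξ))).measurable
  set g : ℂ → ℝ := fun z => (⨆ r ∈ Ioo (0 : ℝ) 1, ‖f (r • z • (ξ : Cn n))‖ₑ ^ q).toReal
  have hg : ∀ θ, g (circleMap 0 1 θ) = (radialMax q f (rot θ ξ)).toReal := fun θ => by
    simp only [g, radialMax, coe_rot]
  have hint : CircleIntegrable g 0 1 := by
    rw [circleIntegrable_iff_integrable_arcMeasure]
    simp_rw [hg]
    exact integrable_toReal_of_lintegral_ne_top hmθ.aemeasurable hξ.ne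
  have hlim := ae_exists_radial_limit_of_dominated (differentiableOn_slice hf ξ) hq hint
    (fun θ => ENNReal.toReal_nonneg) ?_
  · filter_upwards [hlim] with θ ⟨L, hL⟩
    have e : (fun r : ℝ => f (r • (rot θ ξ : Cn n))) =
        fun r : ℝ => f (((r : ℂ) * circleMap 0 1 θ) • (ξ : Cn n)) := by
      ext1 r; rw [rot_smul]
    rw [e]
    exact ⟨L, hL⟩
  · intro r hr
    filter_upwards [ae_lt_top hmθ hξ.ne] with θ hθ
    rw [hg, ← rot_smul, ← ENNReal.ofReal_le_iff_le_toReal hθ.ne, ofReal_norm_rpow _ hq.le]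
    exact le_radialMax q f _ hr

theorem MemHardy.lintegral_radialMax_ne_top (hn : 1 ≤ n) {q : ℝ} (hq : 0 < q) {f : Cn n → ℂ}
    (hf : MemHardy q f) : ∫⁻ ξ, radialMax q f ξ ∂(sphereMeasure n) ≠ ∞ := by
  obtain ⟨C, hC⟩ := exists_lintegral_radialMax_le hn hq
  refine ne_top_of_le_ne_top (ENNReal.mul_ne_top ENNReal.coe_ne_top ?_) (hC f hf.1)
  intro h
  have := hf.2
  rw [hardyNorm, h, ENNReal.top_rpow_of_pos (by positivity)] at this
  exact lt_irrefl _ this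

theorem tendsto_radialLimit {F : Type*} [TopologicalSpace F] [Nonempty F]
    {f : Cn n → F} {ξ : unitSphere n}
    (h : ∃ L, Tendsto (fun r : ℝ => f (r • (ξ : Cn n))) (𝓝[<] 1) (𝓝 L)) :
    Tendsto (fun r : ℝ => f (r • (ξ : Cn n))) (𝓝[<] 1) (𝓝 (radialLimit f ξ)) :=
  tendsto_nhds_limUnder h

/-- The means over spheres are dominated by the mean of the radial limit. -/
theorem lintegral_sphere_le_radialLimit {f : Cn n → ℂ} (hf : DifferentiableOn ℂ f (unitBall n))
    {q : ℝ} (hq : 0 < q) (hmax : ∫⁻ ξ, radialMax q f ξ ∂(sphereMeasure n) ≠ ∞)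
    {t : ℝ} (ht : t ∈ Ioo (0 : ℝ) 1) :
    ∫⁻ ξ : unitSphere n, ‖f (t • (ξ : Cn n))‖ₑ ^ q ∂(sphereMeasure n) ≤
      ∫⁻ ξ, ‖radialLimit f ξ‖ₑ ^ q ∂(sphereMeasure n) := by
  have hlim : Tendsto (fun k => ∫⁻ ξ : unitSphere n, ‖f (radius k • (ξ : Cn n))‖ₑ ^ q
      ∂(sphereMeasure n)) atTop (𝓝 (∫⁻ ξ, ‖radialLimit f ξ‖ₑ ^ q ∂(sphereMeasure n))) := by
    -- The integrable maximal function dominates, so the means converge to the boundary integral;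
    -- being increasing in the radius, they stay below it.
    refine tendsto_lintegral_of_dominated_convergence (radialMax q f) (fun k => ?_)
      (fun k => Eventually.of_forall fun ξ => le_radialMax q f ξ (radius_mem k)) hmax ?_
    · exact (continuous_dilate_sphere hf.continuousOn (radius_mem k).1.le
        (radius_mem k).2).enorm.measurable.pow_const q
    · filter_upwards [ae_exists_radial_limit hf hq hmax] with ξ hξ
      have := ((tendsto_radialLimit hξ).comp tendsto_radius).enorm
      exact (ENNReal.continuous_rpow_const.tendsto _).comp this
  refine ge_of_tendsto hlim ?_
  filter_upwards [(tendsto_radius.mono_right nhdsWithin_le_nhds).eventually (lt_mem_nhds ht.2)]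
    with k hk
  exact lintegral_sphere_mono hf hq ht.1.le hk.le (radius_mem k).2

theorem lintegral_radialLimit_le {f : Cn n → ℂ} (hf : DifferentiableOn ℂ f (unitBall n))
    {q : ℝ} (hq : 0 < q) (hmax : ∫⁻ ξ, radialMax q f ξ ∂(sphereMeasure n) ≠ ∞) :
    ∫⁻ ξ, ‖radialLimit f ξ‖ₑ ^ q ∂(sphereMeasure n) ≠ ∞ := by
  refine ne_top_of_le_ne_top hmax (lintegral_mono_ae ?_)
  filter_upwards [ae_exists_radial_limit hf hq hmax] with ξ hξ
  have h := ((tendsto_radialLimit hξ).comp tendsto_radius).enorm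
  refine le_of_tendsto ((ENNReal.continuous_rpow_const.tendsto _).comp h)
    (Eventually.of_forall fun k => le_radialMax q f ξ (radius_mem k))

theorem aemeasurable_radialLimit {F : Type*} [NormedAddCommGroup F] [MeasurableSpace F]
    [BorelSpace F] {f : Cn n → F} (hf : ContinuousOn f (unitBall n))
    (h : ∀ᵐ ξ : unitSphere n ∂(sphereMeasure n),
      ∃ L, Tendsto (fun r : ℝ => f (r • (ξ : Cn n))) (𝓝[<] 1) (𝓝 L)) :
    AEMeasurable (radialLimit f) (sphereMeasure n) := by
  refine aemeasurable_of_tendsto_metrizable_ae atTop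
    (f := fun (k : ℕ) (ξ : unitSphere n) => f (radius k • (ξ : Cn n))) (fun k => ?_) ?_
  · exact (continuous_dilate_sphere hf (radius_mem k).1.le
        (radius_mem k).2).measurable.aemeasurable
  · filter_upwards [h] with ξ hξ
    exact (tendsto_radialLimit hξ).comp tendsto_radius

end RadialLimits

/-! ### Hardy norms and Fatou's lemma. -/

section HardyNorm

variable {n : ℕ}

theorem lintegral_le_of_ae_tendsto {α : Type*} [MeasurableSpace α] {μ : Measure α}
    {g : ℕ → α → ℝ≥0∞} {G : α → ℝ≥0∞} {B : ℝ≥0∞} (hg : ∀ k, AEMeasurable (g k) μ)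
    (hB : ∀ k, ∫⁻ x, g k x ∂μ ≤ B) (h : ∀ᵐ x ∂μ, Tendsto (fun k => g k x) atTop (𝓝 (G x))) :
    ∫⁻ x, G x ∂μ ≤ B :=
  calc ∫⁻ x, G x ∂μ = ∫⁻ x, liminf (fun k => g k x) atTop ∂μ :=
        lintegral_congr_ae (h.mono fun _ hx => hx.liminf_eq.symm)
    _ ≤ liminf (fun k => ∫⁻ x, g k x ∂μ) atTop := lintegral_liminf_le' hg
    _ ≤ B := liminf_le_of_frequently_le' (Frequently.of_forall hB)

theorem lintegral_le_hardyNorm {p : ℝ} (hp : 0 < p) (f : Cn n → ℂ) {r : ℝ}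
    (hr : r ∈ Ioo (0 : ℝ) 1) :
    ∫⁻ ξ : unitSphere n, ‖f (r • (ξ : Cn n))‖ₑ ^ p ∂(sphereMeasure n) ≤ hardyNorm p f ^ p := by
  rw [hardyNorm, ← ENNReal.rpow_mul, one_div_mul_cancel hp.ne', ENNReal.rpow_one]
  exact le_iSup₂ (f := fun r (_ : r ∈ Ioo (0 : ℝ) 1) =>
    ∫⁻ ξ : unitSphere n, ‖f (r • (ξ : Cn n))‖ₑ ^ p ∂(sphereMeasure n)) r hr

theorem hardyNorm_le {p : ℝ} (hp : 0 < p) {f : Cn n → ℂ} {B : ℝ≥0∞}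
    (h : ∀ r ∈ Ioo (0 : ℝ) 1,
      ∫⁻ ξ : unitSphere n, ‖f (r • (ξ : Cn n))‖ₑ ^ p ∂(sphereMeasure n) ≤ B ^ p) :
    hardyNorm p f ≤ B := by
  rw [hardyNorm, one_div, ENNReal.rpow_inv_le_iff hp]
  exact iSup₂_le h

end HardyNorm

/-! ### Radial limits of self-maps and the pullback measure. -/

section Pullback

variable {n : ℕ}

/-- Each coordinate is bounded by `1`, so its maximal function is integrable, and the finitely many
exceptional null sets are united. -/
theorem IsHolomorphicSelfMap.ae_exists_radial_limit {φ : Cn n → Cn n}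
    (hφ : IsHolomorphicSelfMap φ) : ∀ᵐ ξ : unitSphere n ∂(sphereMeasure n),
      ∃ L, Tendsto (fun r : ℝ => φ (r • (ξ : Cn n))) (𝓝[<] 1) (𝓝 L) := by
  have hcoord : ∀ i : Fin n, ∀ᵐ ξ : unitSphere n ∂(sphereMeasure n),
      ∃ L, Tendsto (fun r : ℝ => φ (r • (ξ : Cn n)) i) (𝓝[<] 1) (𝓝 L) := by
    intro i
    refine BallHardy.ae_exists_radial_limit (f := fun z => φ z i) (q := 1) ?_ one_pos ?_
    · exact (EuclideanSpace.proj (𝕜 := ℂ) i).differentiable.comp_differentiableOn hφ.1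
    · refine ne_top_of_le_ne_top (measure_ne_top (sphereMeasure n) univ) ?_
      rw [← lintegral_one]
      refine lintegral_mono fun ξ => iSup₂_le fun r hr => ?_
      rw [ENNReal.rpow_one, ← ofReal_norm, ENNReal.ofReal_le_one]
      have h1 : ‖φ (r • (ξ : Cn n))‖ < 1 := by
        simpa using hφ.2 (real_smul_mem_unitBall hr.1.le hr.2 ξ)
      exact (PiLp.norm_apply_le _ i).trans h1.le
  filter_upwards [ae_all_iff.2 hcoord] with ξ hξ
  choose L hL using hξ
  refine ⟨WithLp.toLp 2 L, ?_⟩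
  exact ((PiLp.continuous_toLp 2 _).tendsto L).comp (tendsto_pi_nhds.2 hL)

theorem IsHolomorphicSelfMap.radialLimit_mem {φ : Cn n → Cn n} (hφ : IsHolomorphicSelfMap φ)
    {ξ : unitSphere n} (h : ∃ L, Tendsto (fun r : ℝ => φ (r • (ξ : Cn n))) (𝓝[<] 1) (𝓝 L)) :
    radialLimit φ ξ ∈ closedUnitBall n :=
  Metric.isClosed_closedBall.mem_of_tendsto ((tendsto_radialLimit h).comp tendsto_radius)
    (Eventually.of_forall fun k => Metric.ball_subset_closedBall
      (hφ.2 (real_smul_mem_unitBall (radius_mem k).1.le (radius_mem k).2 ξ)))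

theorem IsHolomorphicSelfMap.ae_radialLimit_mem {φ : Cn n → Cn n} (hφ : IsHolomorphicSelfMap φ) :
    ∀ᵐ ξ ∂(sphereMeasure n), radialLimit φ ξ ∈ closedUnitBall n :=
  hφ.ae_exists_radial_limit.mono fun _ => hφ.radialLimit_mem

theorem IsHolomorphicSelfMap.aemeasurable_radialLimit {φ : Cn n → Cn n}
    (hφ : IsHolomorphicSelfMap φ) : AEMeasurable (radialLimit φ) (sphereMeasure n) :=
  BallHardy.aemeasurable_radialLimit hφ.1.continuousOn hφ.ae_exists_radial_limit

variable {q : ℝ} {φ : Cn n → Cn n} {ψ : Cn n → ℂ}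

theorem MemHardy.ae_exists_radial_limit (hn : 1 ≤ n) (hq : 0 < q) (hψ : MemHardy q ψ) :
    ∀ᵐ ξ : unitSphere n ∂(sphereMeasure n),
      ∃ L, Tendsto (fun r : ℝ => ψ (r • (ξ : Cn n))) (𝓝[<] 1) (𝓝 L) :=
  BallHardy.ae_exists_radial_limit hψ.1 hq (hψ.lintegral_radialMax_ne_top hn hq)

theorem MemHardy.aemeasurable_radialLimit (hn : 1 ≤ n) (hq : 0 < q) (hψ : MemHardy q ψ) :
    AEMeasurable (radialLimit ψ) (sphereMeasure n) :=
  BallHardy.aemeasurable_radialLimit hψ.1.continuousOn (hψ.ae_exists_radial_limit hn hq)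

/-- The change of variables formula for the pullback measure. -/
theorem setLIntegral_pullbackMeasure (hn : 1 ≤ n) (hq : 0 < q) (hφ : IsHolomorphicSelfMap φ)
    (hψ : MemHardy q ψ) {F : Cn n → ℝ≥0∞} (hF : ContinuousOn F (closedUnitBall n)) :
    ∫⁻ w in closedUnitBall n, F w ∂(pullbackMeasure ψ φ q) =
      ∫⁻ ξ, ‖radialLimit ψ ξ‖ₑ ^ q * F (radialLimit φ ξ) ∂(sphereMeasure n) := by
  have hd : AEMeasurable (fun ξ : unitSphere n => ‖radialLimit ψ ξ‖ₑ ^ q) (sphereMeasure n) :=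
    (hψ.aemeasurable_radialLimit hn hq).enorm.pow_const q
  have hac := withDensity_absolutelyContinuous (sphereMeasure n)
    fun ξ : unitSphere n => ‖radialLimit ψ ξ‖ₑ ^ q
  have hφm := hφ.aemeasurable_radialLimit
  have hφm' : AEMeasurable (radialLimit φ)
      ((sphereMeasure n).withDensity fun ξ => ‖radialLimit ψ ξ‖ₑ ^ q) := hφm.mono_ac hac
  have hmem : ∀ᵐ w ∂(pullbackMeasure ψ φ q), w ∈ closedUnitBall n :=
    (ae_map_iff hφm' Metric.isClosed_closedBall.measurableSet).2
      (hac.ae_le hφ.ae_radialLimit_mem)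
  have hres : (pullbackMeasure ψ φ q).restrict (closedUnitBall n) = pullbackMeasure ψ φ q :=
    Measure.restrict_eq_self_of_ae_mem hmem
  have hFm : AEMeasurable F (pullbackMeasure ψ φ q) := by
    rw [← hres]
    exact hF.aemeasurable Metric.isClosed_closedBall.measurableSet
  have hmap : (sphereMeasure n).map (radialLimit φ) (closedUnitBall n)ᶜ = 0 :=
    (ae_map_iff hφm Metric.isClosed_closedBall.measurableSet).2 hφ.ae_radialLimit_mem
  have hFφ : AEMeasurable (fun ξ => F (radialLimit φ ξ)) (sphereMeasure n) := by
    refine AEMeasurable.comp_aemeasurable (g := F) ?_ hφm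
    rw [← Measure.restrict_eq_self_of_ae_mem (s := closedUnitBall n) hmap]
    exact hF.aemeasurable Metric.isClosed_closedBall.measurableSet
  rw [hres, pullbackMeasure, lintegral_map' hFm hφm',
    lintegral_withDensity_eq_lintegral_mul₀ hd hFφ]
  rfl

/-- The density `|ψ*|^q` is dominated by the integrable maximal function of `ψ`. -/
theorem isFiniteMeasure_pullbackMeasure (hn : 1 ≤ n) (hq : 0 < q) (φ : Cn n → Cn n)
    (hψ : MemHardy q ψ) : IsFiniteMeasure (pullbackMeasure ψ φ q) := by
  have := isFiniteMeasure_withDensity (μ := sphereMeasure n)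
    (f := fun ξ : unitSphere n => ‖radialLimit ψ ξ‖ₑ ^ q)
    (lintegral_radialLimit_le hψ.1 hq (hψ.lintegral_radialMax_ne_top hn hq))
  rw [pullbackMeasure]
  infer_instance

end Pullback

/-! ### From the kernel condition to the Carleson condition. -/

section Kernel

variable {n : ℕ}

theorem norm_one_sub_inner_pos {z w : Cn n} (hz : ‖z‖ < 1) (hw : ‖w‖ ≤ 1) :
    0 < ‖1 - inner ℂ z w‖ := by
  refine norm_pos_iff.2 (one_sub_ne_zero_of_norm_lt ((norm_inner_le_norm _ _).trans_lt ?_))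
  nlinarith [norm_nonneg z, norm_nonneg w]

/-- With the pole at `(1 - h/2) ξ`, the numerator base is at least `h / 2` and `|1 - ⟨w, z⟩| ≤ 3h/2`
on `S_h(ξ)`. The kernel is thus at least `(2/9)^κ h^{-κ}` there, and Chebyshev's inequality
concludes. -/
theorem isCarlesonMeasure_of_kernel_le {β : ℝ} (hβ : 0 < β) {μ : Measure (Cn n)}
    [IsFiniteMeasure μ]
    (hker : (⨆ z ∈ unitBall n, ∫⁻ w in closedUnitBall n,
      ENNReal.ofReal ((1 - ‖z‖ ^ 2) ^ ((n : ℝ) * β) /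
        ‖1 - inner ℂ z w‖ ^ (2 * ((n : ℝ) * β))) ∂μ) < ∞) :
    IsCarlesonMeasure β μ := by
  set S := ⨆ z ∈ unitBall n, ∫⁻ w in closedUnitBall n,
      ENNReal.ofReal ((1 - ‖z‖ ^ 2) ^ ((n : ℝ) * β) /
        ‖1 - inner ℂ z w‖ ^ (2 * ((n : ℝ) * β))) ∂μ
  set κ := (n : ℝ) * β
  have hκ : 0 ≤ κ := by positivity
  refine ⟨inferInstance, (ENNReal.ofReal ((9 / 2 : ℝ) ^ κ) * S).toNNReal, fun ξ hξ h hh => ?_⟩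
  rw [ENNReal.coe_toNNReal (ENNReal.mul_ne_top ENNReal.ofReal_ne_top hker.ne)]
  have hξ1 : ‖ξ‖ = 1 := by simpa using hξ
  obtain ⟨h0, h2⟩ := hh
  set z : Cn n := (1 - h / 2) • ξ with hz
  have hzn : ‖z‖ = 1 - h / 2 := by
    rw [hz, norm_smul, hξ1, mul_one, Real.norm_of_nonneg (by linarith)]
  have hz1 : ‖z‖ < 1 := by linarith
  have hpt : ∀ w ∈ carlesonSet ξ h, ENNReal.ofReal ((2 / 9 : ℝ) ^ κ * (h ^ κ)⁻¹) ≤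
      ENNReal.ofReal ((1 - ‖z‖ ^ 2) ^ κ / ‖1 - inner ℂ z w‖ ^ (2 * κ)) := by
    intro w hw
    have hw1 : ‖w‖ ≤ 1 := by simpa using hw.1
    have hd0 := norm_one_sub_inner_pos hz1 hw1
    have hd : ‖1 - inner ℂ z w‖ ≤ 3 * h / 2 := by
      have e : (1 : ℂ) - inner ℂ z w = (1 - inner ℂ ξ w) + ((h / 2 : ℝ) : ℂ) * inner ℂ ξ w := by
        rw [hz, ← Complex.coe_smul, inner_smul_left, Complex.conj_ofReal]
        push_cast; ring
      rw [e]
      refine (norm_add_le _ _).trans ?_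
      rw [norm_mul, Complex.norm_real, Real.norm_of_nonneg (by linarith)]
      have h3 := norm_inner_le_one hξ1.le hw1
      have h4 := hw.2
      nlinarith
    refine ENNReal.ofReal_le_ofReal ?_
    have e : (2 / 9 : ℝ) ^ κ * (h ^ κ)⁻¹ = (h / 2) ^ κ / (3 * h / 2) ^ (2 * κ) := by
      rw [Real.rpow_mul (show (0 : ℝ) ≤ 3 * h / 2 by positivity) 2 κ,
        ← Real.div_rpow (by positivity) (by positivity), ← Real.inv_rpow h0.le,
        ← Real.mul_rpow (by positivity) (by positivity)]
      congr 1
      rw [Real.rpow_two]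
      field_simp
      norm_num
    rw [e]
    have h5 : h / 2 ≤ 1 - ‖z‖ ^ 2 := by rw [hzn]; nlinarith
    have h6 : 0 ≤ 1 - ‖z‖ ^ 2 := by linarith
    gcongr
  have hle : ENNReal.ofReal ((2 / 9 : ℝ) ^ κ * (h ^ κ)⁻¹) * μ (carlesonSet ξ h) ≤ S := by
    rw [← setLIntegral_const]
    calc _ ≤ ∫⁻ w in carlesonSet ξ h,
          ENNReal.ofReal ((1 - ‖z‖ ^ 2) ^ κ / ‖1 - inner ℂ z w‖ ^ (2 * κ)) ∂μ :=
          setLIntegral_mono' (measurableSet_carlesonSet _ _) hpt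
      _ ≤ ∫⁻ w in closedUnitBall n,
          ENNReal.ofReal ((1 - ‖z‖ ^ 2) ^ κ / ‖1 - inner ℂ z w‖ ^ (2 * κ)) ∂μ :=
          lintegral_mono_set fun w hw => hw.1
      _ ≤ S := le_iSup₂ (f := fun z (_ : z ∈ unitBall n) => ∫⁻ w in closedUnitBall n,
          ENNReal.ofReal ((1 - ‖z‖ ^ 2) ^ κ / ‖1 - inner ℂ z w‖ ^ (2 * κ)) ∂μ) z (by simpa using hz1)
  have hone : ENNReal.ofReal ((9 / 2 : ℝ) ^ κ) * ENNReal.ofReal (h ^ κ) *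
      ENNReal.ofReal ((2 / 9 : ℝ) ^ κ * (h ^ κ)⁻¹) = 1 := by
    rw [← ENNReal.ofReal_mul (by positivity), ← ENNReal.ofReal_mul (by positivity),
      ← ENNReal.ofReal_one]
    congr 1
    have e : (9 / 2 : ℝ) ^ κ * (2 / 9 : ℝ) ^ κ = 1 := by
      rw [← Real.mul_rpow (by positivity) (by positivity)]; norm_num
    have hp : (h ^ κ) ≠ 0 := (Real.rpow_pos_of_pos h0 _).ne'
    calc _ = ((9 / 2 : ℝ) ^ κ * (2 / 9 : ℝ) ^ κ) * (h ^ κ * (h ^ κ)⁻¹) := by ring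
      _ = 1 := by rw [e, mul_inv_cancel₀ hp, one_mul]
  set a := ENNReal.ofReal ((9 / 2 : ℝ) ^ κ)
  set b := ENNReal.ofReal (h ^ κ)
  set c := ENNReal.ofReal ((2 / 9 : ℝ) ^ κ * (h ^ κ)⁻¹)
  calc μ (carlesonSet ξ h) = (a * b * c) * μ (carlesonSet ξ h) := by rw [hone, one_mul]
    _ = a * b * (c * μ (carlesonSet ξ h)) := by ring
    _ ≤ a * b * S := by gcongr
    _ = a * S * b := by ring

end Kernel

/-! ### Hardy norms of the test functions. -/

section TestFunctions

variable {n : ℕ}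

/-- The radius `2 / (1 + |z|)` exceeds `1`, yet `|z|` times it is below `1`, so the singularity of
the kernel is avoided. -/
theorem differentiableOn_testFunction {z : Cn n} (hz : ‖z‖ < 1) (κ : ℝ) :
    1 < 2 / (1 + ‖z‖) ∧
      DifferentiableOn ℂ (testFunction z κ) (Metric.ball 0 (2 / (1 + ‖z‖))) := by
  have h0 : 0 < 1 + ‖z‖ := by positivity
  refine ⟨by rw [one_lt_div h0]; linarith, fun w hw => ?_⟩
  refine (differentiableAt_testFunction hz ?_ κ).differentiableWithinAt
  have hw1 : ‖w‖ < 2 / (1 + ‖z‖) := by simpa using hw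
  rw [lt_div_iff₀ h0] at hw1
  refine (norm_inner_le_norm _ _).trans_lt ?_
  nlinarith [norm_nonneg z, norm_nonneg w]

/-- The Hardy norms of the test functions. -/
theorem exists_hardyNorm_testFunction_le (hn : 1 ≤ n) {p : ℝ} (hp : 0 < p) :
    ∃ C : ℝ≥0, ∀ z : Cn n, ‖z‖ < 1 → MemHardy p (testFunction z (2 * n / p)) ∧
      hardyNorm p (testFunction z (2 * n / p)) ^ p ≤
        C * ENNReal.ofReal ((1 - ‖z‖ ^ 2) ^ (n : ℝ)) := by
  have hn0 : (0 : ℝ) < n := by exact_mod_cast hn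
  obtain ⟨M, hM⟩ := exists_sphereMeasure_quasiBall_le hn
  obtain ⟨C, hC⟩ := exists_lintegral_kernel_le (n := n) (κ := (n : ℝ)) hn0
  refine ⟨C * M, fun z hz => ?_⟩
  set f := testFunction z (2 * n / p)
  obtain ⟨hR, hf⟩ := differentiableOn_testFunction hz (2 * n / p)
  obtain ⟨ζ, hζ, e⟩ := exists_eq_smul_sphere hn hz.le
  have hz2 : 0 < 1 - ‖z‖ ^ 2 := by nlinarith [norm_nonneg z]
  have hker : ∫⁻ ξ : unitSphere n, ENNReal.ofReal ((1 - ‖z‖ ^ 2) ^ (n : ℝ) /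
      ‖1 - inner ℂ z (ξ : Cn n)‖ ^ (2 * (n : ℝ))) ∂(sphereMeasure n) ≤ C * M := by
    -- The surface measure satisfies the growth condition with `κ = n`, so the Poisson–Szegő kernel
    -- has bounded total mass.
    have h1 := hC ((sphereMeasure n).map Subtype.val) ζ hζ (1 - ‖z‖)
      ⟨by linarith, by linarith [norm_nonneg z]⟩ M (fun t ht => ?_) z e
    · have hKm : Measurable fun w : Cn n => ENNReal.ofReal ((1 - ‖z‖ ^ 2) ^ (n : ℝ) /
          ‖1 - inner ℂ z w‖ ^ (2 * (n : ℝ))) := by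
        refine ENNReal.measurable_ofReal.comp (measurable_const.div (Measurable.pow_const ?_ _))
        exact (by fun_prop : Continuous fun w : Cn n => ‖1 - inner ℂ z w‖).measurable
      rw [setLIntegral_map Metric.isClosed_closedBall.measurableSet hKm measurable_subtype_coe] at h1
      rwa [coe_preimage_closedUnitBall, setLIntegral_univ] at h1
    · rw [Measure.map_apply measurable_subtype_coe (measurableSet_carlesonSet _ _),
        coe_preimage_carlesonSet,
        Real.rpow_natCast]
      exact hM ζ hζ t (by linarith)
  have hbd : ∫⁻ ξ : unitSphere n, ‖f ξ‖ₑ ^ p ∂(sphereMeasure n) ≤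
      (C * M : ℝ≥0) * ENNReal.ofReal ((1 - ‖z‖ ^ 2) ^ (n : ℝ)) := by
    calc _ = ENNReal.ofReal ((1 - ‖z‖ ^ 2) ^ (n : ℝ)) * ∫⁻ ξ : unitSphere n,
          ENNReal.ofReal ((1 - ‖z‖ ^ 2) ^ (n : ℝ) /
            ‖1 - inner ℂ z (ξ : Cn n)‖ ^ (2 * (n : ℝ))) ∂(sphereMeasure n) := by
          rw [← lintegral_const_mul' _ _ ENNReal.ofReal_ne_top]
          refine lintegral_congr fun ξ => ?_
          have hd := norm_one_sub_inner_pos hz (norm_unitSphere ξ).le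
          rw [← ofReal_norm_rpow _ hp.le, ← ENNReal.ofReal_mul (by positivity)]
          congr 1
          simp only [f]
          rw [norm_testFunction hz, ← Real.rpow_mul (by positivity), div_mul_cancel₀ _ hp.ne',
            Real.div_rpow hz2.le hd.le, two_mul, Real.rpow_add hz2, mul_div_assoc]
      _ ≤ ENNReal.ofReal ((1 - ‖z‖ ^ 2) ^ (n : ℝ)) * (C * M) := by gcongr
      _ = _ := by push_cast; ring
  have hnorm : hardyNorm p f ≤
      ((C * M : ℝ≥0) * ENNReal.ofReal ((1 - ‖z‖ ^ 2) ^ (n : ℝ))) ^ (1 / p) := by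
    refine hardyNorm_le hp fun r hr => ?_
    rw [← ENNReal.rpow_mul, one_div_mul_cancel hp.ne', ENNReal.rpow_one]
    exact (lintegral_sphere_le_boundary hR hf hp hr.1.le hr.2.le).trans hbd
  refine ⟨⟨hf.mono (Metric.ball_subset_ball hR.le), hnorm.trans_lt ?_⟩, ?_⟩
  · exact ENNReal.rpow_lt_top_of_nonneg (by positivity)
      (ENNReal.mul_ne_top ENNReal.coe_ne_top ENNReal.ofReal_ne_top)
  · refine (ENNReal.rpow_le_rpow hnorm hp.le).trans_eq ?_
    rw [← ENNReal.rpow_mul, one_div_mul_cancel hp.ne', ENNReal.rpow_one]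

end TestFunctions

/-! ### Boundary integrals of the weighted composition, and the implications through (ii). -/

section WeightedComposition

variable {n : ℕ} {p q : ℝ} {φ : Cn n → Cn n} {ψ : Cn n → ℂ}

/-- The Fatou inequality for the weighted composition of a function continuous on the closed
ball. -/
theorem lintegral_radialLimit_weightedComp_le (hn : 1 ≤ n) (hq : 0 < q)
    (hφ : IsHolomorphicSelfMap φ) (hψ : MemHardy q ψ) {f : Cn n → ℂ}
    {R : ℝ} (hR : 1 < R) (hf : DifferentiableOn ℂ f (Metric.ball 0 R)) :
    ∫⁻ w in closedUnitBall n, ‖f w‖ₑ ^ q ∂(pullbackMeasure ψ φ q) ≤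
      hardyNorm q (weightedComp ψ φ f) ^ q := by
  have hcl : closedUnitBall n ⊆ Metric.ball 0 R := Metric.closedBall_subset_ball hR
  have hfc : ContinuousOn f (closedUnitBall n) := hf.continuousOn.mono hcl
  rw [setLIntegral_pullbackMeasure hn hq hφ hψ (F := fun w => ‖f w‖ₑ ^ q)
    (ENNReal.continuous_rpow_const.comp_continuousOn hfc.enorm)]
  refine lintegral_le_of_ae_tendsto (g := fun k (ξ : unitSphere n) =>
    ‖weightedComp ψ φ f (radius k • (ξ : Cn n))‖ₑ ^ q) (fun k => ?_)
    (fun k => lintegral_le_hardyNorm hq _ (radius_mem k)) ?_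
  · have hc : ContinuousOn (weightedComp ψ φ f) (unitBall n) :=
      hψ.1.continuousOn.mul (hfc.comp hφ.1.continuousOn
        fun z hz => Metric.ball_subset_closedBall (hφ.2 hz))
    exact ((continuous_dilate_sphere hc (radius_mem k).1.le
      (radius_mem k).2).enorm.measurable.pow_const q).aemeasurable
  · filter_upwards [hψ.ae_exists_radial_limit hn hq, hφ.ae_exists_radial_limit] with ξ h1 h2
    have hmem := hφ.radialLimit_mem h2
    have t1 := (tendsto_radialLimit h1).comp tendsto_radius
    have t2 := (tendsto_radialLimit h2).comp tendsto_radius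
    have hfa : ContinuousAt f (radialLimit φ ξ) :=
      hf.continuousOn.continuousAt (Metric.isOpen_ball.mem_nhds (hcl hmem))
    have t3 := (t1.mul (hfa.tendsto.comp t2)).enorm
    have t4 := (ENNReal.continuous_rpow_const (y := q)).tendsto _ |>.comp t3
    rw [enorm_mul, ENNReal.mul_rpow_of_nonneg _ _ hq.le] at t4
    exact t4

/-- The means of the weighted composition with a function holomorphic across the sphere. -/
theorem lintegral_weightedComp_le (hn : 1 ≤ n) (hq : 0 < q)
    (hφ : IsHolomorphicSelfMap φ) (hψ : MemHardy q ψ) {f : Cn n → ℂ}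
    {R : ℝ} (hR : 1 < R) (hf : DifferentiableOn ℂ f (Metric.ball 0 R)) {t : ℝ}
    (ht : t ∈ Ioo (0 : ℝ) 1) :
    ∫⁻ ξ : unitSphere n, ‖weightedComp ψ φ f (t • (ξ : Cn n))‖ₑ ^ q ∂(sphereMeasure n) ≤
      ∫⁻ w in closedUnitBall n, ‖f w‖ₑ ^ q ∂(pullbackMeasure ψ φ q) := by
  have hcl : closedUnitBall n ⊆ Metric.ball 0 R := Metric.closedBall_subset_ball hR
  have hfc : ContinuousOn f (closedUnitBall n) := hf.continuousOn.mono hcl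
  have hW : DifferentiableOn ℂ (weightedComp ψ φ f) (unitBall n) :=
    hψ.1.mul (hf.comp hφ.1 fun z hz => hcl (Metric.ball_subset_closedBall (hφ.2 hz)))
  -- `f` is bounded on the closed ball, so the maximal function of the product is a constant
  -- multiple of that of `ψ`. The means are then controlled by the radial limit.
  have hmax : ∫⁻ ξ, radialMax q (weightedComp ψ φ f) ξ ∂(sphereMeasure n) ≠ ∞ := by
    obtain ⟨K, hK⟩ := (ProperSpace.isCompact_closedBall (0 : Cn n) 1).exists_bound_of_continuousOn
      hfc
    refine ne_top_of_le_ne_top (ENNReal.mul_ne_top (enorm_rpow_ne_top (K : ℂ) hq.le)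
      (hψ.lintegral_radialMax_ne_top hn hq)) ?_
    rw [← lintegral_const_mul' _ _ (enorm_rpow_ne_top (K : ℂ) hq.le)]
    refine lintegral_mono fun ξ => iSup₂_le fun r hr => ?_
    have h1 := hφ.2 (real_smul_mem_unitBall hr.1.le hr.2 ξ)
    have h2 : ‖f (φ (r • (ξ : Cn n)))‖ₑ ≤ ‖(K : ℂ)‖ₑ := by
      rw [← ofReal_norm, ← ofReal_norm, Complex.norm_real]
      exact ENNReal.ofReal_le_ofReal
        ((hK _ (Metric.ball_subset_closedBall h1)).trans (le_abs_self K))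
    rw [weightedComp, enorm_mul, ENNReal.mul_rpow_of_nonneg _ _ hq.le, mul_comm]
    exact mul_le_mul' (ENNReal.rpow_le_rpow h2 hq.le) (le_radialMax q ψ ξ hr)
  refine (lintegral_sphere_le_radialLimit hW hq hmax ht).trans_eq ?_
  rw [setLIntegral_pullbackMeasure hn hq hφ hψ (F := fun w => ‖f w‖ₑ ^ q)
    (ENNReal.continuous_rpow_const.comp_continuousOn hfc.enorm)]
  refine lintegral_congr_ae ?_
  filter_upwards [hψ.ae_exists_radial_limit hn hq, hφ.ae_exists_radial_limit] with ξ h1 h2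
  have hfa : ContinuousAt f (radialLimit φ ξ) :=
    hf.continuousOn.continuousAt (Metric.isOpen_ball.mem_nhds (hcl (hφ.radialLimit_mem h2)))
  have h3 : radialLimit (weightedComp ψ φ f) ξ = radialLimit ψ ξ * f (radialLimit φ ξ) :=
    ((tendsto_radialLimit h1).mul (hfa.tendsto.comp (tendsto_radialLimit h2))).limUnder_eq
  rw [h3, enorm_mul, ENNReal.mul_rpow_of_nonneg _ _ hq.le]

/-- The embedding integrates `f` over the closed ball, where a general `f` has no values on the
sphere. It is used for the dilates of `f`, with a bound uniform in the dilation, and Fatou's lemma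
passes to the limit at each fixed interior radius `t`. -/
theorem isBoundedWeightedComp_of_isCarlesonMeasure (hn : 1 ≤ n) (hp : 0 < p) (hpq : p ≤ q)
    (hφ : IsHolomorphicSelfMap φ) (hψ : MemHardy q ψ)
    (hμ : IsCarlesonMeasure (q / p) (pullbackMeasure ψ φ q)) :
    IsBoundedWeightedComp p q ψ φ := by
  have hq : 0 < q := hp.trans_le hpq
  obtain ⟨C, hC⟩ := exists_carleson_embedding hn hp hpq hμ
  refine ⟨C ^ (1 / q), fun f hf => ?_⟩
  have hW : DifferentiableOn ℂ (weightedComp ψ φ f) (unitBall n) :=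
    hψ.1.mul (hf.1.comp hφ.1 hφ.2)
  have hnorm : hardyNorm q (weightedComp ψ φ f) ≤
      ((C ^ (1 / q) : ℝ≥0) : ℝ≥0∞) * hardyNorm p f := by
    refine hardyNorm_le hq fun t ht => ?_
    have e : (((C ^ (1 / q) : ℝ≥0) : ℝ≥0∞) * hardyNorm p f) ^ q = C * hardyNorm p f ^ q := by
      rw [ENNReal.mul_rpow_of_nonneg _ _ hq.le, ENNReal.coe_rpow_of_nonneg _ (by positivity),
        ← ENNReal.rpow_mul, one_div_mul_cancel hq.ne', ENNReal.rpow_one]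
    rw [e]
    have hdil : ∀ k, DifferentiableOn ℂ (weightedComp ψ φ fun z => f (radius k • z))
        (unitBall n) := fun k => by
      obtain ⟨h1, h2⟩ := differentiableOn_dilate hf.1 (radius_mem k)
      exact hψ.1.mul (h2.comp hφ.1 fun z hz => Metric.ball_subset_ball h1.le (hφ.2 hz))
    refine lintegral_le_of_ae_tendsto (g := fun k (ξ : unitSphere n) =>
      ‖weightedComp ψ φ (fun z => f (radius k • z)) (t • (ξ : Cn n))‖ₑ ^ q) (fun k => ?_)
      (fun k => ?_) (Eventually.of_forall fun ξ => ?_)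
    · exact ((continuous_dilate_sphere (hdil k).continuousOn ht.1.le
        ht.2).enorm.measurable.pow_const q).aemeasurable
    · obtain ⟨h1, h2⟩ := differentiableOn_dilate hf.1 (radius_mem k)
      refine (lintegral_weightedComp_le hn hq hφ hψ h1 h2 ht).trans ((hC _ _ h1 h2).trans ?_)
      refine mul_le_mul_right ((ENNReal.rpow_le_rpow
        (lintegral_le_hardyNorm hp f (radius_mem k)) (by positivity)).trans_eq ?_) _
      rw [← ENNReal.rpow_mul, mul_div_cancel₀ _ hp.ne']
    · have hz := hφ.2 (real_smul_mem_unitBall ht.1.le ht.2 ξ)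
      set w := φ (t • (ξ : Cn n))
      have t1 : Tendsto (fun k => radius k • w) atTop (𝓝 w) := by
        simpa using (tendsto_radius.mono_right nhdsWithin_le_nhds).smul_const w
      have t2 := (hf.1.continuousOn.continuousAt (Metric.isOpen_ball.mem_nhds hz)).tendsto.comp t1
      have t3 := (t2.const_mul (ψ (t • (ξ : Cn n)))).enorm
      exact (ENNReal.continuous_rpow_const.tendsto _).comp t3
  exact ⟨⟨hW, hnorm.trans_lt (ENNReal.mul_lt_top ENNReal.coe_lt_top hf.2)⟩, hnorm⟩

/-- For the test function with exponent `2n/p`, `|f|^q` is `(1 - |z|²)^{nq/p}` times the kernel, and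
`‖f‖_p^q` is bounded by a constant times the same factor, which cancels. -/
theorem kernel_lt_top_of_isBoundedWeightedComp (hn : 1 ≤ n) (hp : 0 < p) (hq : 0 < q)
    (hφ : IsHolomorphicSelfMap φ) (hψ : MemHardy q ψ) (h : IsBoundedWeightedComp p q ψ φ) :
    (⨆ z ∈ unitBall n, ∫⁻ w in closedUnitBall n,
      ENNReal.ofReal ((1 - ‖z‖ ^ 2) ^ ((n : ℝ) * (q / p)) /
        ‖1 - inner ℂ z w‖ ^ (2 * ((n : ℝ) * (q / p)))) ∂(pullbackMeasure ψ φ q)) < ∞ := by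
  obtain ⟨C, hC⟩ := h
  obtain ⟨D, hD⟩ := exists_hardyNorm_testFunction_le hn hp
  have hfin : (C : ℝ≥0∞) ^ q * (D : ℝ≥0∞) ^ (q / p) < ∞ :=
    ENNReal.mul_lt_top (ENNReal.rpow_lt_top_of_nonneg hq.le ENNReal.coe_ne_top)
      (ENNReal.rpow_lt_top_of_nonneg (by positivity) ENNReal.coe_ne_top)
  refine lt_of_le_of_lt (iSup₂_le fun z hz => ?_) hfin
  have hz1 : ‖z‖ < 1 := by simpa using hz
  have hz2 : 0 < 1 - ‖z‖ ^ 2 := by nlinarith [norm_nonneg z]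
  obtain ⟨hf, hfn⟩ := hD z hz1
  obtain ⟨hR, hdiff⟩ := differentiableOn_testFunction hz1 (2 * n / p)
  set f := testFunction z (2 * n / p)
  set κ := (n : ℝ) * (q / p)
  set a := ENNReal.ofReal ((1 - ‖z‖ ^ 2) ^ κ)
  have ha0 : a ≠ 0 := by simp only [a]; positivity
  have h1 : ∫⁻ w in closedUnitBall n, ‖f w‖ₑ ^ q ∂(pullbackMeasure ψ φ q) =
      a * ∫⁻ w in closedUnitBall n, ENNReal.ofReal ((1 - ‖z‖ ^ 2) ^ κ /
        ‖1 - inner ℂ z w‖ ^ (2 * κ)) ∂(pullbackMeasure ψ φ q) := by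
    rw [← lintegral_const_mul' _ _ ENNReal.ofReal_ne_top]
    refine setLIntegral_congr_fun Metric.isClosed_closedBall.measurableSet fun w hw => ?_
    have hd := norm_one_sub_inner_pos hz1 (w := w) (by simpa using hw)
    simp only [f]
    rw [← ofReal_norm_rpow _ hq.le, ← ENNReal.ofReal_mul (by positivity), norm_testFunction hz1,
      ← Real.rpow_mul (by positivity), show 2 * (n : ℝ) / p * q = 2 * κ by simp only [κ]; ring,
      Real.div_rpow hz2.le hd.le]
    nth_rewrite 1 [two_mul]
    rw [Real.rpow_add hz2, mul_div_assoc]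
  have h2 : ∫⁻ w in closedUnitBall n, ‖f w‖ₑ ^ q ∂(pullbackMeasure ψ φ q) ≤
      a * ((C : ℝ≥0∞) ^ q * (D : ℝ≥0∞) ^ (q / p)) := by
    refine (lintegral_radialLimit_weightedComp_le hn hq hφ hψ hR hdiff).trans ?_
    calc _ ≤ (C * hardyNorm p f) ^ q := ENNReal.rpow_le_rpow (hC f hf).2 hq.le
      _ = C ^ q * (hardyNorm p f ^ p) ^ (q / p) := by
        rw [ENNReal.mul_rpow_of_nonneg _ _ hq.le, ← ENNReal.rpow_mul, mul_div_cancel₀ _ hp.ne']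
      _ ≤ C ^ q * (D * ENNReal.ofReal ((1 - ‖z‖ ^ 2) ^ (n : ℝ))) ^ (q / p) := by
        gcongr
      _ = _ := by
        rw [ENNReal.mul_rpow_of_nonneg _ _ (by positivity),
          ENNReal.ofReal_rpow_of_nonneg (by positivity) (by positivity), ← Real.rpow_mul hz2.le]
        simp only [a, κ]
        ring
  rw [h1] at h2
  exact (ENNReal.mul_le_mul_iff_right ha0 ENNReal.ofReal_ne_top).1 h2

end WeightedComposition

end BallHardy

end

/-! ### The equivalence. -/

open BallHardy in
theorem theorem6p1 (n : ℕ) (hn : 1 ≤ n) (p q : ℝ) (hp : 0 < p) (hpq : p ≤ q)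
    (φ : Cn n → Cn n) (hφ : IsHolomorphicSelfMap φ)
    (ψ : Cn n → ℂ) (hψ : MemHardy q ψ) :
    List.TFAE [
      IsCarlesonMeasure (q / p) (pullbackMeasure ψ φ q),
      IsBoundedWeightedComp p q ψ φ,
      (⨆ z ∈ unitBall n, ∫⁻ w in closedUnitBall n,
        ENNReal.ofReal ((1 - ‖z‖ ^ 2) ^ ((n : ℝ) * q / p) /
          ‖1 - inner ℂ z w‖ ^ (2 * (n : ℝ) * q / p)) ∂(pullbackMeasure ψ φ q)) < ∞] := by
  have hq : 0 < q := hp.trans_le hpq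
  have := isFiniteMeasure_pullbackMeasure hn hq φ hψ
  rw [show (n : ℝ) * q / p = (n : ℝ) * (q / p) by ring,
    show 2 * (n : ℝ) * q / p = 2 * ((n : ℝ) * (q / p)) by ring]
  tfae_have 1 → 2 := isBoundedWeightedComp_of_isCarlesonMeasure hn hp hpq hφ hψ
  tfae_have 2 → 3 := kernel_lt_top_of_isBoundedWeightedComp hn hp hq hφ hψ
  tfae_have 3 → 1 := isCarlesonMeasure_of_kernel_le (by positivity)
  tfae_finish
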